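/- Let $(\overline M^2,\overline g)$ be a smooth Riemannian surface with Gauss curvature $K$ and Levi-Civita connection $\overline\nabla$, and let $e^\psi$ be a density on it, with $\psi:\overline M\to\mathbb R$ smooth. For a regular closed curve with unit normal $N$ and geodesic curvature vector $kN=\overline\nabla_s\partial_s\gamma$ ($s$ the arc length), put $k_\psi=k-\langle\overline\nabla\psi,N\rangle$; the curve is called $\psi$-minimal if $k_\psi=0$, and a smooth family of regular closed curves $\gamma(\cdot,t):\mathbb S^1\to\overline M$ is a solution of the $\psi$-mean curvature flow ($\psi$MCF) if $\partial_t\gamma=k_\psi N$. Let $\mathcal I(a)$, for $0\le a<\mathrm{area}(\overline M)\le\infty$, be the isoperimetric profile of $(\overline M,\overline g)$, that is, the infimum of the lengths of the boundaries of the relatively compact smooth domains of area $a$. Suppose that $\mathcal I$ is a well defined continuous function, and that for every $a_0\in[0,\mathrm{area}(\overline M))$, $\lim_{a\to a_0}\mathcal I(a)=0$ implies $a_0=0$. Let $\gamma(\cdot,t)$ be a solution of the $\psi$MCF whose initial condition is a smooth embedded closed curve $\gamma_0:\mathbb S^1\to\overline M$. Suppose that the solution exists for every $t\in[0,\infty)$,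 and that $\gamma(\mathbb S^1,t)\subset U$ for all $t$, where $U\subset\overline M$ is a fixed compact set on which $$|\overline\nabla^jK|\le C_j,\qquad |\overline\nabla^j\psi|\le P_j\quad (j=0,1,2,\dots),\qquad 0<E\le e^\psi\le D$$ for some constants $C_j,P_j,E,D$. Then there is a reparametrization $\widetilde\gamma(u,t)=\gamma(\varphi_t(u),t)$ of the flow, where $\varphi_t$, $t\ge 0$, is a smooth family of orientation preserving diffeomorphisms of $\mathbb S^1$, such that for every $m\in\mathbb N$ there are a sequence $t_k\ge 0$, $t_k\to\infty$, and a smooth regular closed $\psi$-minimal curve to which $\widetilde\gamma(\cdot,t_k)$ converges in the $C^m$ topology as $k\to\infty$. -/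

import Mathlib

open Set Filter Topology Manifold MeasureTheory
open scoped ContDiff BigOperators

noncomputable section

namespace DensityFlow

/-- The model space of surfaces. -/
abbrev Plane : Type := EuclideanSpace ℝ (Fin 2)

/-- A smooth Riemannian metric on the surface `M`. -/
abbrev Metric (M : Type*) [TopologicalSpace M] [ChartedSpace Plane M]
    [IsManifold (𝓡 2) ∞ M] : Type _ :=
  Bundle.ContMDiffRiemannianMetric (𝓡 2) ∞ Plane (fun x : M => TangentSpace (𝓡 2) x)

variable {M : Type*} [TopologicalSpace M] [ChartedSpace Plane M]

/-! ### Local coordinates -/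

/-- The `i`-th coordinate vector of the plane. -/
def stdVec (i : Fin 2) : Plane := EuclideanSpace.single i (1 : ℝ)

/-- Partial derivative `∂ᵢ f` of a function on the plane. -/
def partialD (i : Fin 2) (f : Plane → ℝ) (y : Plane) : ℝ := fderiv ℝ f y (stdVec i)

/-- Coordinate vector field `∂ᵢ` of the preferred chart at `p`, at the point with coordinates
`y`. -/
def coordField (p : M) (y : Plane) (i : Fin 2) :
    TangentSpace (𝓡 2) ((extChartAt (𝓡 2) p).symm y) :=
  mfderiv 𝓘(ℝ, Plane) (𝓡 2) (extChartAt (𝓡 2) p).symm y (stdVec i)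

/-! ### Closed curves

A closed curve is a `2π`-periodic map from the line. The tangent space at a point `x` is, by
definition, the plane, a vector being given by its components in the preferred chart at `x`. -/

/-- Velocity vector `∂_θ c`. -/
def velocity (c : ℝ → M) (θ : ℝ) : TangentSpace (𝓡 2) (c θ) :=
  mfderiv 𝓘(ℝ, ℝ) (𝓡 2) c θ (1 : ℝ)

/-- Smooth regular closed curve: an immersion of the circle `ℝ / 2πℤ`. -/
structure IsClosedCurve (c : ℝ → M) : Prop where
  smooth : ContMDiff 𝓘(ℝ, ℝ) (𝓡 2) ∞ c
  periodic : Function.Periodic c (2 * Real.pi)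
  regular : ∀ θ, velocity c θ ≠ 0

/-- Smooth embedded closed curve: a regular closed curve that is injective on the circle. -/
structure IsEmbeddedClosedCurve (c : ℝ → M) : Prop extends IsClosedCurve c where
  injOn : InjOn c (Ico 0 (2 * Real.pi))

/-! ### Reparametrizations and convergence -/

/-- `φ t` is, for every `t ≥ 0`, the lift to the line of an orientation preserving diffeomorphism
of the circle, and the family depends smoothly on `t`. -/
structure IsReparametrization (φ : ℝ → ℝ → ℝ) : Prop where
  smooth : ContDiffOn ℝ ∞ (fun q : ℝ × ℝ => φ q.1 q.2) (Ici 0 ×ˢ univ)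
  equivariant : ∀ t, 0 ≤ t → ∀ u, φ t (u + 2 * Real.pi) = φ t u + 2 * Real.pi
  deriv_pos : ∀ t, 0 ≤ t → ∀ u, 0 < deriv (φ t) u

/-- Convergence of curves in the `C^m` topology: near every parameter value the curves lie
eventually in the preferred chart at the corresponding point of the limit, and their coordinates
converge uniformly there, with all derivatives up to order `m`. -/
def CmConverges (m : ℕ) (c : ℕ → ℝ → M) (c' : ℝ → M) : Prop :=
  ∀ θ₀ : ℝ, ∃ δ > 0,
    (∀ θ ∈ Icc (θ₀ - δ) (θ₀ + δ), c' θ ∈ (chartAt Plane (c' θ₀)).source) ∧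
    (∀ᶠ n in atTop, ∀ θ ∈ Icc (θ₀ - δ) (θ₀ + δ), c n θ ∈ (chartAt Plane (c' θ₀)).source) ∧
    ∀ i ≤ m, TendstoUniformlyOn
      (fun n => iteratedDeriv i fun s => extChartAt (𝓡 2) (c' θ₀) (c n s))
      (iteratedDeriv i fun s => extChartAt (𝓡 2) (c' θ₀) (c' s)) atTop
      (Icc (θ₀ - δ) (θ₀ + δ))

/-! ### Levi-Civita connection and curvature -/

variable [IsManifold (𝓡 2) ∞ M]

/-- Coefficients `gᵢⱼ` of the metric in the preferred chart at `p`. -/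
def gram (g : Metric M) (p : M) (y : Plane) : Matrix (Fin 2) (Fin 2) ℝ :=
  Matrix.of fun i j =>
    g.inner ((extChartAt (𝓡 2) p).symm y) (coordField p y i) (coordField p y j)

/-- Christoffel symbols `Γᵏᵢⱼ` of the Levi-Civita connection in the preferred chart at `p`. -/
def christoffel (g : Metric M) (p : M) (k i j : Fin 2) (y : Plane) : ℝ :=
  (1 / 2 : ℝ) * ∑ l, (gram g p y)⁻¹ k l *
    (partialD i (fun z => gram g p z j l) y + partialD j (fun z => gram g p z i l) y
      - partialD l (fun z => gram g p z i j) y)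

/-- Coefficient `Rˡₖᵢⱼ` of the curvature tensor in the preferred chart at `p`:
`R(∂ᵢ, ∂ⱼ) ∂ₖ = ∇ᵢ ∇ⱼ ∂ₖ - ∇ⱼ ∇ᵢ ∂ₖ = Rˡₖᵢⱼ ∂ₗ`. -/
def riemann (g : Metric M) (p : M) (l k i j : Fin 2) (y : Plane) : ℝ :=
  partialD i (christoffel g p l j k) y - partialD j (christoffel g p l i k) y
    + ∑ m, (christoffel g p l i m y * christoffel g p m j k y
      - christoffel g p l j m y * christoffel g p m i k y)

/-- Gauss curvature `K = ⟨R(∂₀, ∂₁) ∂₁, ∂₀⟩ / det (gᵢⱼ)`. -/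
def gaussCurvature (g : Metric M) (p : M) : ℝ :=
  (∑ l, riemann g p l 1 0 1 (extChartAt (𝓡 2) p p) * gram g p (extChartAt (𝓡 2) p p) l 0)
    / (gram g p (extChartAt (𝓡 2) p p)).det

/-- Components of the `j`-th iterated covariant derivative `∇ʲ f` of a function in the preferred
chart at `p`; the first index is that of the last differentiation. -/
def covDeriv (g : Metric M) (f : M → ℝ) (p : M) : (j : ℕ) → (Fin j → Fin 2) → Plane → ℝ
  | 0, _ => fun y => f ((extChartAt (𝓡 2) p).symm y)
  | j + 1, I => fun y =>
      partialD (I 0) (covDeriv g f p j (Fin.tail I)) y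
        - ∑ l : Fin j, ∑ k : Fin 2, christoffel g p k (I 0) (Fin.tail I l) y *
            covDeriv g f p j (Function.update (Fin.tail I) l k) y

/-- The norm `|∇ʲ f|` at `p` with respect to the metric. -/
def covDerivNorm (g : Metric M) (f : M → ℝ) (j : ℕ) (p : M) : ℝ :=
  Real.sqrt (∑ I : Fin j → Fin 2, ∑ J : Fin j → Fin 2,
    (∏ l, (gram g p (extChartAt (𝓡 2) p p))⁻¹ (I l) (J l)) *
      (covDeriv g f p j I (extChartAt (𝓡 2) p p) * covDeriv g f p j J (extChartAt (𝓡 2) p p)))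

/-- The conditions `|∇ʲ K| ≤ Cⱼ`, `|∇ʲ ψ| ≤ Pⱼ` for all `j`, and `0 < E ≤ e^ψ ≤ D`, on `U`. -/
def BoundedGeometryOn (g : Metric M) (ψ : M → ℝ) (U : Set M) : Prop :=
  (∃ C : ℕ → ℝ, ∀ j, ∀ x ∈ U, covDerivNorm g (gaussCurvature g) j x ≤ C j) ∧
  (∃ P : ℕ → ℝ, ∀ j, ∀ x ∈ U, covDerivNorm g ψ j x ≤ P j) ∧
  ∃ E D : ℝ, 0 < E ∧ ∀ x ∈ U, E ≤ Real.exp (ψ x) ∧ Real.exp (ψ x) ≤ D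

/-! ### The curvature with density, and the flow -/

/-- Covariant acceleration `∇_{∂_θ c} ∂_θ c`. -/
def acceleration (g : Metric M) (c : ℝ → M) (θ : ℝ) : TangentSpace (𝓡 2) (c θ) :=
  let v : Plane := velocity c θ
  iteratedDeriv 2 (fun s => extChartAt (𝓡 2) (c θ) (c s)) θ
    + ∑ k, (∑ i, ∑ j, christoffel g (c θ) k i j (extChartAt (𝓡 2) (c θ) (c θ)) *
        (v i * v j)) • stdVec k

/-- The gradient of `f` with respect to the metric. -/
def metricGradient (g : Metric M) (f : M → ℝ) (x : M) : TangentSpace (𝓡 2) x :=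
  ∑ k, (∑ l, (gram g x (extChartAt (𝓡 2) x x))⁻¹ k l *
    partialD l (fun y => f ((extChartAt (𝓡 2) x).symm y)) (extChartAt (𝓡 2) x x)) • stdVec k

/-- The component of `w` orthogonal to `v`. -/
def normalPart (g : Metric M) (x : M) (v w : TangentSpace (𝓡 2) x) : TangentSpace (𝓡 2) x :=
  w - (g.inner x w v / g.inner x v v) • v

/-- The curvature vector with density `k_ψ N = (k - ⟨∇ψ, N⟩) N` of a regular curve. Here
`k N = ∇_s ∂_s c` is the normal part of `∇_{∂_θ c} ∂_θ c / |∂_θ c|²`, and `⟨∇ψ, N⟩ N` is the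
normal part of `∇ψ`; the vector does not depend on the choice of the unit normal `N`. -/
def psiCurvature (g : Metric M) (ψ : M → ℝ) (c : ℝ → M) (θ : ℝ) : TangentSpace (𝓡 2) (c θ) :=
  normalPart g (c θ) (velocity c θ)
    ((g.inner (c θ) (velocity c θ) (velocity c θ))⁻¹ • acceleration g c θ
      - metricGradient g ψ (c θ))

/-- Closed `ψ`-minimal curve: a regular closed curve with `k_ψ = 0`. -/
structure IsClosedPsiMinimal (g : Metric M) (ψ : M → ℝ) (c : ℝ → M) : Prop
    extends IsClosedCurve c where
  minimal : ∀ θ, psiCurvature g ψ c θ = 0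

/-- `γ t θ` is a solution, for all `t ∈ [0, ∞)`, of the mean curvature flow with density
`∂_t γ = k_ψ N` of closed curves. -/
structure IsPsiMCF (g : Metric M) (ψ : M → ℝ) (γ : ℝ → ℝ → M) : Prop where
  smooth : ContMDiffOn 𝓘(ℝ, ℝ × ℝ) (𝓡 2) ∞ (fun q : ℝ × ℝ => γ q.1 q.2) (Ici 0 ×ˢ univ)
  closed : ∀ t, 0 ≤ t → IsClosedCurve (γ t)
  flow : ∀ t, 0 ≤ t → ∀ θ, (mfderivWithin 𝓘(ℝ, ℝ) (𝓡 2) (fun s => γ s θ) (Ici 0) t (1 : ℝ) :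
    TangentSpace (𝓡 2) (γ t θ)) = psiCurvature g ψ (γ t) θ

/-! ### The isoperimetric profile -/

/-- Riemannian length of a closed curve. -/
def curveLength (g : Metric M) (c : ℝ → M) : ℝ :=
  ∫ θ in (0 : ℝ)..(2 * Real.pi), Real.sqrt (g.inner (c θ) (velocity c θ) (velocity c θ))

/-- Riemannian area of a Borel set `A`: the supremum, over all finite families of disjoint Borel
pieces of `A` each lying in the domain of one chart, of the sum of the areas
`∫ √det (gᵢⱼ) dy` of the pieces. -/
def area (g : Metric M) (A : Set M) : ENNReal :=
  ⨆ (n : ℕ) (p : Fin n → M) (B : Fin n → Set M)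
    (_ : (∀ i, MeasurableSet[borel M] (B i) ∧ B i ⊆ A ∩ (chartAt Plane (p i)).source) ∧
      Pairwise fun i j => Disjoint (B i) (B j)),
    ∑ i, ∫⁻ y in extChartAt (𝓡 2) (p i) '' B i,
      ENNReal.ofReal (Real.sqrt (gram g (p i) y).det)

/-- `Ω` is a relatively compact smooth domain of area `a` whose boundary, a finite union of
disjoint smooth embedded closed curves, has length `L`. (The condition that `Ω` be the interior of
its closure says that it lies on one side only of each boundary curve.) -/
def IsDomainWith (g : Metric M) (Ω : Set M) (a L : ℝ) : Prop :=
  IsOpen Ω ∧ IsCompact (closure Ω) ∧ interior (closure Ω) = Ω ∧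
  area g Ω = ENNReal.ofReal a ∧
  ∃ (n : ℕ) (c : Fin n → ℝ → M), (∀ i, IsEmbeddedClosedCurve (c i)) ∧
    (Pairwise fun i j => Disjoint (range (c i)) (range (c j))) ∧
    frontier Ω = (⋃ i, range (c i)) ∧ L = ∑ i, curveLength g (c i)

/-- Isoperimetric profile: the infimum of the boundary lengths of the domains of area `a`. -/
def isoProfile (g : Metric M) (a : ℝ) : ℝ :=
  sInf {L : ℝ | ∃ Ω : Set M, IsDomainWith g Ω a L}

/-- The range `0 ≤ a < area M` of areas on which the profile is considered. -/
def profileDomain (g : Metric M) : Set ℝ :=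
  {a : ℝ | 0 ≤ a ∧ ENNReal.ofReal a < area g (univ : Set M)}

/-- The isoperimetric profile is a well defined continuous function, and it tends to zero at `a₀`
only if `a₀ = 0`. -/
structure IsoperimetricCondition (g : Metric M) : Prop where
  wellDefined : ∀ a ∈ profileDomain g, ∃ (Ω : Set M) (L : ℝ), IsDomainWith g Ω a L
  continuousOn : ContinuousOn (isoProfile g) (profileDomain g)
  zero_of_tendsto : ∀ a₀ ∈ profileDomain g,
    Tendsto (isoProfile g) (𝓝[profileDomain g] a₀) (𝓝 0) → a₀ = 0

end DensityFlow

end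

/-! Write κ for the curvature with density, v for the speed and s for arc length. The flow decreases
the weighted length L = ∫ e^ψ ds: the density e^ψ v has time derivative -κ² e^ψ v, so L' = -Y with Y
= ∫ κ² e^ψ ds. The curvature satisfies the parabolic equation κ_t = κ_ss + dψ(T) κ_s + κ (k² + r),
where r is a smooth function of the position and the unit tangent T (`dT_kap_zero`). Everything
rests on these two facts and on compactness of `U`.

Lower bound for the length (`exists_le_length`). If L were arbitrarily small, some curve of the flow
would lie in a tiny coordinate disc. By the maximum principle the largest squared distance of the
curve to the centre then decreases at a definite rate, so it would become negative in finite time,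
whereas the flow exists for all times (`exists_barrier_function`).

Decay of the curvature (`exists_curvSq_zero_le`). As L decreases and is bounded below, every late
unit interval contains a time at which Y is small. With Z = ∫ κ_s² e^ψ ds, the energy inequality and
the one-dimensional Sobolev bound sup κ² ≤ const (Y + Z) give Y' ≤ -Z + const Y while Y is small.
Hence Y tends to zero, every late unit interval contains a time at which Z, and so sup κ², is small,
and the maximum principle carries the smallness of sup κ² to the end of the interval.

Higher derivatives (`exists_curvSq_le`). The derivatives κ_j in arc length satisfy equations of the
same type whose remainder is a polynomial in lower derivatives and is affine in κ_j. Bernstein's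
trick, the maximum principle applied to κ_{j+1}² + λ κ_j² with λ large, bounds all of them for t ≥ 1
by induction.

Convergence (`exists_subsequence`). At integer times the curves are parametrized with constant
speed. The speed stays between positive constants, so the bounds on κ_j become bounds on all
derivatives, in the parameter, of every smooth function restricted to the curves. A diagonal
Arzelà–Ascoli argument gives a smooth limit; its speed is a positive constant and its κ is zero.
Bump functions in time interpolate the reparametrizations, chosen at integer times only, by one
smooth family. A single sequence of times serves every order m.

The computations take place in charts, where the surface becomes a `PlaneGeometry`. The sign of κ
depends on the chart, since the rotation defining the normal does; its square and the squares of the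
κ_j do not, so the global estimates are written in terms of squares (`curvSq`), with constants made
uniform by a finite cover of `U` (`exists_uniform_const`). -/

noncomputable section

namespace DensityFlow

/-! ### Real analysis -/

/-- If the second derivative were positive, the point would also be a local minimum, so the function
would be locally constant and the second derivative zero. -/
theorem deriv_deriv_nonpos_of_isLocalMax {f : ℝ → ℝ} {x : ℝ} (h : IsLocalMax f x)
    (hc : ContinuousAt f x) : deriv (deriv f) x ≤ 0 := by
  by_contra! hlt
  have hmin : IsLocalMin f x := isLocalMin_of_deriv_deriv_pos hlt h.deriv_eq_zero hc
  have hcst : f =ᶠ[𝓝 x] fun _ => f x := by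
    filter_upwards [h, hmin] with y h1 h2 using le_antisymm h1 h2
  have h2 : deriv (deriv f) x = deriv (deriv fun _ => f x) x := hcst.deriv.deriv_eq
  simp at h2
  linarith

/-- Parabolic maximum principle with a barrier depending on time. -/
theorem lt_barrier_of_isLocalMax {Q : ℝ → ℝ → ℝ} {B : ℝ → ℝ} {t₀ t₁ P : ℝ} (hP : 0 < P)
    (hQ : ContinuousOn (fun q : ℝ × ℝ => Q q.1 q.2) (Icc t₀ t₁ ×ˢ univ))
    (hper : ∀ t ∈ Icc t₀ t₁, Function.Periodic (Q t) P)
    (hB : ContinuousOn B (Icc t₀ t₁)) (h0 : ∀ θ, Q t₀ θ < B t₀)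
    (hstep : ∀ t ∈ Ioc t₀ t₁, ∀ θ, Q t θ = B t → IsLocalMax (Q t) θ →
      ∃ d b, HasDerivAt (fun τ => Q τ θ) d t ∧ HasDerivAt B b t ∧ d < b) :
    ∀ t ∈ Icc t₀ t₁, ∀ θ, Q t θ < B t := by
  by_contra! hcon
  obtain ⟨t', ht', θ', hθ'⟩ := hcon
  set K : Set (ℝ × ℝ) := (Icc t₀ t₁ ×ˢ Icc 0 P) ∩ (fun q => Q q.1 q.2 - B q.1) ⁻¹' Ici 0
  have hK : IsCompact K := by
    refine (isCompact_Icc.prod isCompact_Icc).of_isClosed_subset ?_ inter_subset_left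
    refine ContinuousOn.preimage_isClosed_of_isClosed ?_ (isClosed_Icc.prod isClosed_Icc) isClosed_Ici
    exact (hQ.mono (prod_mono_right (subset_univ _))).sub
      (hB.comp continuousOn_fst fun q hq => hq.1)
  have mem : ∀ t ∈ Icc t₀ t₁, ∀ θ, B t ≤ Q t θ → t ∈ Prod.fst '' K := by
    intro t ht θ hθ
    obtain ⟨y, hy, hyy⟩ := (hper t ht).exists_mem_Ico₀ hP θ
    exact ⟨(t, y), ⟨⟨ht, hy.1, hy.2.le⟩, by simpa [← hyy] using hθ⟩, rfl⟩
  -- The first contact time: `K` holds the points of one period where `Q` has reached the barrier.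
  obtain ⟨s, hs⟩ := (hK.image continuous_fst).exists_isLeast ⟨t', mem t' ht' θ' hθ'⟩
  obtain ⟨⟨⟨s', θ⟩, hK', rfl⟩, hleast⟩ := hs
  simp only at hleast
  have hsI : s' ∈ Icc t₀ t₁ := hK'.1.1
  have hge : B s' ≤ Q s' θ := by simpa using hK'.2
  have hlt : ∀ t ∈ Ico t₀ s', ∀ θ, Q t θ < B t := by
    intro t ht θ
    by_contra! h
    exact absurd (hleast (mem t ⟨ht.1, ht.2.le.trans hsI.2⟩ θ h)) (not_le.2 ht.2)
  have hs0 : t₀ < s' := by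
    rcases hsI.1.eq_or_lt with h | h
    · subst h; exact absurd (h0 θ) (not_lt.2 hge)
    · exact h
  have hle : ∀ θ, Q s' θ ≤ B s' := by
    intro θ
    have hm : s' ∈ Icc t₀ s' := ⟨hs0.le, le_rfl⟩
    have hcl : s' ∈ closure (Ico t₀ s') := by rw [closure_Ico hs0.ne]; exact hm
    have hsub : Icc t₀ s' ⊆ Icc t₀ t₁ := Icc_subset_Icc_right hsI.2
    have c1 : ContinuousOn (fun t => Q t θ) (Icc t₀ s') :=
      hQ.comp (f := fun t : ℝ => (t, θ)) (by fun_prop) fun t ht => ⟨hsub ht, mem_univ _⟩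
    refine ContinuousWithinAt.closure_le hcl ((c1 s' hm).mono Ico_subset_Icc_self)
      (((hB.mono hsub) s' hm).mono Ico_subset_Icc_self) fun t ht => (hlt t ht θ).le
  have heq : Q s' θ = B s' := le_antisymm (hle θ) hge
  obtain ⟨d, b, hd, hb, hdb⟩ := hstep s' ⟨hs0, hsI.2⟩ θ heq
    (Eventually.of_forall fun y => by simpa [heq] using hle y)
  have hD := hd.sub hb
  -- The difference `Q - B` vanishes at the contact point with negative time derivative, so it is
  -- positive just before, against the choice of the first contact time.
  have hsign := eventually_nhdsWithin_sign_eq_of_deriv_neg (f := (fun τ => Q τ θ) - B) (x₀ := s')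
    (by rw [hD.deriv]; linarith) (by simp [heq])
  have h1 : ∀ᶠ x in 𝓝[<] s', SignType.sign (((fun τ => Q τ θ) - B) x) = SignType.sign (s' - x) :=
    hsign.filter_mono nhdsWithin_le_nhds
  obtain ⟨x, hx, hxI⟩ := (h1.and (Ico_mem_nhdsLT hs0)).exists
  have h2 := hlt x hxI θ
  rw [sign_pos (by linarith [hxI.2] : 0 < s' - x), sign_eq_one_iff] at hx
  simp at hx
  linarith

/-- A decreasing `L` that is bounded below has small increments over late unit intervals, so by the
mean value theorem `Y = -L'` is small somewhere in each of them. While `Y` stays below `η` it grows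
at most exponentially, hence it is still small at the end of the interval. -/
theorem tendsto_zero_of_growth_le {L Y Y' : ℝ → ℝ} {t₀ C η : ℝ} (hη : 0 < η)
    (hL : ∀ t > t₀, HasDerivAt L (-Y t) t) (hY : ∀ t > t₀, HasDerivAt Y (Y' t) t)
    (hY0 : ∀ t > t₀, 0 ≤ Y t) (hL0 : ∀ t > t₀, 0 ≤ L t)
    (hgrow : ∀ t > t₀, Y t ≤ η → Y' t ≤ C * Y t) : Tendsto Y atTop (𝓝 0) := by
  have hanti : AntitoneOn L (Ioi t₀) := by
    refine antitoneOn_of_deriv_nonpos (convex_Ioi _) (fun t ht => (hL t ht).continuousAt.continuousWithinAt)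
      (fun t ht => (hL t (interior_subset ht)).differentiableAt.differentiableWithinAt) fun t ht => ?_
    rw [(hL t (interior_subset ht)).deriv]
    linarith [hY0 t (interior_subset ht)]
  have hbdd : BddBelow (L '' Ioi t₀) := ⟨0, by rintro _ ⟨t, ht, rfl⟩; exact hL0 t ht⟩
  set l := sInf (L '' Ioi t₀)
  have hne : (L '' Ioi t₀).Nonempty := ⟨_, mem_image_of_mem _ (mem_Ioi.2 (lt_add_one t₀))⟩
  rw [Metric.tendsto_atTop]
  intro ε₀ hε₀
  set ε := min ε₀ η
  have hε : 0 < ε := lt_min hε₀ hη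
  set c := |C| + 1
  have hc : 0 < c := by positivity
  -- The factor `exp (-c)` compensates the growth at rate `c` over the unit of time that follows.
  obtain ⟨_, ⟨T, hT, rfl⟩, hTl⟩ := exists_lt_of_csInf_lt hne
    (show l < l + ε * Real.exp (-c) by have := Real.exp_pos (-c); nlinarith)
  have hT : t₀ < T := hT
  refine ⟨T + 1, fun t₁ ht₁ => ?_⟩
  rw [Real.dist_eq, sub_zero, abs_of_nonneg (hY0 t₁ (by linarith))]
  obtain ⟨ξ, hξ, hξe⟩ := exists_hasDerivAt_eq_slope L (fun t => -Y t) (show t₁ - 1 < t₁ by linarith)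
    (fun t ht => (hL t (by linarith [ht.1])).continuousAt.continuousWithinAt)
    (fun t ht => hL t (by linarith [ht.1]))
  have hY1 : Y ξ < ε * Real.exp (-c) := by
    have h1 : L (t₁ - 1) ≤ L T := hanti hT (by simp; linarith) (by linarith)
    have h2 : l ≤ L t₁ := csInf_le hbdd (mem_image_of_mem _ (by simp; linarith))
    have h3 : t₁ - (t₁ - 1) = 1 := by ring
    rw [h3, div_one] at hξe
    linarith
  -- The barrier principle for a function that does not depend on the space variable; the period is
  -- immaterial.
  have key := lt_barrier_of_isLocalMax (Q := fun t _ => Y t)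
    (B := fun t => ε * Real.exp (c * (t - t₁))) (t₀ := ξ) (t₁ := t₁) one_pos
    (by
      have : ContinuousOn Y (Icc ξ t₁) := fun t ht =>
        (hY t (by linarith [ht.1, hξ.1])).continuousAt.continuousWithinAt
      exact this.comp continuousOn_fst fun q hq => hq.1)
    (fun t _ x => rfl) (by fun_prop)
    (fun _ => hY1.trans_le (by
      have : Real.exp (-c) ≤ Real.exp (c * (ξ - t₁)) := Real.exp_le_exp.2 (by nlinarith [hξ.1])
      nlinarith))
    (fun t ht _ hYB _ => by
      have ht0 : t₀ < t := by linarith [ht.1, hξ.1]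
      have hexp := Real.exp_pos (c * (t - t₁))
      have hle1 : Real.exp (c * (t - t₁)) ≤ 1 := Real.exp_le_one_iff.2 (by nlinarith [ht.2])
      refine ⟨_, ε * (Real.exp (c * (t - t₁)) * c), hY t ht0, ?_, ?_⟩
      · have := ((((hasDerivAt_id t).sub_const t₁).const_mul c).exp).const_mul ε
        simpa using this
      · have hYp : 0 < Y t := by rw [hYB]; positivity
        have hYη : Y t ≤ η := by
          have : ε ≤ η := min_le_right _ _
          rw [hYB]; nlinarith
        have h1 := hgrow t ht0 hYη
        have h2 : C * Y t ≤ |C| * Y t := mul_le_mul_of_nonneg_right (le_abs_self C) hYp.le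
        have h3 : ε * (Real.exp (c * (t - t₁)) * c) = c * Y t := by rw [hYB]; ring
        rw [h3]
        have : c * Y t = |C| * Y t + Y t := by simp only [c]; ring
        linarith)
    t₁ ⟨hξ.2.le, le_rfl⟩ 0
  simp at key
  exact key.trans_le (min_le_left _ _)

/-- A sequence of smooth functions with uniform bounds on all derivatives that converges on a dense
set converges locally uniformly with all derivatives. -/
theorem exists_smooth_limit {f : ℕ → ℝ → ℝ} {C : ℕ → ℝ} {S : Set ℝ} (hS : Dense S)
    (hf : ∀ k, ContDiff ℝ ∞ (f k)) (hC : ∀ j k x, |iteratedDeriv j (f k) x| ≤ C j)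
    (hconv : ∀ x ∈ S, ∃ l, Tendsto (fun k => f k x) atTop (𝓝 l)) :
    ∃ F : ℝ → ℝ, ContDiff ℝ ∞ F ∧
      ∀ j, TendstoLocallyUniformly (fun k => iteratedDeriv j (f k)) (iteratedDeriv j F) atTop := by
  have hder : ∀ j k x, HasDerivAt (iteratedDeriv j (f k)) (iteratedDeriv (j + 1) (f k) x) x := by
    intro j k x
    have h1 : DifferentiableAt ℝ (iteratedDeriv j (f k)) x :=
      ((hf k).differentiable_iteratedDeriv j (by exact_mod_cast WithTop.coe_lt_top _)) x
    simpa [iteratedDeriv_succ] using h1.hasDerivAt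
  have hC0 : ∀ j, 0 ≤ C j := fun j => (abs_nonneg _).trans (hC j 0 0)
  have hlip : ∀ j k x y, |iteratedDeriv j (f k) y - iteratedDeriv j (f k) x| ≤ C (j + 1) * |y - x| := by
    intro j k x y
    have := Convex.norm_image_sub_le_of_norm_hasDerivWithin_le (s := univ) (x := x) (y := y)
      (fun z _ => (hder j k z).hasDerivWithinAt) (fun z _ => hC (j + 1) k z) convex_univ
      (mem_univ _) (mem_univ _)
    simpa using this
  have hpt0 : ∀ x, ∃ l, Tendsto (fun k => f k x) atTop (𝓝 l) := by
    intro x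
    refine cauchySeq_tendsto_of_complete (Metric.cauchySeq_iff'.2 fun ε hε => ?_)
    -- The uniform Lipschitz bound `C 1` carries the Cauchy property from a nearby point of the
    -- dense set to `x`.
    obtain ⟨y, hyS, hy⟩ := hS.exists_dist_lt x (show 0 < ε / (4 * (C 1 + 1)) by have := hC0 1; positivity)
    obtain ⟨l, hl⟩ := hconv y hyS
    obtain ⟨N, hN⟩ := Metric.cauchySeq_iff'.1 hl.cauchySeq (ε / 4) (by positivity)
    refine ⟨N, fun n hn => ?_⟩
    have h1 := hN n hn
    have h2 := hlip 0 n x y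
    have h3 := hlip 0 N x y
    simp only [iteratedDeriv_zero, zero_add, Real.dist_eq] at *
    have h4 : C 1 * |y - x| ≤ ε / 4 := by
      rw [abs_sub_comm] at hy
      rw [lt_div_iff₀ (by have := hC0 1; positivity)] at hy
      have := abs_nonneg (y - x)
      nlinarith
    rw [abs_lt] at *
    rw [abs_le] at h2 h3
    constructor <;> linarith
  have hpt : ∀ j x, ∃ l, Tendsto (fun k => iteratedDeriv j (f k) x) atTop (𝓝 l) := by
    intro j
    induction j with
    | zero => simpa using hpt0
    | succ j ih =>
      intro x
      refine cauchySeq_tendsto_of_complete (Metric.cauchySeq_iff'.2 fun ε hε => ?_)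
      set c := C (j + 2) + 1
      have hc : 0 < c := by have := hC0 (j + 2); positivity
      set h := ε / (4 * c)
      have hh : 0 < h := by positivity
      have hch : C (j + 2) * h ≤ ε / 4 := by
        have : c * h = ε / 4 := by simp only [h]; field_simp
        nlinarith
      obtain ⟨l, hl⟩ := ih (x + h)
      obtain ⟨l', hl'⟩ := ih x
      obtain ⟨N, hN⟩ := Metric.cauchySeq_iff'.1 (hl.sub hl').cauchySeq (ε * h / 4) (by positivity)
      -- The difference quotient with step `h` approximates the next derivative within `ε / 4`
      -- uniformly in `k`, by the bound on the derivative of order `j + 2`. The quotients converge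
      -- by induction, so the derivatives are Cauchy.
      have hq : ∀ k, |iteratedDeriv j (f k) (x + h) - iteratedDeriv j (f k) x
          - h * iteratedDeriv (j + 1) (f k) x| ≤ h * (ε / 4) := by
        intro k
        obtain ⟨ξ, hξ, hξe⟩ := exists_hasDerivAt_eq_slope (iteratedDeriv j (f k))
          (iteratedDeriv (j + 1) (f k)) (show x < x + h by linarith)
          (fun z _ => (hder j k z).continuousAt.continuousWithinAt) (fun z _ => hder j k z)
        rw [eq_div_iff (by linarith)] at hξe
        have h1 := hlip (j + 1) k x ξ
        have h2 : |ξ - x| ≤ h := by rw [abs_le]; constructor <;> linarith [hξ.1, hξ.2]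
        have h3 : iteratedDeriv j (f k) (x + h) - iteratedDeriv j (f k) x
          - h * iteratedDeriv (j + 1) (f k) x = h * (iteratedDeriv (j + 1) (f k) ξ -
            iteratedDeriv (j + 1) (f k) x) := by rw [← hξe]; ring
        rw [h3, abs_mul, abs_of_pos hh]
        refine mul_le_mul_of_nonneg_left (h1.trans (le_trans ?_ hch)) hh.le
        exact mul_le_mul_of_nonneg_left h2 (hC0 _)
      refine ⟨N, fun n hn => ?_⟩
      have h1 := hN n hn
      have h2 := hq n
      have h3 := hq N
      simp only [Real.dist_eq] at *
      rw [← mul_lt_mul_iff_right₀ hh]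
      rw [abs_lt] at h1
      rw [abs_le] at h2 h3
      rw [← abs_of_pos hh, ← abs_mul, abs_of_pos hh, abs_lt]
      constructor <;> nlinarith
  choose G hG using hpt
  have hloc : ∀ j, TendstoLocallyUniformly (fun k => iteratedDeriv j (f k)) (G j) atTop := by
    intro j
    -- Functions with a common Lipschitz constant that converge pointwise converge locally
    -- uniformly; the limit inherits the constant.
    have hGl : ∀ x y, |G j y - G j x| ≤ C (j + 1) * |y - x| := fun x y =>
      le_of_tendsto ((hG j y).sub (hG j x)).abs (Eventually.of_forall fun k => hlip j k x y)
    rw [Metric.tendstoLocallyUniformly_iff]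
    intro ε hε x
    have hc : 0 < C (j + 1) + 1 := by have := hC0 (j + 1); positivity
    refine ⟨Metric.ball x (ε / (4 * (C (j + 1) + 1))), Metric.ball_mem_nhds _ (by positivity), ?_⟩
    filter_upwards [Metric.tendsto_nhds.1 (hG j x) (ε / 4) (by positivity)] with n hn y hy
    have h1 := hGl x y
    have h2 := hlip j n x y
    rw [Metric.mem_ball] at hy
    simp only [Real.dist_eq] at *
    have h4 : C (j + 1) * |y - x| ≤ ε / 4 := by
      rw [lt_div_iff₀ (by positivity)] at hy
      have := abs_nonneg (y - x)
      nlinarith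
    rw [abs_lt] at *
    rw [abs_le] at h1 h2
    constructor <;> linarith
  have hGd : ∀ j x, HasDerivAt (G j) (G (j + 1) x) x := fun j x =>
    hasDerivAt_of_tendstoLocallyUniformlyOn isOpen_univ
      (tendstoLocallyUniformlyOn_univ.2 (hloc (j + 1)))
      (Eventually.of_forall fun k x _ => hder j k x) (fun x _ => hG j x) (mem_univ x)
  have hit : ∀ j, iteratedDeriv j (G 0) = G j := by
    intro j
    induction j with
    | zero => simp
    | succ j ih => rw [iteratedDeriv_succ, ih]; ext x; exact (hGd j x).deriv
  refine ⟨G 0, contDiff_of_differentiable_iteratedDeriv fun m _ => ?_, fun j => by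
    rw [hit]; exact hloc j⟩
  rw [hit]
  exact fun x => (hGd m x).differentiableAt

end DensityFlow
end

/-! ### Families of curves in a plane with a Riemannian metric and a density -/

noncomputable section

namespace DensityFlow

section Directional

variable {E : Type*} [NormedAddCommGroup E] [NormedSpace ℝ E]

/-- Derivative in the time direction. -/
def dT (f : ℝ × ℝ → E) (q : ℝ × ℝ) : E := fderiv ℝ f q (1, 0)

/-- Derivative in the space direction. -/
def dX (f : ℝ × ℝ → E) (q : ℝ × ℝ) : E := fderiv ℝ f q (0, 1)

theorem contDiffOn_fderiv_apply {f : ℝ × ℝ → E} {O : Set (ℝ × ℝ)} (hO : IsOpen O)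
    (hf : ContDiffOn ℝ ∞ f O) (e : ℝ × ℝ) : ContDiffOn ℝ ∞ (fun q => fderiv ℝ f q e) O :=
  (hf.fderiv_of_isOpen hO (m := ∞) (by simp)).clm_apply contDiffOn_const

theorem fderiv_fderiv_comm {f : ℝ × ℝ → E} {q : ℝ × ℝ} (hf : ContDiffAt ℝ ∞ f q) (e e' : ℝ × ℝ) :
    fderiv ℝ (fun p => fderiv ℝ f p e) q e' = fderiv ℝ (fun p => fderiv ℝ f p e') q e := by
  have h1 : DifferentiableAt ℝ (fderiv ℝ f) q :=
    (hf.fderiv_right (m := ∞) (by simp)).differentiableAt (by simp)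
  have h2 : ∀ e, fderiv ℝ (fun p => fderiv ℝ f p e) q = (fderiv ℝ (fderiv ℝ f) q).flip e := by
    intro e
    have := (h1.hasFDerivAt.clm_apply (hasFDerivAt_const e q)).fderiv
    rw [this]; simp
  rw [h2, h2]
  have := (hf.isSymmSndFDerivAt (by simpa using (WithTop.coe_le_coe.2 (le_top : (2 : ℕ∞) ≤ ⊤) : (2 : WithTop ℕ∞) ≤ ∞))) e e'
  simpa using this.symm

theorem hasDerivAt_time {f : ℝ × ℝ → E} {t θ : ℝ} (hf : DifferentiableAt ℝ f (t, θ)) :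
    HasDerivAt (fun s => f (s, θ)) (dT f (t, θ)) t := by
  have h1 : HasDerivAt (fun s : ℝ => (s, θ)) ((1 : ℝ), (0 : ℝ)) t :=
    (hasDerivAt_id t).prodMk (hasDerivAt_const t θ)
  exact hf.hasFDerivAt.comp_hasDerivAt t h1

theorem hasDerivAt_space {f : ℝ × ℝ → E} {t θ : ℝ} (hf : DifferentiableAt ℝ f (t, θ)) :
    HasDerivAt (fun s => f (t, s)) (dX f (t, θ)) θ := by
  have h1 : HasDerivAt (fun s : ℝ => (t, s)) ((0 : ℝ), (1 : ℝ)) θ :=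
    (hasDerivAt_const θ t).prodMk (hasDerivAt_id θ)
  exact hf.hasFDerivAt.comp_hasDerivAt θ h1

end Directional

theorem ContDiffOn.differentiableAt_of_isOpen {E F : Type*} [NormedAddCommGroup E]
    [NormedSpace ℝ E] [NormedAddCommGroup F] [NormedSpace ℝ F] {f : F → E} {O : Set F} {q : F}
    (hf : ContDiffOn ℝ ∞ f O) (hO : IsOpen O) (hq : q ∈ O) : DifferentiableAt ℝ f q :=
  (hf.contDiffAt (hO.mem_nhds hq)).differentiableAt (by simp)

/-- A positive bilinear form on the plane is diagonalized by an orthonormal pair. -/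
theorem eq_add_of_orthonormal {B : Plane →L[ℝ] Plane →L[ℝ] ℝ} (hs : ∀ u w, B u w = B w u)
    (hp : ∀ v, v ≠ 0 → 0 < B v v) {T N : Plane} (hT : B T T = 1) (hN : B N N = 1)
    (hTN : B T N = 0) (W : Plane) : W = B W T • T + B W N • N := by
  have hNT : B N T = 0 := by rw [hs]; exact hTN
  have hli : LinearIndependent ℝ ![T, N] := by
    rw [LinearIndependent.pair_iff]
    intro a b hab
    constructor
    · have := congrArg (fun z => B z T) hab
      simpa [hT, hNT] using this
    · have := congrArg (fun z => B z N) hab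
      simpa [hN, hTN] using this
  have hspan := hli.span_eq_top_of_card_eq_finrank (by simp)
  -- The remainder is orthogonal to `T` and `N`, which span the plane, hence to itself.
  set R := W - (B W T • T + B W N • N)
  have hRT : B R T = 0 := by simp [R, hT, hNT]
  have hRN : B R N = 0 := by simp [R, hN, hTN]
  have hR : R ∈ Submodule.span ℝ (Set.range ![T, N]) := by rw [hspan]; trivial
  have hRR : B R R = 0 := by
    obtain ⟨b, a, hab⟩ : ∃ b a : ℝ, b • N + a • T = R := by
      simpa [Submodule.mem_span_pair] using hR
    have : B R R = B R (b • N + a • T) := by rw [hab]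
    rw [this, map_add, map_smul, map_smul, hRT, hRN]; simp
  have : R = 0 := by
    by_contra h
    exact (hp R h).ne' hRR
  exact sub_eq_zero.1 this

/-- A Riemannian metric `G` on an open subset `Ω` of the plane with its Levi-Civita connection `Γ`,
a rotation `J` by a right angle, and the logarithm `ψ` of a density. -/
structure PlaneGeometry where
  Ω : Set Plane
  isOpen : IsOpen Ω
  G : Plane → Plane →L[ℝ] Plane →L[ℝ] ℝ
  Γ : Plane → Plane →L[ℝ] Plane →L[ℝ] Plane
  J : Plane → Plane →L[ℝ] Plane
  ψ : Plane → ℝ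
  smooth_G : ContDiffOn ℝ ∞ G Ω
  smooth_Γ : ContDiffOn ℝ ∞ Γ Ω
  smooth_J : ContDiffOn ℝ ∞ J Ω
  smooth_ψ : ContDiffOn ℝ ∞ ψ Ω
  symm_G : ∀ y u w, G y u w = G y w u
  pos_G : ∀ y ∈ Ω, ∀ u, u ≠ 0 → 0 < G y u u
  symm_Γ : ∀ y u w, Γ y u w = Γ y w u
  compat : ∀ y ∈ Ω, ∀ u v w, fderiv ℝ G y u v w = G y (Γ y u v) w + G y v (Γ y u w)
  J_orth : ∀ y ∈ Ω, ∀ u, G y u (J y u) = 0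
  J_norm : ∀ y ∈ Ω, ∀ u, G y (J y u) (J y u) = G y u u

namespace PlaneGeometry

variable (S : PlaneGeometry) {E : Type*} [NormedAddCommGroup E] [NormedSpace ℝ E]

/-- The speed `|∂_θ x|`. -/
def speed (x : ℝ × ℝ → Plane) (q : ℝ × ℝ) : ℝ := √(S.G (x q) (dX x q) (dX x q))

/-- The arc length derivative. -/
def dS (x : ℝ × ℝ → Plane) (f : ℝ × ℝ → E) (q : ℝ × ℝ) : E := (S.speed x q)⁻¹ • dX f q

/-- Unit tangent vector. -/
def tang (x : ℝ × ℝ → Plane) : ℝ × ℝ → Plane := S.dS x x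

/-- Unit normal vector. -/
def nor (x : ℝ × ℝ → Plane) (q : ℝ × ℝ) : Plane := S.J (x q) (S.tang x q)

/-- Covariant derivative in the direction `e` of a vector field along `x`. -/
def covD (x : ℝ × ℝ → Plane) (e : ℝ × ℝ) (W : ℝ × ℝ → Plane) (q : ℝ × ℝ) : Plane :=
  fderiv ℝ W q e + S.Γ (x q) (fderiv ℝ x q e) (W q)

/-- Geodesic curvature. -/
def geoCurv (x : ℝ × ℝ → Plane) (q : ℝ × ℝ) : ℝ :=
  S.G (x q) ((S.speed x q)⁻¹ • S.covD x (0, 1) (S.tang x) q) (S.nor x q)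

/-- The arc length derivatives of the curvature with density. -/
def kap (x : ℝ × ℝ → Plane) : ℕ → ℝ × ℝ → ℝ
  | 0 => fun q => S.geoCurv x q - fderiv ℝ S.ψ (x q) (S.nor x q)
  | j + 1 => S.dS x (kap x j)

/-- `R(a, b) w` for the curvature tensor `R`. -/
def riem (y a b w : Plane) : Plane :=
  fderiv ℝ S.Γ y a b w - fderiv ℝ S.Γ y b a w + S.Γ y a (S.Γ y b w) - S.Γ y b (S.Γ y a w)

/-- The zeroth order coefficient of the evolution equation of the curvature. -/
def reaction (y T : Plane) : ℝ :=
  S.G y (S.riem y (S.J y T) T T) (S.J y T)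
    - (fderiv ℝ (fderiv ℝ S.ψ) y (S.J y T) (S.J y T)
      - fderiv ℝ S.ψ y (S.Γ y (S.J y T) (S.J y T)))

/-- `x` is a smooth family of regular curves on the open set `O` of times and parameters. -/
structure IsRegular (O : Set (ℝ × ℝ)) (x : ℝ × ℝ → Plane) : Prop where
  isOpen : IsOpen O
  smooth : ContDiffOn ℝ ∞ x O
  mapsTo : MapsTo x O S.Ω
  regular : ∀ q ∈ O, dX x q ≠ 0

/-- `x` is a regular solution of the flow on the open set `O` of times and parameters. -/
structure IsFlow (O : Set (ℝ × ℝ)) (x : ℝ × ℝ → Plane) : Prop extends S.IsRegular O x where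
  flow : ∀ q ∈ O, dT x q = S.kap x 0 q • S.nor x q

end PlaneGeometry

end DensityFlow
end

/-! ### The moving frame and the evolution of speed and curvature -/

noncomputable section

namespace DensityFlow
namespace PlaneGeometry
variable {S : PlaneGeometry} {E : Type*} [NormedAddCommGroup E] [NormedSpace ℝ E]
  {O : Set (ℝ × ℝ)} {x : ℝ × ℝ → Plane} {q : ℝ × ℝ}

namespace IsRegular

/-! #### Smoothness -/

theorem contDiffOn_dX (h : S.IsRegular O x) {f : ℝ × ℝ → E} (hf : ContDiffOn ℝ ∞ f O) :
    ContDiffOn ℝ ∞ (dX f) O := contDiffOn_fderiv_apply h.isOpen hf _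

theorem contDiffOn_G (h : S.IsRegular O x) : ContDiffOn ℝ ∞ (fun q => S.G (x q)) O :=
  S.smooth_G.comp h.smooth h.mapsTo

theorem contDiffOn_Γ (h : S.IsRegular O x) : ContDiffOn ℝ ∞ (fun q => S.Γ (x q)) O :=
  S.smooth_Γ.comp h.smooth h.mapsTo

theorem speed_sq (h : S.IsRegular O x) (hq : q ∈ O) :
    S.speed x q ^ 2 = S.G (x q) (dX x q) (dX x q) :=
  Real.sq_sqrt (S.pos_G _ (h.mapsTo hq) _ (h.regular q hq)).le

theorem speed_pos (h : S.IsRegular O x) (hq : q ∈ O) : 0 < S.speed x q :=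
  Real.sqrt_pos.2 (S.pos_G _ (h.mapsTo hq) _ (h.regular q hq))

theorem contDiffOn_speed (h : S.IsRegular O x) : ContDiffOn ℝ ∞ (S.speed x) O := by
  refine ContDiffOn.sqrt ?_ fun _ hq => (S.pos_G _ (h.mapsTo hq) _ (h.regular _ hq)).ne'
  exact (h.contDiffOn_G.clm_apply (h.contDiffOn_dX h.smooth)).clm_apply (h.contDiffOn_dX h.smooth)

theorem contDiffOn_inv_speed (h : S.IsRegular O x) : ContDiffOn ℝ ∞ (fun q => (S.speed x q)⁻¹) O :=
  h.contDiffOn_speed.inv fun _ hq => (h.speed_pos hq).ne'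

theorem contDiffOn_dS (h : S.IsRegular O x) {f : ℝ × ℝ → E} (hf : ContDiffOn ℝ ∞ f O) :
    ContDiffOn ℝ ∞ (S.dS x f) O := h.contDiffOn_inv_speed.smul (h.contDiffOn_dX hf)

theorem contDiffOn_tang (h : S.IsRegular O x) : ContDiffOn ℝ ∞ (S.tang x) O := h.contDiffOn_dS h.smooth

theorem contDiffOn_nor (h : S.IsRegular O x) : ContDiffOn ℝ ∞ (S.nor x) O :=
  (S.smooth_J.comp h.smooth h.mapsTo).clm_apply h.contDiffOn_tang

theorem contDiffOn_covD (h : S.IsRegular O x) {W : ℝ × ℝ → Plane} (hW : ContDiffOn ℝ ∞ W O)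
    (e : ℝ × ℝ) : ContDiffOn ℝ ∞ (S.covD x e W) O :=
  (contDiffOn_fderiv_apply h.isOpen hW e).add
    ((h.contDiffOn_Γ.clm_apply (contDiffOn_fderiv_apply h.isOpen h.smooth e)).clm_apply hW)

theorem contDiffOn_geoCurv (h : S.IsRegular O x) : ContDiffOn ℝ ∞ (S.geoCurv x) O :=
  (h.contDiffOn_G.clm_apply (h.contDiffOn_inv_speed.smul (h.contDiffOn_covD h.contDiffOn_tang _))).clm_apply
    h.contDiffOn_nor

theorem contDiffOn_fderiv_ψ (h : S.IsRegular O x) : ContDiffOn ℝ ∞ (fun q => fderiv ℝ S.ψ (x q)) O :=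
  (S.smooth_ψ.fderiv_of_isOpen S.isOpen (m := ∞) (by simp)).comp h.smooth h.mapsTo

theorem contDiffOn_kap (h : S.IsRegular O x) (j : ℕ) : ContDiffOn ℝ ∞ (S.kap x j) O := by
  induction j with
  | zero => exact h.contDiffOn_geoCurv.sub (h.contDiffOn_fderiv_ψ.clm_apply h.contDiffOn_nor)
  | succ j ih => exact h.contDiffOn_dS ih

/-! #### The moving frame -/

theorem dX_eq (h : S.IsRegular O x) (hq : q ∈ O) (f : ℝ × ℝ → E) :
    dX f q = S.speed x q • S.dS x f q := by
  rw [dS, smul_smul, mul_inv_cancel₀ (h.speed_pos hq).ne', one_smul]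

theorem G_tang_tang (h : S.IsRegular O x) (hq : q ∈ O) : S.G (x q) (S.tang x q) (S.tang x q) = 1 := by
  have h1 := h.speed_sq hq
  have h2 := h.speed_pos hq
  simp only [tang, dS, map_smul, smul_apply, smul_eq_mul, ← h1]
  field_simp

theorem G_tang_nor (h : S.IsRegular O x) (hq : q ∈ O) : S.G (x q) (S.tang x q) (S.nor x q) = 0 :=
  S.J_orth _ (h.mapsTo hq) _

theorem G_nor_tang (h : S.IsRegular O x) (hq : q ∈ O) : S.G (x q) (S.nor x q) (S.tang x q) = 0 := by
  rw [S.symm_G, h.G_tang_nor hq]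

theorem G_nor_nor (h : S.IsRegular O x) (hq : q ∈ O) : S.G (x q) (S.nor x q) (S.nor x q) = 1 := by
  rw [nor, S.J_norm _ (h.mapsTo hq), h.G_tang_tang hq]

theorem eq_frame (h : S.IsRegular O x) (hq : q ∈ O) (W : Plane) :
    W = S.G (x q) W (S.tang x q) • S.tang x q + S.G (x q) W (S.nor x q) • S.nor x q :=
  eq_add_of_orthonormal (S.symm_G _) (S.pos_G _ (h.mapsTo hq)) (h.G_tang_tang hq) (h.G_nor_nor hq)
    (h.G_tang_nor hq) W

theorem fderiv_metric (h : S.IsRegular O x) (hq : q ∈ O) {V W : ℝ × ℝ → Plane}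
    (hV : DifferentiableAt ℝ V q) (hW : DifferentiableAt ℝ W q) (e : ℝ × ℝ) :
    fderiv ℝ (fun q => S.G (x q) (V q) (W q)) q e =
      S.G (x q) (S.covD x e V q) (W q) + S.G (x q) (V q) (S.covD x e W q) := by
  have hx := (ContDiffOn.differentiableAt_of_isOpen h.smooth h.isOpen hq).hasFDerivAt
  have hG := (ContDiffOn.differentiableAt_of_isOpen S.smooth_G S.isOpen (h.mapsTo hq)).hasFDerivAt
  have h1 := (((hG.comp q hx).clm_apply hV.hasFDerivAt).clm_apply hW.hasFDerivAt).fderiv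
  simp only [Function.comp_def] at h1
  rw [h1]
  simp only [covD, add_apply, ContinuousLinearMap.comp_apply,
    ContinuousLinearMap.flip_apply, map_add]
  rw [S.compat _ (h.mapsTo hq)]
  ring

theorem covD_smul (_ : S.IsRegular O x) {a : ℝ × ℝ → ℝ} {W : ℝ × ℝ → Plane}
    (ha : DifferentiableAt ℝ a q) (hW : DifferentiableAt ℝ W q) (e : ℝ × ℝ) :
    S.covD x e (fun q => a q • W q) q = fderiv ℝ a q e • W q + a q • S.covD x e W q := by
  simp only [covD]
  rw [fderiv_fun_smul ha hW]
  simp only [add_apply, smul_apply,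
    ContinuousLinearMap.smulRight_apply, map_smul, smul_add]
  abel

theorem covD_congr (h : S.IsRegular O x) (hq : q ∈ O) {V W : ℝ × ℝ → Plane} (hVW : EqOn V W O)
    (e : ℝ × ℝ) : S.covD x e V q = S.covD x e W q := by
  have : V =ᶠ[𝓝 q] W := by filter_upwards [h.isOpen.mem_nhds hq] with p hp using hVW hp
  rw [covD, covD, this.fderiv_eq, this.eq_of_nhds]

theorem fderiv_congr_on (h : S.IsRegular O x) (hq : q ∈ O) {f g : ℝ × ℝ → E} (hfg : EqOn f g O) :
    fderiv ℝ f q = fderiv ℝ g q := by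
  have : f =ᶠ[𝓝 q] g := by filter_upwards [h.isOpen.mem_nhds hq] with p hp using hfg hp
  exact this.fderiv_eq

theorem differentiableAt (h : S.IsRegular O x) (hq : q ∈ O) {f : ℝ × ℝ → E} (hf : ContDiffOn ℝ ∞ f O) :
    DifferentiableAt ℝ f q := ContDiffOn.differentiableAt_of_isOpen hf h.isOpen hq

theorem fderiv_const_metric (h : S.IsRegular O x) (hq : q ∈ O) {V W : ℝ × ℝ → Plane} {c : ℝ}
    (hV : ContDiffOn ℝ ∞ V O) (hW : ContDiffOn ℝ ∞ W O) (hc : ∀ p ∈ O, S.G (x p) (V p) (W p) = c)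
    (e : ℝ × ℝ) :
    S.G (x q) (S.covD x e V q) (W q) + S.G (x q) (V q) (S.covD x e W q) = 0 := by
  rw [← h.fderiv_metric hq (h.differentiableAt hq hV) (h.differentiableAt hq hW),
    h.fderiv_congr_on hq (g := fun _ => c) fun p hp => hc p hp]
  simp

/-- Differentiating ⟨N, N⟩ = 1 and ⟨T, N⟩ = 0 is enough; that the rotation `J` is parallel is not
needed. -/
theorem covD_nor_eq (h : S.IsRegular O x) (hq : q ∈ O) (e : ℝ × ℝ) :
    S.covD x e (S.nor x) q = -S.G (x q) (S.covD x e (S.tang x) q) (S.nor x q) • S.tang x q := by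
  have h1 := h.fderiv_const_metric hq h.contDiffOn_nor h.contDiffOn_nor
    (fun p hp => h.G_nor_nor hp) e
  have h2 := h.fderiv_const_metric hq h.contDiffOn_tang h.contDiffOn_nor
    (fun p hp => h.G_tang_nor hp) e
  rw [S.symm_G _ (S.nor x q)] at h1
  rw [S.symm_G _ (S.tang x q)] at h2
  rw [h.eq_frame hq (S.covD x e (S.nor x) q)]
  have h3 : S.G (x q) (S.covD x e (S.nor x) q) (S.nor x q) = 0 := by linarith
  have h4 : S.G (x q) (S.covD x e (S.nor x) q) (S.tang x q)
    = -S.G (x q) (S.covD x e (S.tang x) q) (S.nor x q) := by linarith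
  rw [h3, h4]; simp

theorem covD_tang_eq (h : S.IsRegular O x) (hq : q ∈ O) (e : ℝ × ℝ) :
    S.covD x e (S.tang x) q = S.G (x q) (S.covD x e (S.tang x) q) (S.nor x q) • S.nor x q := by
  have h1 := h.fderiv_const_metric hq h.contDiffOn_tang h.contDiffOn_tang
    (fun p hp => h.G_tang_tang hp) e
  rw [S.symm_G _ (S.tang x q)] at h1
  have h3 : S.G (x q) (S.covD x e (S.tang x) q) (S.tang x q) = 0 := by linarith
  conv_lhs => rw [h.eq_frame hq (S.covD x e (S.tang x) q), h3]
  simp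

theorem covD_space_tang (h : S.IsRegular O x) (hq : q ∈ O) :
    S.covD x (0, 1) (S.tang x) q = (S.speed x q * S.geoCurv x q) • S.nor x q := by
  have := h.speed_pos hq
  rw [h.covD_tang_eq hq, geoCurv]
  simp only [map_smul, smul_apply, smul_eq_mul]
  field_simp

theorem covD_space_nor (h : S.IsRegular O x) (hq : q ∈ O) :
    S.covD x (0, 1) (S.nor x) q = -(S.speed x q * S.geoCurv x q) • S.tang x q := by
  rw [h.covD_nor_eq hq, h.covD_space_tang hq]
  simp [h.G_nor_nor hq]

end IsRegular

namespace IsFlow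

/-! #### Evolution equations -/

/-- Ordinary second derivatives of `W` and `x` commute and the mixed first order terms are symmetric
in `e` and `f`; only the derivatives of `Γ` and its quadratic terms remain, and they form the
curvature tensor. -/
theorem covD_comm (h : S.IsFlow O x) (hq : q ∈ O) (e f : ℝ × ℝ) {W : ℝ × ℝ → Plane}
    (hW : ContDiffOn ℝ ∞ W O) :
    S.covD x e (S.covD x f W) q = S.covD x f (S.covD x e W) q
      + S.riem (x q) (fderiv ℝ x q e) (fderiv ℝ x q f) (W q) := by
  have hx := (h.differentiableAt hq h.smooth).hasFDerivAt
  have hΓ := (ContDiffOn.differentiableAt_of_isOpen S.smooth_Γ S.isOpen (h.mapsTo hq)).hasFDerivAt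
  have key : ∀ e f : ℝ × ℝ, fderiv ℝ (S.covD x f W) q e =
      fderiv ℝ (fun p => fderiv ℝ W p f) q e
      + (fderiv ℝ S.Γ (x q) (fderiv ℝ x q e) (fderiv ℝ x q f) (W q)
        + S.Γ (x q) (fderiv ℝ (fun p => fderiv ℝ x p f) q e) (W q)
        + S.Γ (x q) (fderiv ℝ x q f) (fderiv ℝ W q e)) := by
    intro e f
    have h1 := (h.differentiableAt hq (contDiffOn_fderiv_apply h.isOpen hW f)).hasFDerivAt
    have h2 := (h.differentiableAt hq (contDiffOn_fderiv_apply h.isOpen h.smooth f)).hasFDerivAt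
    have h3 := (h.differentiableAt hq hW).hasFDerivAt
    have h4 := (h1.add (((hΓ.comp q hx).clm_apply h2).clm_apply h3)).fderiv
    have h5 : (fun p => fderiv ℝ W p f) + (fun p => S.Γ (x p) (fderiv ℝ x p f) (W p))
      = S.covD x f W := rfl
    simp only [Function.comp_def] at h4
    rw [h5] at h4
    rw [h4]
    simp only [add_apply, ContinuousLinearMap.comp_apply,
      ContinuousLinearMap.flip_apply]
    abel
  have hq' := h.isOpen.mem_nhds hq
  have c1 := fderiv_fderiv_comm (hW.contDiffAt hq') e f
  have c2 := fderiv_fderiv_comm (h.smooth.contDiffAt hq') e f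
  simp only [covD] at key ⊢
  rw [key, key, c1, c2]
  simp only [riem, map_add]
  rw [S.symm_Γ (x q) (fderiv ℝ x q e) (fderiv ℝ W q f)]
  rw [S.symm_Γ (x q) (fderiv ℝ x q f) (fderiv ℝ W q e)]
  abel

/-- The connection has no torsion and second derivatives commute. -/
theorem covD_time_dX (h : S.IsFlow O x) (hq : q ∈ O) :
    S.covD x (1, 0) (dX x) q = S.covD x (0, 1) (dT x) q := by
  have c2 := fderiv_fderiv_comm (h.smooth.contDiffAt (h.isOpen.mem_nhds hq)) (0, 1) (1, 0)
  simp only [covD]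
  rw [S.symm_Γ]
  exact congrArg₂ _ c2 rfl

theorem covD_space_dT (h : S.IsFlow O x) (hq : q ∈ O) :
    S.covD x (0, 1) (dT x) q = S.speed x q • (S.kap x 1 q • S.nor x q
      - (S.kap x 0 q * S.geoCurv x q) • S.tang x q) := by
  rw [h.covD_congr hq (W := fun q => S.kap x 0 q • S.nor x q) (fun p hp => h.flow p hp),
    h.covD_smul (h.differentiableAt hq (h.contDiffOn_kap 0)) (h.differentiableAt hq h.contDiffOn_nor),
    h.covD_space_nor hq]
  have : fderiv ℝ (S.kap x 0) q (0, 1) = S.speed x q • S.kap x 1 q := h.dX_eq hq (S.kap x 0)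
  rw [this]
  simp only [smul_sub, smul_smul, smul_eq_mul]
  rw [sub_eq_add_neg, ← neg_smul]
  congr 2
  ring

theorem dT_speed (h : S.IsFlow O x) (hq : q ∈ O) :
    dT (S.speed x) q = -(S.geoCurv x q * S.kap x 0 q) * S.speed x q := by
  have hv := h.speed_pos hq
  have hd := h.differentiableAt hq h.contDiffOn_speed
  have h1 : dT (fun q => S.speed x q ^ 2) q = 2 * S.speed x q * dT (S.speed x) q := by
    have := (hd.hasFDerivAt.pow 2).fderiv
    rw [dT, this]; simp [dT]
  have hX := h.differentiableAt hq (h.contDiffOn_dX h.smooth)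
  have h2 : dT (fun q => S.speed x q ^ 2) q = 2 * S.G (x q) (S.covD x (0, 1) (dT x) q) (dX x q) := by
    rw [dT, h.fderiv_congr_on hq (g := fun q => S.G (x q) (dX x q) (dX x q))
      (fun p hp => h.speed_sq hp), h.fderiv_metric hq hX hX, S.symm_G _ (dX x q),
      h.covD_time_dX hq]
    ring
  rw [h1, h.covD_space_dT hq, h.dX_eq hq x, ← tang] at h2
  simp only [map_smul, map_sub, smul_apply, smul_eq_mul,
    sub_apply, h.G_nor_tang hq, h.G_tang_tang hq] at h2
  have : S.speed x q * dT (S.speed x) q = S.speed x q * (-(S.geoCurv x q * S.kap x 0 q) * S.speed x q) := by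
    linarith
  exact mul_left_cancel₀ hv.ne' this

theorem dT_inv_speed (h : S.IsFlow O x) (hq : q ∈ O) :
    fderiv ℝ (fun q => (S.speed x q)⁻¹) q (1, 0) =
      S.geoCurv x q * S.kap x 0 q * (S.speed x q)⁻¹ := by
  have hv := h.speed_pos hq
  have hd := (h.differentiableAt hq h.contDiffOn_speed).hasFDerivAt
  have h1 := ((hasDerivAt_inv hv.ne').comp_hasFDerivAt q hd).fderiv
  simp only [Function.comp_def] at h1
  have h2 := h.dT_speed hq
  rw [dT] at h2
  rw [h1]
  simp only [smul_apply, smul_eq_mul, h2]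
  field_simp

/-- In `∂_s = v⁻¹ ∂_θ` only the factor `v⁻¹` fails to commute with `∂_t`, and its time derivative is
k κ v⁻¹. -/
theorem dT_dS (h : S.IsFlow O x) (hq : q ∈ O) {f : ℝ × ℝ → E} (hf : ContDiffOn ℝ ∞ f O) :
    dT (S.dS x f) q = S.dS x (dT f) q + (S.geoCurv x q * S.kap x 0 q) • S.dS x f q := by
  have h1 := fderiv_fderiv_comm (hf.contDiffAt (h.isOpen.mem_nhds hq)) (0, 1) (1, 0)
  have h2 := (((h.differentiableAt hq h.contDiffOn_inv_speed).hasFDerivAt).smul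
    (h.differentiableAt hq (h.contDiffOn_dX hf)).hasFDerivAt).fderiv
  have h3 : (fun q => (S.speed x q)⁻¹) • dX f = S.dS x f := rfl
  rw [h3] at h2
  rw [dT, h2]
  simp only [add_apply, smul_apply,
    ContinuousLinearMap.smulRight_apply, h.dT_inv_speed hq]
  simp only [dS, smul_smul]
  exact congrArg₂ _ (congrArg _ h1) rfl

theorem covD_time_tang (h : S.IsFlow O x) (hq : q ∈ O) :
    S.covD x (1, 0) (S.tang x) q = S.kap x 1 q • S.nor x q := by
  have hv := h.speed_pos hq
  have h1 := h.covD_smul (h.differentiableAt hq h.contDiffOn_inv_speed)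
    (h.differentiableAt hq (h.contDiffOn_dX h.smooth)) (1, 0)
  have h2 : S.tang x = fun q => (S.speed x q)⁻¹ • dX x q := rfl
  rw [h2, h1, h.covD_time_dX hq, h.covD_space_dT hq, h.dT_inv_speed hq, smul_smul,
    inv_mul_cancel₀ hv.ne', one_smul, mul_smul]
  rw [show (S.speed x q)⁻¹ • dX x q = S.tang x q from rfl, mul_comm]
  abel

theorem covD_time_nor (h : S.IsFlow O x) (hq : q ∈ O) :
    S.covD x (1, 0) (S.nor x) q = -S.kap x 1 q • S.tang x q := by
  rw [h.covD_nor_eq hq, h.covD_time_tang hq]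
  simp [h.G_nor_nor hq]

/-- Differentiate k = ⟨∇_s T, N⟩. Exchanging ∇_t with ∇_s produces the curvature tensor, ∇_t T = κ_s
N produces κ_ss, and the changing speed produces k² κ. -/
theorem dT_geoCurv (h : S.IsFlow O x) (hq : q ∈ O) :
    dT (S.geoCurv x) q = S.kap x 2 q + S.geoCurv x q ^ 2 * S.kap x 0 q
      + S.kap x 0 q * S.G (x q) (S.riem (x q) (S.nor x q) (S.tang x q) (S.tang x q)) (S.nor x q) := by
  have hv := h.speed_pos hq
  have hcov := h.contDiffOn_covD h.contDiffOn_tang (0, 1)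
  have hDs : ContDiffOn ℝ ∞ (fun q => (S.speed x q)⁻¹ • S.covD x (0, 1) (S.tang x) q) O :=
    h.contDiffOn_inv_speed.smul hcov
  have h1 := h.fderiv_metric hq (h.differentiableAt hq hDs) (h.differentiableAt hq h.contDiffOn_nor) (1, 0)
  have h2 : dT (S.geoCurv x) q = fderiv ℝ (fun q => S.G (x q) ((S.speed x q)⁻¹ •
    S.covD x (0, 1) (S.tang x) q) (S.nor x q)) q (1, 0) := rfl
  have h3 := h.covD_smul (h.differentiableAt hq h.contDiffOn_inv_speed) (h.differentiableAt hq hcov)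
    (1, 0)
  have h4 := h.covD_congr hq (V := S.covD x (1, 0) (S.tang x)) (W := fun q => S.kap x 1 q • S.nor x q)
    (fun p hp => h.covD_time_tang hp) (0, 1)
  rw [h.covD_smul (h.differentiableAt hq (h.contDiffOn_kap 1)) (h.differentiableAt hq h.contDiffOn_nor),
    h.covD_space_nor hq] at h4
  have h5 : fderiv ℝ (S.kap x 1) q (0, 1) = S.speed x q • S.kap x 2 q := h.dX_eq hq (S.kap x 1)
  have h6 : fderiv ℝ x q (1, 0) = S.kap x 0 q • S.nor x q := h.flow q hq
  have h7 : fderiv ℝ x q (0, 1) = S.speed x q • S.tang x q := h.dX_eq hq x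
  have h8 : S.riem (x q) (S.kap x 0 q • S.nor x q) (S.speed x q • S.tang x q) (S.tang x q) =
      (S.kap x 0 q * S.speed x q) • S.riem (x q) (S.nor x q) (S.tang x q) (S.tang x q) := by
    simp only [riem, map_smul, smul_apply, smul_sub, smul_add, smul_smul]
    simp only [mul_comm]
  rw [h2, h1, h3, h.covD_comm hq (1, 0) (0, 1) h.contDiffOn_tang, h4, h5, h6, h7, h8,
    h.dT_inv_speed hq, h.covD_space_tang hq, h.covD_time_nor hq]
  simp only [map_smul, map_add, smul_apply, smul_eq_mul,
    add_apply, h.G_nor_tang hq, h.G_tang_nor hq, h.G_nor_nor hq]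
  field_simp
  ring

/-- Subtract from the evolution of k the time derivative of dψ(N). The rotation ∇_t N = -κ_s T of
the normal gives the drift dψ(T) κ_s, and the motion x_t = κ N gives the Hessian of ψ in the normal
direction, which is part of `reaction`. -/
theorem dT_kap_zero (h : S.IsFlow O x) (hq : q ∈ O) :
    dT (S.kap x 0) q = S.kap x 2 q + fderiv ℝ S.ψ (x q) (S.tang x q) * S.kap x 1 q
      + S.kap x 0 q * (S.geoCurv x q ^ 2 + S.reaction (x q) (S.tang x q)) := by
  have hx := (h.differentiableAt hq h.smooth).hasFDerivAt
  have hψ := ((S.smooth_ψ.fderiv_of_isOpen S.isOpen (m := ∞) (by simp)).contDiffAt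
    (S.isOpen.mem_nhds (h.mapsTo hq))).differentiableAt (by simp)
  have hn := (h.differentiableAt hq h.contDiffOn_nor).hasFDerivAt
  have h1 := (h.differentiableAt hq h.contDiffOn_geoCurv).hasFDerivAt.sub
    ((hψ.hasFDerivAt.comp q hx).clm_apply hn)
  have h2 : fderiv ℝ (S.nor x) q (1, 0) = S.covD x (1, 0) (S.nor x) q
      - S.Γ (x q) (fderiv ℝ x q (1, 0)) (S.nor x q) := by simp [covD]
  have h6 : fderiv ℝ x q (1, 0) = S.kap x 0 q • S.nor x q := h.flow q hq
  have h3 := h1.fderiv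
  have h4 : (S.geoCurv x - fun q => (fderiv ℝ S.ψ ∘ x) q (S.nor x q)) = S.kap x 0 := rfl
  rw [h4] at h3
  have h5 := h.dT_geoCurv hq
  rw [dT] at h5 ⊢
  rw [h3]
  simp only [sub_apply, add_apply,
    ContinuousLinearMap.comp_apply, ContinuousLinearMap.flip_apply, Function.comp_def]
  rw [h5, h2, h6, h.covD_time_nor hq]
  simp only [reaction, nor, map_smul, map_sub, smul_apply, smul_eq_mul]
  ring

end IsFlow
end PlaneGeometry
end DensityFlow
end

/-! ### Structure of the evolution equations of the higher derivatives -/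

noncomputable section

namespace DensityFlow
namespace PlaneGeometry

variable (S : PlaneGeometry) {E : Type*} [NormedAddCommGroup E] [NormedSpace ℝ E]
  {O : Set (ℝ × ℝ)} {x : ℝ × ℝ → Plane} {q : ℝ × ℝ}

/-- Polynomials in the first `j` arc length derivatives of the curvature with density, with
coefficients that are smooth functions of the position and the unit tangent vector. -/
inductive Adm (x : ℝ × ℝ → Plane) (j : ℕ) : (ℝ × ℝ → ℝ) → Prop
  | base (F : Plane × Plane → ℝ) (hF : ContDiffOn ℝ ∞ F (S.Ω ×ˢ univ)) :
      Adm x j fun q => F (x q, S.tang x q)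
  | kap (i : ℕ) (hi : i ≤ j) : Adm x j (S.kap x i)
  | add {f g : ℝ × ℝ → ℝ} (hf : Adm x j f) (hg : Adm x j g) : Adm x j fun q => f q + g q
  | mul {f g : ℝ × ℝ → ℝ} (hf : Adm x j f) (hg : Adm x j g) : Adm x j fun q => f q * g q

/-- Over a compact set the metric dominates a positive multiple of the Euclidean one, so unit
vectors are bounded. Continuous functions of position and unit tangent are therefore bounded there,
which is the source of the constants in the estimates. -/
theorem isCompact_unit_tangent {K : Set Plane} (hK : IsCompact K) (hKΩ : K ⊆ S.Ω) :
    IsCompact {z : Plane × Plane | z.1 ∈ K ∧ S.G z.1 z.2 z.2 = 1} := by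
  have hcont : ContinuousOn (fun z : Plane × Plane => S.G z.1 z.2 z.2) (K ×ˢ univ) := by
    have : ContinuousOn (fun z : Plane × Plane => S.G z.1) (K ×ˢ univ) :=
      (S.smooth_G.continuousOn.mono hKΩ).comp continuousOn_fst fun _ hz => hz.1
    exact (this.clm_apply continuousOn_snd).clm_apply continuousOn_snd
  -- The minimum of the metric over Euclidean unit vectors, extended by homogeneity; the empty set
  -- is treated apart because it has no minimum.
  obtain ⟨m, hm, hmG⟩ : ∃ m > 0, ∀ y ∈ K, ∀ u, m * ‖u‖ ^ 2 ≤ S.G y u u := by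
    rcases (K ×ˢ Metric.sphere (0 : Plane) 1).eq_empty_or_nonempty with he | hne
    · have hKe : K = ∅ := by
        rcases prod_eq_empty_iff.1 he with h | h
        · exact h
        · exact absurd h (NormedSpace.sphere_nonempty.2 zero_le_one).ne_empty
      exact ⟨1, one_pos, by simp [hKe]⟩
    obtain ⟨z, hz, hzm⟩ := (hK.prod (isCompact_sphere (0 : Plane) 1)).exists_isMinOn hne
      (hcont.mono (prod_mono_right (subset_univ _)))
    have hz0 : z.2 ≠ 0 := by
      intro h0
      have : ‖z.2‖ = 1 := by simpa using hz.2
      simp [h0] at this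
    refine ⟨_, S.pos_G _ (hKΩ hz.1) _ hz0, fun y hy u => ?_⟩
    rcases eq_or_ne u 0 with rfl | hu
    · simp
    have hn : ‖u‖ ≠ 0 := norm_ne_zero_iff.2 hu
    have h1 := hzm (show (y, ‖u‖⁻¹ • u) ∈ K ×ˢ Metric.sphere (0 : Plane) 1 from
      ⟨hy, by simp [norm_smul, hn]⟩)
    simp only [mem_ofPred_eq, map_smul, smul_apply, smul_eq_mul] at h1
    calc _ ≤ (‖u‖⁻¹ * (‖u‖⁻¹ * S.G y u u)) * ‖u‖ ^ 2 := by gcongr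
      _ = _ := by field_simp
  have hsub : {z : Plane × Plane | z.1 ∈ K ∧ S.G z.1 z.2 z.2 = 1} =
      (K ×ˢ Metric.closedBall 0 (√(1 / m))) ∩ (fun z : Plane × Plane => S.G z.1 z.2 z.2) ⁻¹' {1} := by
    ext z
    simp only [mem_ofPred_eq, mem_inter_iff, mem_prod, mem_closedBall_zero_iff, mem_preimage,
      mem_singleton_iff]
    refine ⟨fun hz => ⟨⟨hz.1, ?_⟩, hz.2⟩, fun hz => ⟨hz.1.1, hz.2⟩⟩
    apply Real.le_sqrt_of_sq_le
    have := hmG z.1 hz.1 z.2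
    rw [le_div_iff₀ hm]
    linarith [hz.2]
  rw [hsub]
  have hc := hK.prod (isCompact_closedBall (0 : Plane) (√(1 / m)))
  exact hc.of_isClosed_subset (ContinuousOn.preimage_isClosed_of_isClosed
    (hcont.mono (prod_mono_right (subset_univ _))) hc.isClosed isClosed_singleton) inter_subset_left

theorem contDiffOn_fderiv_ψ_snd :
    ContDiffOn ℝ ∞ (fun z : Plane × Plane => fderiv ℝ S.ψ z.1 z.2) (S.Ω ×ˢ univ) :=
  ((S.smooth_ψ.fderiv_of_isOpen S.isOpen (m := ∞) (by simp)).comp contDiffOn_fst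
    fun _ hz => hz.1).clm_apply contDiffOn_snd

theorem contDiffOn_J_snd :
    ContDiffOn ℝ ∞ (fun z : Plane × Plane => S.J z.1 z.2) (S.Ω ×ˢ univ) :=
  (S.smooth_J.comp contDiffOn_fst fun _ hz => hz.1).clm_apply contDiffOn_snd

theorem contDiffOn_Γ_snd {f g : Plane × Plane → Plane} (hf : ContDiffOn ℝ ∞ f (S.Ω ×ˢ univ))
    (hg : ContDiffOn ℝ ∞ g (S.Ω ×ˢ univ)) :
    ContDiffOn ℝ ∞ (fun z : Plane × Plane => S.Γ z.1 (f z) (g z)) (S.Ω ×ˢ univ) :=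
  ((S.smooth_Γ.comp contDiffOn_fst fun _ hz => hz.1).clm_apply hf).clm_apply hg

theorem contDiffOn_G_snd {f g : Plane × Plane → Plane} (hf : ContDiffOn ℝ ∞ f (S.Ω ×ˢ univ))
    (hg : ContDiffOn ℝ ∞ g (S.Ω ×ˢ univ)) :
    ContDiffOn ℝ ∞ (fun z : Plane × Plane => S.G z.1 (f z) (g z)) (S.Ω ×ˢ univ) :=
  ((S.smooth_G.comp contDiffOn_fst fun _ hz => hz.1).clm_apply hf).clm_apply hg

theorem contDiffOn_dψ_J :
    ContDiffOn ℝ ∞ (fun z : Plane × Plane => fderiv ℝ S.ψ z.1 (S.J z.1 z.2)) (S.Ω ×ˢ univ) :=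
  ((S.smooth_ψ.fderiv_of_isOpen S.isOpen (m := ∞) (by simp)).comp contDiffOn_fst
    fun _ hz => hz.1).clm_apply S.contDiffOn_J_snd

set_option maxSynthPendingDepth 3 in
theorem contDiffOn_reaction :
    ContDiffOn ℝ ∞ (fun z : Plane × Plane => S.reaction z.1 z.2) (S.Ω ×ˢ univ) := by
  have h1 := S.contDiffOn_J_snd
  have h2 : ContDiffOn ℝ ∞ (fun z : Plane × Plane => z.2) (S.Ω ×ˢ univ) := contDiffOn_snd
  have hdΓ : ContDiffOn ℝ ∞ (fun z : Plane × Plane => fderiv ℝ S.Γ z.1) (S.Ω ×ˢ univ) :=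
    (S.smooth_Γ.fderiv_of_isOpen S.isOpen (m := ∞) (by simp)).comp contDiffOn_fst fun _ hz => hz.1
  have hψ := S.smooth_ψ.fderiv_of_isOpen S.isOpen (m := ∞) (by simp)
  have hdψ : ContDiffOn ℝ ∞ (fun z : Plane × Plane => fderiv ℝ S.ψ z.1) (S.Ω ×ˢ univ) :=
    hψ.comp contDiffOn_fst fun _ hz => hz.1
  have hddψ : ContDiffOn ℝ ∞ (fun z : Plane × Plane => fderiv ℝ (fderiv ℝ S.ψ) z.1) (S.Ω ×ˢ univ) :=
    (hψ.fderiv_of_isOpen S.isOpen (m := ∞) (by simp)).comp contDiffOn_fst fun _ hz => hz.1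
  refine (S.contDiffOn_G_snd ?_ h1).sub (((hddψ.clm_apply h1).clm_apply h1).sub
    (hdψ.clm_apply (S.contDiffOn_Γ_snd h1 h1)))
  exact (((((hdΓ.clm_apply h1).clm_apply h2).clm_apply h2).sub
    (((hdΓ.clm_apply h2).clm_apply h1).clm_apply h2)).add
    (S.contDiffOn_Γ_snd h1 (S.contDiffOn_Γ_snd h2 h2))).sub
    (S.contDiffOn_Γ_snd h2 (S.contDiffOn_Γ_snd h1 h2))

variable {S}

namespace IsFlow

theorem dS_congr (h : S.IsFlow O x) (hq : q ∈ O) {f g : ℝ × ℝ → E} (hfg : EqOn f g O) :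
    S.dS x f q = S.dS x g q := by
  simp only [dS, dX]; rw [h.fderiv_congr_on hq hfg]

theorem dS_add (h : S.IsFlow O x) (hq : q ∈ O) {f g : ℝ × ℝ → E} (hf : ContDiffOn ℝ ∞ f O)
    (hg : ContDiffOn ℝ ∞ g O) : S.dS x (fun q => f q + g q) q = S.dS x f q + S.dS x g q := by
  simp only [dS, dX]
  rw [fderiv_fun_add (h.differentiableAt hq hf) (h.differentiableAt hq hg)]
  simp

theorem dS_mul (h : S.IsFlow O x) (hq : q ∈ O) {f g : ℝ × ℝ → ℝ} (hf : ContDiffOn ℝ ∞ f O)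
    (hg : ContDiffOn ℝ ∞ g O) :
    S.dS x (fun q => f q * g q) q = f q * S.dS x g q + g q * S.dS x f q := by
  simp only [dS, dX]
  rw [fderiv_fun_mul (h.differentiableAt hq hf) (h.differentiableAt hq hg)]
  simp
  ring

theorem geoCurv_eq : S.geoCurv x q = S.kap x 0 q + fderiv ℝ S.ψ (x q) (S.nor x q) := by
  simp [kap]

theorem dS_tang (h : S.IsFlow O x) (hq : q ∈ O) :
    S.dS x (S.tang x) q = S.geoCurv x q • S.nor x q - S.Γ (x q) (S.tang x q) (S.tang x q) := by
  have h1 := h.covD_space_tang hq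
  have hv := h.speed_pos hq
  have h7 : fderiv ℝ x q (0, 1) = S.speed x q • S.tang x q := h.dX_eq hq x
  rw [covD, h7, ← eq_sub_iff_add_eq] at h1
  simp only [dS, dX]
  rw [h1]
  simp only [map_smul, smul_sub, smul_smul, smul_apply]
  rw [← mul_assoc, inv_mul_cancel₀ hv.ne']
  simp

theorem contDiffOn_adm (h : S.IsFlow O x) {j : ℕ} {f : ℝ × ℝ → ℝ} (hf : S.Adm x j f) :
    ContDiffOn ℝ ∞ f O := by
  induction hf with
  | base F hF => exact hF.comp (h.smooth.prodMk h.contDiffOn_tang) fun q hq => ⟨h.mapsTo hq, mem_univ _⟩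
  | kap i _ => exact h.contDiffOn_kap i
  | add _ _ h1 h2 => exact h1.add h2
  | mul _ _ h1 h2 => exact h1.mul h2

theorem _root_.DensityFlow.PlaneGeometry.Adm.mono {i j : ℕ} (hij : i ≤ j) {f : ℝ × ℝ → ℝ}
    (hf : S.Adm x i f) : S.Adm x j f := by
  induction hf with
  | base F hF => exact .base F hF
  | kap l hl => exact .kap l (hl.trans hij)
  | add _ _ h1 h2 => exact .add h1 h2
  | mul _ _ h1 h2 => exact .mul h1 h2

/-- Chain rule with x_s = T and T_s = k N - Γ(T, T), where k = κ + dψ(N); the part of T_s containing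
κ gives `F₂`. -/
theorem dS_base (h : S.IsFlow O x) {F : Plane × Plane → ℝ} (hF : ContDiffOn ℝ ∞ F (S.Ω ×ˢ univ)) :
    ∃ F₁ F₂ : Plane × Plane → ℝ, ContDiffOn ℝ ∞ F₁ (S.Ω ×ˢ univ) ∧ ContDiffOn ℝ ∞ F₂ (S.Ω ×ˢ univ) ∧
      ∀ q ∈ O, S.dS x (fun q => F (x q, S.tang x q)) q =
        F₁ (x q, S.tang x q) + F₂ (x q, S.tang x q) * S.kap x 0 q := by
  have hopen : IsOpen (S.Ω ×ˢ (univ : Set Plane)) := S.isOpen.prod isOpen_univ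
  have hdF := hF.fderiv_of_isOpen hopen (m := ∞) (by simp)
  refine ⟨fun z => fderiv ℝ F z (z.2, fderiv ℝ S.ψ z.1 (S.J z.1 z.2) • S.J z.1 z.2 - S.Γ z.1 z.2 z.2),
    fun z => fderiv ℝ F z (0, S.J z.1 z.2), ?_, ?_, fun q hq => ?_⟩
  · exact hdF.clm_apply (contDiffOn_snd.prodMk ((S.contDiffOn_dψ_J.smul S.contDiffOn_J_snd).sub
      (S.contDiffOn_Γ_snd contDiffOn_snd contDiffOn_snd)))
  · exact hdF.clm_apply (contDiffOn_const.prodMk S.contDiffOn_J_snd)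
  · have hx := (h.differentiableAt hq h.smooth).hasFDerivAt
    have ht := (h.differentiableAt hq h.contDiffOn_tang).hasFDerivAt
    have hFd := (ContDiffOn.differentiableAt_of_isOpen (q := (x q, S.tang x q)) hF hopen
      ⟨h.mapsTo hq, mem_univ _⟩).hasFDerivAt
    have h1 := (hFd.comp (f := fun q => (x q, S.tang x q)) q (hx.prodMk ht)).fderiv
    simp only [Function.comp_def] at h1
    have h2 : S.dS x (fun q => F (x q, S.tang x q)) q =
        fderiv ℝ F (x q, S.tang x q) (S.tang x q, S.dS x (S.tang x) q) := by
      rw [dS, dX, h1]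
      simp only [ContinuousLinearMap.comp_apply, ContinuousLinearMap.prod_apply]
      rw [← map_smul]
      rfl
    rw [h2, h.dS_tang hq, geoCurv_eq]
    have h3 : (S.tang x q, (S.kap x 0 q + fderiv ℝ S.ψ (x q) (S.nor x q)) • S.nor x q
        - S.Γ (x q) (S.tang x q) (S.tang x q)) =
        (S.tang x q, fderiv ℝ S.ψ (x q) (S.nor x q) • S.nor x q - S.Γ (x q) (S.tang x q) (S.tang x q))
        + S.kap x 0 q • ((0 : Plane), S.nor x q) := by
      ext1
      · simp
      · simp [add_smul]; abel
    rw [h3, map_add, map_smul, smul_eq_mul, mul_comm (S.kap x 0 q)]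
    rfl

/-- Only differentiating κ_j itself creates κ_{j+1}, which therefore enters linearly. This linearity
is what the Bernstein estimate relies on. -/
theorem dS_adm (h : S.IsFlow O x) {j : ℕ} {f : ℝ × ℝ → ℝ} (hf : S.Adm x j f) :
    ∃ f₁ f₂, S.Adm x j f₁ ∧ S.Adm x j f₂ ∧
      ∀ q ∈ O, S.dS x f q = f₁ q + f₂ q * S.kap x (j + 1) q := by
  have hconst : ∀ c : ℝ, S.Adm x j fun _ => c := fun c => .base (fun _ => c) contDiffOn_const
  induction hf with
  | base F hF =>
    obtain ⟨F₁, F₂, h1, h2, h3⟩ := h.dS_base hF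
    exact ⟨_, _, (Adm.base F₁ h1).add ((Adm.base F₂ h2).mul (.kap 0 (Nat.zero_le _))), hconst 0,
      fun q hq => by rw [h3 q hq]; simp⟩
  | kap i hi =>
    rcases hi.eq_or_lt with rfl | hlt
    · exact ⟨_, _, hconst 0, hconst 1, fun q _ => by simp [kap]⟩
    · exact ⟨_, _, .kap (i + 1) hlt, hconst 0, fun q _ => by simp [kap]⟩
  | @add f g hf hg h1 h2 =>
    obtain ⟨f₁, f₂, hf1, hf2, hfe⟩ := h1
    obtain ⟨g₁, g₂, hg1, hg2, hge⟩ := h2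
    refine ⟨_, _, hf1.add hg1, hf2.add hg2, fun q hq => ?_⟩
    rw [h.dS_add hq (h.contDiffOn_adm hf) (h.contDiffOn_adm hg), hfe q hq, hge q hq]
    ring
  | @mul f g hf hg h1 h2 =>
    obtain ⟨f₁, f₂, hf1, hf2, hfe⟩ := h1
    obtain ⟨g₁, g₂, hg1, hg2, hge⟩ := h2
    refine ⟨_, _, (hf.mul hg1).add (hg.mul hf1), (hf.mul hg2).add (hg.mul hf2), fun q hq => ?_⟩
    rw [h.dS_mul hq (h.contDiffOn_adm hf) (h.contDiffOn_adm hg), hfe q hq, hge q hq]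
    ring

theorem adm_bounded (h : S.IsFlow O x) {j : ℕ} {f : ℝ × ℝ → ℝ} (hf : S.Adm x j f)
    {K : Set Plane} (hK : IsCompact K) (hKΩ : K ⊆ S.Ω) (B : ℝ) :
    ∃ C, ∀ q ∈ O, x q ∈ K → (∀ i ≤ j, |S.kap x i q| ≤ B) → |f q| ≤ C := by
  induction hf with
  | base F hF =>
    obtain ⟨C, hC⟩ := (S.isCompact_unit_tangent hK hKΩ).exists_bound_of_continuousOn
      (hF.continuousOn.mono fun z hz => ⟨hKΩ hz.1, mem_univ _⟩)
    exact ⟨C, fun q hq hqK _ => hC (x q, S.tang x q) ⟨hqK, h.G_tang_tang hq⟩⟩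
  | kap i hi => exact ⟨B, fun q _ _ hb => hb i hi⟩
  | add _ _ h1 h2 =>
    obtain ⟨C₁, h1⟩ := h1
    obtain ⟨C₂, h2⟩ := h2
    exact ⟨C₁ + C₂, fun q hq hK hb => (abs_add_le _ _).trans (add_le_add (h1 q hq hK hb) (h2 q hq hK hb))⟩
  | mul _ _ h1 h2 =>
    obtain ⟨C₁, h1⟩ := h1
    obtain ⟨C₂, h2⟩ := h2
    refine ⟨C₁ * C₂, fun q hq hK hb => ?_⟩
    rw [abs_mul]
    exact mul_le_mul (h1 q hq hK hb) (h2 q hq hK hb) (abs_nonneg _) ((abs_nonneg _).trans (h1 q hq hK hb))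

/-- Apply `∂_s` to the equation for κ_j. The derivative of the drift coefficient dψ(T) and the
commutator of `∂_t` with `∂_s` multiply κ_{j+1} by admissible functions of order `j`, and `dS_adm`
treats the remainder. Keeping the result affine in κ_{j+1} allows an estimate in which only the
derivatives up to order `j` are known to be bounded. -/
theorem dT_kap_succ_of (h : S.IsFlow O x) {j : ℕ} {R : ℝ × ℝ → ℝ} (hR : S.Adm x j R)
    (hj : ∀ q ∈ O, dT (S.kap x j) q = S.kap x (j + 2) q
      + fderiv ℝ S.ψ (x q) (S.tang x q) * S.kap x (j + 1) q + R q) :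
    ∃ R₁ R₂, S.Adm x j R₁ ∧ S.Adm x j R₂ ∧ ∀ q ∈ O, dT (S.kap x (j + 1)) q = S.kap x (j + 3) q
      + fderiv ℝ S.ψ (x q) (S.tang x q) * S.kap x (j + 2) q + (R₁ q + R₂ q * S.kap x (j + 1) q) := by
  obtain ⟨f₁, f₂, hf1, hf2, hfe⟩ := h.dS_adm hR
  obtain ⟨g₁, g₂, hg1, hg2, hge⟩ := h.dS_base S.contDiffOn_fderiv_ψ_snd
  have hk0 : S.Adm x j (S.kap x 0) := .kap 0 (Nat.zero_le _)
  refine ⟨f₁, _, hf1, hf2.add (((Adm.base g₁ hg1).add ((Adm.base g₂ hg2).mul hk0)).add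
    ((hk0.add (Adm.base _ S.contDiffOn_dψ_J)).mul hk0)), fun q hq => ?_⟩
  have hψ : ContDiffOn ℝ ∞ (fun q => fderiv ℝ S.ψ (x q) (S.tang x q)) O :=
    h.contDiffOn_fderiv_ψ.clm_apply h.contDiffOn_tang
  have h1 := h.dT_dS hq (h.contDiffOn_kap j)
  have h2 : S.dS x (dT (S.kap x j)) q = S.kap x (j + 3) q
      + (fderiv ℝ S.ψ (x q) (S.tang x q) * S.kap x (j + 2) q
        + S.kap x (j + 1) q * (g₁ (x q, S.tang x q) + g₂ (x q, S.tang x q) * S.kap x 0 q))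
      + (f₁ q + f₂ q * S.kap x (j + 1) q) := by
    rw [h.dS_congr hq (g := fun q => S.kap x (j + 2) q
      + fderiv ℝ S.ψ (x q) (S.tang x q) * S.kap x (j + 1) q + R q) (fun p hp => hj p hp),
      h.dS_add hq ((h.contDiffOn_kap _).add (hψ.mul (h.contDiffOn_kap _))) (h.contDiffOn_adm hR),
      h.dS_add hq (h.contDiffOn_kap _) (hψ.mul (h.contDiffOn_kap _)),
      h.dS_mul hq hψ (h.contDiffOn_kap _), hfe q hq, hge q hq]
    rfl
  have h3 : dT (S.kap x (j + 1)) q = dT (S.dS x (S.kap x j)) q := rfl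
  rw [h3, h1, h2, geoCurv_eq]
  have h4 : S.dS x (S.kap x j) q = S.kap x (j + 1) q := rfl
  rw [h4]
  simp only [nor, smul_eq_mul]
  ring

theorem exists_dT_kap (h : S.IsFlow O x) (j : ℕ) : ∃ R, S.Adm x j R ∧
    ∀ q ∈ O, dT (S.kap x j) q = S.kap x (j + 2) q
      + fderiv ℝ S.ψ (x q) (S.tang x q) * S.kap x (j + 1) q + R q := by
  induction j with
  | zero =>
    have hk0 : S.Adm x 0 (S.kap x 0) := .kap 0 le_rfl
    have hk := hk0.add (Adm.base _ S.contDiffOn_dψ_J)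
    refine ⟨_, hk0.mul ((hk.mul hk).add (.base _ S.contDiffOn_reaction)), fun q hq => ?_⟩
    rw [h.dT_kap_zero hq, geoCurv_eq]
    simp only [nor]
    ring
  | succ j ih =>
    obtain ⟨R, hR, hj⟩ := ih
    obtain ⟨R₁, R₂, h1, h2, h3⟩ := h.dT_kap_succ_of hR hj
    exact ⟨_, (h1.mono (Nat.le_succ j)).add ((h2.mono (Nat.le_succ j)).mul (.kap (j + 1) le_rfl)), h3⟩

theorem exists_dT_kap_succ (h : S.IsFlow O x) (j : ℕ) : ∃ R₁ R₂, S.Adm x j R₁ ∧ S.Adm x j R₂ ∧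
    ∀ q ∈ O, dT (S.kap x (j + 1)) q = S.kap x (j + 3) q
      + fderiv ℝ S.ψ (x q) (S.tang x q) * S.kap x (j + 2) q + (R₁ q + R₂ q * S.kap x (j + 1) q) :=
  let ⟨_, hR, hj⟩ := h.exists_dT_kap j
  h.dT_kap_succ_of hR hj

/-- Bounds on curvature derivatives thus bound the arc length derivatives of any smooth function of
the position. -/
theorem iterate_dS_comp_adm (h : S.IsFlow O x) {f : Plane → ℝ} (hf : ContDiffOn ℝ ∞ f S.Ω) (j : ℕ) :
    ∃ g, S.Adm x j g ∧ EqOn ((S.dS x)^[j] (f ∘ x)) g O := by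
  induction j with
  | zero => exact ⟨_, .base (fun z => f z.1) (hf.comp contDiffOn_fst fun _ hz => hz.1), fun q _ => rfl⟩
  | succ j ih =>
    obtain ⟨g, hg, he⟩ := ih
    obtain ⟨f₁, f₂, h1, h2, h3⟩ := h.dS_adm hg
    refine ⟨_, (h1.mono (Nat.le_succ j)).add ((h2.mono (Nat.le_succ j)).mul (.kap (j + 1) le_rfl)),
      fun q hq => ?_⟩
    rw [Function.iterate_succ_apply', h.dS_congr hq he, h3 q hq]

end IsFlow
end PlaneGeometry
end DensityFlow
end

/-! ### Pointwise estimates at spatial maxima, the energy identity and barriers -/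

noncomputable section

namespace DensityFlow
namespace PlaneGeometry
namespace IsFlow

variable {S : PlaneGeometry} {E : Type*} [NormedAddCommGroup E] [NormedSpace ℝ E]
  {O : Set (ℝ × ℝ)} {x : ℝ × ℝ → Plane} {q : ℝ × ℝ}

theorem fderiv_sq (h : S.IsFlow O x) (hq : q ∈ O) {f : ℝ × ℝ → ℝ} (hf : ContDiffOn ℝ ∞ f O)
    (e : ℝ × ℝ) : fderiv ℝ (fun q => f q ^ 2) q e = 2 * f q * fderiv ℝ f q e := by
  have := ((h.differentiableAt hq hf).hasFDerivAt.pow 2).fderiv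
  rw [this]; simp

theorem dS_sq (h : S.IsFlow O x) (hq : q ∈ O) {f : ℝ × ℝ → ℝ} (hf : ContDiffOn ℝ ∞ f O) :
    S.dS x (fun q => f q ^ 2) q = 2 * f q * S.dS x f q := by
  simp only [dS, dX]; rw [h.fderiv_sq hq hf]; simp only [smul_eq_mul]; ring

theorem dS_const_mul (h : S.IsFlow O x) (hq : q ∈ O) {f : ℝ × ℝ → ℝ} (hf : ContDiffOn ℝ ∞ f O)
    (c : ℝ) : S.dS x (fun q => c * f q) q = c * S.dS x f q := by
  rw [h.dS_mul hq contDiffOn_const hf]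
  simp [dS, dX]

theorem dS_dS_sq (h : S.IsFlow O x) (hq : q ∈ O) {f : ℝ × ℝ → ℝ} (hf : ContDiffOn ℝ ∞ f O) :
    S.dS x (S.dS x fun q => f q ^ 2) q = 2 * S.dS x f q ^ 2 + 2 * f q * S.dS x (S.dS x f) q := by
  rw [h.dS_congr hq (g := fun q => 2 * (f q * S.dS x f q)) (fun p hp => by
    simp only; rw [h.dS_sq hp hf]; ring),
    h.dS_const_mul hq (hf.mul (h.contDiffOn_dS hf)), h.dS_mul hq hf (h.contDiffOn_dS hf)]
  ring

theorem fderiv_ψ_comp (h : S.IsFlow O x) (hq : q ∈ O) (e : ℝ × ℝ) :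
    fderiv ℝ (fun q => S.ψ (x q)) q e = fderiv ℝ S.ψ (x q) (fderiv ℝ x q e) := by
  have hx := (h.differentiableAt hq h.smooth).hasFDerivAt
  have hψ := (ContDiffOn.differentiableAt_of_isOpen S.smooth_ψ S.isOpen (h.mapsTo hq)).hasFDerivAt
  have := (hψ.comp q hx).fderiv
  simp only [Function.comp_def] at this
  rw [this]; simp

theorem contDiffOn_ψ (h : S.IsFlow O x) : ContDiffOn ℝ ∞ (fun q => S.ψ (x q)) O :=
  S.smooth_ψ.comp h.smooth h.mapsTo

theorem fderiv_exp_ψ (h : S.IsFlow O x) (hq : q ∈ O) (e : ℝ × ℝ) :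
    fderiv ℝ (fun q => Real.exp (S.ψ (x q))) q e =
      Real.exp (S.ψ (x q)) * fderiv ℝ S.ψ (x q) (fderiv ℝ x q e) := by
  have := (h.differentiableAt hq h.contDiffOn_ψ).hasFDerivAt.exp.fderiv
  rw [this, smul_apply, h.fderiv_ψ_comp hq, smul_eq_mul]

theorem dT_density (h : S.IsFlow O x) (hq : q ∈ O) :
    dT (fun q => Real.exp (S.ψ (x q)) * S.speed x q) q =
      -S.kap x 0 q ^ 2 * (Real.exp (S.ψ (x q)) * S.speed x q) := by
  have h1 := h.differentiableAt hq h.contDiffOn_ψ.exp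
  have h2 := h.differentiableAt hq h.contDiffOn_speed
  have h3 := h.dT_speed hq
  have h4 := h.fderiv_exp_ψ hq (1, 0)
  have h6 : fderiv ℝ x q (1, 0) = S.kap x 0 q • S.nor x q := h.flow q hq
  rw [dT] at h3 ⊢
  rw [fderiv_fun_mul h1 h2]
  simp only [add_apply, smul_apply, h3, h4, h6, map_smul, smul_eq_mul, geoCurv_eq]
  ring

theorem dT_kap_sq (h : S.IsFlow O x) (hq : q ∈ O) {j : ℕ} {r : ℝ}
    (hr : dT (S.kap x j) q = S.kap x (j + 2) q
      + fderiv ℝ S.ψ (x q) (S.tang x q) * S.kap x (j + 1) q + r) :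
    dT (fun q => S.kap x j q ^ 2) q = S.dS x (S.dS x fun q => S.kap x j q ^ 2) q
      + fderiv ℝ S.ψ (x q) (S.tang x q) * S.dS x (fun q => S.kap x j q ^ 2) q
      - 2 * S.kap x (j + 1) q ^ 2 + 2 * S.kap x j q * r := by
  have h1 := h.fderiv_sq hq (h.contDiffOn_kap j) (1, 0)
  rw [h.dS_dS_sq hq (h.contDiffOn_kap j), h.dS_sq hq (h.contDiffOn_kap j)]
  rw [dT] at hr ⊢
  rw [h1, hr]
  have e1 : S.dS x (S.kap x j) = S.kap x (j + 1) := rfl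
  have e2 : S.dS x (S.kap x (j + 1)) = S.kap x (j + 2) := rfl
  rw [e1, e2]
  ring

/-- The weight absorbs the drift: e^ψ (f_ss + dψ(T) f_s) = (e^ψ f_s)_s. The second order terms thus
form an exact θ-derivative, which integrates to zero over the circle. The term -κ⁴ comes from the
decreasing density. -/
theorem dT_energy (h : S.IsFlow O x) (hq : q ∈ O) :
    dT (fun q => S.kap x 0 q ^ 2 * (Real.exp (S.ψ (x q)) * S.speed x q)) q =
      dX (fun q => Real.exp (S.ψ (x q)) * S.dS x (fun q => S.kap x 0 q ^ 2) q) q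
      + (Real.exp (S.ψ (x q)) * S.speed x q) * (-2 * S.kap x 1 q ^ 2 + 2 * S.kap x 0 q ^ 2 *
        (S.geoCurv x q ^ 2 + S.reaction (x q) (S.tang x q)) - S.kap x 0 q ^ 4) := by
  have hk := (h.contDiffOn_kap 0).pow 2
  have h1 := h.differentiableAt hq hk
  have h2 := h.differentiableAt hq (h.contDiffOn_ψ.exp.mul h.contDiffOn_speed)
  have h3 := h.dT_density hq
  have h4 := h.dT_kap_sq hq (h.dT_kap_zero hq)
  have h5 : S.dS x (S.dS x fun q => S.kap x 0 q ^ 2) q = (S.speed x q)⁻¹ *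
    dX (S.dS x fun q => S.kap x 0 q ^ 2) q := rfl
  have hv := h.speed_pos hq
  have h7 : fderiv ℝ x q (0, 1) = S.speed x q • S.tang x q := h.dX_eq hq x
  have e1 := h.differentiableAt hq h.contDiffOn_ψ.exp
  have e2 := h.differentiableAt hq (h.contDiffOn_dS hk)
  have e3 := h.fderiv_exp_ψ hq (0, 1)
  rw [h5] at h4
  rw [dT] at h3 h4 ⊢
  rw [fderiv_fun_mul h1 h2, dX, fderiv_fun_mul e1 e2]
  simp only [add_apply, smul_apply, h3, h4, e3, h7, map_smul, smul_eq_mul]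
  rw [dX]
  field_simp
  ring

/-- Since the first derivative vanishes at the maximum, the derivative of `v⁻¹` does not contribute,
and the second arc length derivative has the sign of the second θ-derivative. -/
theorem isLocalMax_dS (h : S.IsFlow O x) {Q : ℝ × ℝ → ℝ} (hQ : ContDiffOn ℝ ∞ Q O) {t θ : ℝ}
    (hq : (t, θ) ∈ O) (hmax : IsLocalMax (fun s => Q (t, s)) θ) :
    S.dS x Q (t, θ) = 0 ∧ S.dS x (S.dS x Q) (t, θ) ≤ 0 := by
  have hd := h.differentiableAt hq hQ
  have hX := h.differentiableAt hq (h.contDiffOn_dX hQ)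
  have h0 : dX Q (t, θ) = 0 := by
    rw [← (hasDerivAt_space hd).deriv]; exact hmax.deriv_eq_zero
  have h1 : deriv (fun s => Q (t, s)) =ᶠ[𝓝 θ] fun s => dX Q (t, s) := by
    have : Tendsto (fun s : ℝ => (t, s)) (𝓝 θ) (𝓝 (t, θ)) := by
      exact (Continuous.prodMk_right t).tendsto θ
    filter_upwards [this.eventually (h.isOpen.mem_nhds hq)] with s hs
    exact (hasDerivAt_space (h.differentiableAt hs hQ)).deriv
  have h2 := deriv_deriv_nonpos_of_isLocalMax hmax (hasDerivAt_space hd).continuousAt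
  rw [h1.deriv_eq, (hasDerivAt_space hX).deriv] at h2
  have hv := h.speed_pos hq
  refine ⟨by simp [dS, h0], ?_⟩
  have h3 := (((h.differentiableAt hq h.contDiffOn_inv_speed).hasFDerivAt).smul hX.hasFDerivAt).fderiv
  have h4 : (fun q => (S.speed x q)⁻¹) • dX Q = S.dS x Q := rfl
  rw [h4] at h3
  have h5 : dX (S.dS x Q) (t, θ) = (S.speed x (t, θ))⁻¹ * dX (dX Q) (t, θ) := by
    rw [dX, h3, h0]
    simp [dX]
  rw [dS, h5, smul_eq_mul, ← mul_assoc]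
  exact mul_nonpos_of_nonneg_of_nonpos (by positivity) h2

theorem exists_reaction_le (h : S.IsFlow O x) {K : Set Plane} (hK : IsCompact K) (hKΩ : K ⊆ S.Ω) :
    ∃ C, 0 ≤ C ∧ ∀ q ∈ O, x q ∈ K →
      S.geoCurv x q ^ 2 + S.reaction (x q) (S.tang x q) ≤ C * (1 + S.kap x 0 q ^ 2) := by
  have hc := S.isCompact_unit_tangent hK hKΩ
  obtain ⟨C₁, h1⟩ := hc.exists_bound_of_continuousOn
    (S.contDiffOn_reaction.continuousOn.mono fun z hz => ⟨hKΩ hz.1, mem_univ _⟩)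
  obtain ⟨C₂, h2⟩ := hc.exists_bound_of_continuousOn
    (S.contDiffOn_dψ_J.continuousOn.mono fun z hz => ⟨hKΩ hz.1, mem_univ _⟩)
  -- From k² = (κ + dψ(N))² ≤ 2 κ² + 2 C₂², with `C₁` bounding the reaction term.
  refine ⟨|C₁| + 2 * C₂ ^ 2 + 2, by positivity, fun q hq hqK => ?_⟩
  have b1 := h1 (x q, S.tang x q) ⟨hqK, h.G_tang_tang hq⟩
  have b2 := h2 (x q, S.tang x q) ⟨hqK, h.G_tang_tang hq⟩
  rw [geoCurv_eq]
  simp only [Real.norm_eq_abs] at b1 b2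
  change |fderiv ℝ S.ψ (x q) (S.nor x q)| ≤ C₂ at b2
  have b3 : fderiv ℝ S.ψ (x q) (S.nor x q) ^ 2 ≤ C₂ ^ 2 := sq_le_sq' (by linarith [abs_le.1 b2]) (abs_le.1 b2).2
  have b4 := (abs_le.1 b1).2
  have b5 := le_abs_self C₁
  have b6 := sq_nonneg (S.kap x 0 q - fderiv ℝ S.ψ (x q) (S.nor x q))
  have b7 := mul_nonneg (abs_nonneg C₁) (sq_nonneg (S.kap x 0 q))
  have b8 := mul_nonneg (sq_nonneg C₂) (sq_nonneg (S.kap x 0 q))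
  nlinarith

theorem dT_kap_sq_le_of_isLocalMax (h : S.IsFlow O x) {t θ : ℝ} (hq : (t, θ) ∈ O)
    (hmax : IsLocalMax (fun s => S.kap x 0 (t, s) ^ 2) θ) :
    dT (fun q => S.kap x 0 q ^ 2) (t, θ) ≤ 2 * S.kap x 0 (t, θ) ^ 2 *
        (S.geoCurv x (t, θ) ^ 2 + S.reaction (x (t, θ)) (S.tang x (t, θ))) := by
  obtain ⟨h1, h2⟩ := h.isLocalMax_dS ((h.contDiffOn_kap 0).pow 2) hq hmax
  rw [h.dT_kap_sq hq (h.dT_kap_zero hq), h1]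
  nlinarith [sq_nonneg (S.kap x (0 + 1) (t, θ))]

/-- The diffusion in the equation of κ_j² leaves -2 κ_{j+1}², so λ κ_j² contributes the good term -2
λ κ_{j+1}² against the quadratic growth of the remainder. The constant does not depend on λ, which
can be chosen afterwards. -/
theorem exists_bernstein (h : S.IsFlow O x) {K : Set Plane} (hK : IsCompact K) (hKΩ : K ⊆ S.Ω)
    {B : ℝ} (hB : 0 ≤ B) (j : ℕ) :
    ∃ C, 0 ≤ C ∧ ∀ lam, 0 ≤ lam → ∀ t θ, (t, θ) ∈ O → x (t, θ) ∈ K →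
      (∀ i ≤ j, |S.kap x i (t, θ)| ≤ B) →
      IsLocalMax (fun s => S.kap x (j + 1) (t, s) ^ 2 + lam * S.kap x j (t, s) ^ 2) θ →
      dT (fun q => S.kap x (j + 1) q ^ 2 + lam * S.kap x j q ^ 2) (t, θ) ≤
        C + 2 * lam * B * C + (3 * C - 2 * lam) * S.kap x (j + 1) (t, θ) ^ 2 := by
  obtain ⟨R, hR, hRe⟩ := h.exists_dT_kap j
  obtain ⟨R₁, R₂, hR1, hR2, hRRe⟩ := h.exists_dT_kap_succ j
  obtain ⟨C₀, hC0⟩ := h.adm_bounded hR hK hKΩ B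
  obtain ⟨C₁, hC1⟩ := h.adm_bounded hR1 hK hKΩ B
  obtain ⟨C₂, hC2⟩ := h.adm_bounded hR2 hK hKΩ B
  set C := |C₀| + |C₁| + |C₂|
  refine ⟨C, by positivity, fun lam hlam t θ hq hxK hb hmax => ?_⟩
  set q := (t, θ)
  have hj1 := (h.contDiffOn_kap (j + 1)).pow 2
  have hj0 := (h.contDiffOn_kap j).pow 2
  have hlj : ContDiffOn ℝ ∞ (fun q => lam * S.kap x j q ^ 2) O := contDiffOn_const.mul hj0
  have hQ : ContDiffOn ℝ ∞ (fun q => S.kap x (j + 1) q ^ 2 + lam * S.kap x j q ^ 2) O := hj1.add hlj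
  obtain ⟨h1, h2⟩ := h.isLocalMax_dS hQ hq hmax
  have e1 := h.dT_kap_sq hq (hRRe q hq)
  have e0 := h.dT_kap_sq hq (hRe q hq)
  have eT : dT (fun q => S.kap x (j + 1) q ^ 2 + lam * S.kap x j q ^ 2) q =
      dT (fun q => S.kap x (j + 1) q ^ 2) q + lam * dT (fun q => S.kap x j q ^ 2) q := by
    simp only [dT]
    rw [fderiv_fun_add (h.differentiableAt hq hj1) (h.differentiableAt hq hlj),
      fderiv_const_mul (h.differentiableAt hq hj0)]
    simp
  have eS : ∀ p ∈ O, S.dS x (fun q => S.kap x (j + 1) q ^ 2 + lam * S.kap x j q ^ 2) p =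
      S.dS x (fun q => S.kap x (j + 1) q ^ 2) p + lam * S.dS x (fun q => S.kap x j q ^ 2) p := by
    intro p hp
    rw [h.dS_add hp hj1 hlj, h.dS_const_mul hp hj0]
  have eSS : S.dS x (S.dS x fun q => S.kap x (j + 1) q ^ 2 + lam * S.kap x j q ^ 2) q =
      S.dS x (S.dS x fun q => S.kap x (j + 1) q ^ 2) q
        + lam * S.dS x (S.dS x fun q => S.kap x j q ^ 2) q := by
    rw [h.dS_congr hq (g := fun p => S.dS x (fun q => S.kap x (j + 1) q ^ 2) p
      + lam * S.dS x (fun q => S.kap x j q ^ 2) p) eS,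
      h.dS_add hq (h.contDiffOn_dS hj1) (contDiffOn_const.mul (h.contDiffOn_dS hj0)),
      h.dS_const_mul hq (h.contDiffOn_dS hj0)]
  rw [eS q hq] at h1
  rw [eSS] at h2
  rw [eT, e1, e0]
  set a := S.kap x (j + 1) q
  set b := S.kap x j q
  have hbB : |b| ≤ B := hb j le_rfl
  have hCr : |R q| ≤ C := (hC0 q hq hxK hb).trans ((le_abs_self _).trans (by
    simp only [C]; linarith [abs_nonneg C₁, abs_nonneg C₂]))
  have hCr1 : |R₁ q| ≤ C := (hC1 q hq hxK hb).trans ((le_abs_self _).trans (by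
    simp only [C]; linarith [abs_nonneg C₀, abs_nonneg C₂]))
  have hCr2 : |R₂ q| ≤ C := (hC2 q hq hxK hb).trans ((le_abs_self _).trans (by
    simp only [C]; linarith [abs_nonneg C₁, abs_nonneg C₀]))
  have hC : 0 ≤ C := by positivity
  have i1 : b * R q ≤ B * C := (le_abs_self _).trans (by rw [abs_mul]; gcongr)
  -- This part of the remainder contributes `C` and `C * a ^ 2`; the part with `R₂` contributes `2 *
  -- C * a ^ 2`, whence the factor `3 * C`.
  have i2 : 2 * a * R₁ q ≤ C * (1 + a ^ 2) := by
    have : 2 * a * R₁ q ≤ 2 * |a| * C := by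
      refine (le_abs_self _).trans ?_
      rw [abs_mul, abs_mul, abs_two]; gcongr
    nlinarith [sq_nonneg (|a| - 1), sq_abs a]
  have i3 : a ^ 2 * R₂ q ≤ C * a ^ 2 := by nlinarith [le_abs_self (R₂ q), sq_nonneg a]
  have i4 : lam * (b * R q) ≤ lam * (B * C) := mul_le_mul_of_nonneg_left i1 hlam
  have i5 := sq_nonneg (S.kap x (j + 1 + 1) q)
  set p := fderiv ℝ S.ψ (x q) (S.tang x q)
  set u := S.dS x (fun q => S.kap x (j + 1) q ^ 2) q
  set w := S.dS x (fun q => S.kap x j q ^ 2) q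
  -- The drift terms combine into the first derivative of the full quantity, which vanishes at the
  -- maximum.
  have i6 : p * u + lam * (p * w) = 0 := by linear_combination p * h1
  nlinarith

/-- Small coordinate discs are barriers for the flow. -/
theorem _root_.DensityFlow.PlaneGeometry.exists_barrier (S : PlaneGeometry) {y₀ : Plane}
    (hy₀ : y₀ ∈ S.Ω) :
    ∃ r > 0, ∃ c > 0, Metric.closedBall y₀ r ⊆ S.Ω ∧ ∀ (O : Set (ℝ × ℝ)) (x : ℝ × ℝ → Plane),
      S.IsFlow O x → ∀ t θ, (t, θ) ∈ O → ‖x (t, θ) - y₀‖ ≤ r →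
      IsLocalMax (fun s => ‖x (t, s) - y₀‖ ^ 2) θ → dT (fun q => ‖x q - y₀‖ ^ 2) (t, θ) ≤ -c := by
  obtain ⟨r₀, hr0, hr0Ω⟩ := Metric.nhds_basis_closedBall.mem_iff.1 (S.isOpen.mem_nhds hy₀)
  have hc := S.isCompact_unit_tangent (isCompact_closedBall y₀ r₀) hr0Ω
  have hcont : ContinuousOn (fun z : Plane × Plane => S.Γ z.1 z.2 z.2 -
      fderiv ℝ S.ψ z.1 (S.J z.1 z.2) • S.J z.1 z.2) (S.Ω ×ˢ univ) :=
    ((S.contDiffOn_Γ_snd contDiffOn_snd contDiffOn_snd).sub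
      (S.contDiffOn_dψ_J.smul S.contDiffOn_J_snd)).continuousOn
  obtain ⟨C, hC⟩ := hc.exists_bound_of_continuousOn (hcont.mono fun z hz => ⟨hr0Ω hz.1, mem_univ _⟩)
  obtain ⟨m, hm, hmT⟩ : ∃ m > 0, ∀ z : Plane × Plane, z.1 ∈ Metric.closedBall y₀ r₀ →
      S.G z.1 z.2 z.2 = 1 → m ≤ ‖z.2‖ ^ 2 := by
    rcases {z : Plane × Plane | z.1 ∈ Metric.closedBall y₀ r₀ ∧ S.G z.1 z.2 z.2 = 1}.eq_empty_or_nonempty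
      with he | hne
    · exact ⟨1, one_pos, fun z h1 h2 => absurd (show z ∈ (∅ : Set _) from he ▸ ⟨h1, h2⟩) (notMem_empty z)⟩
    obtain ⟨z, hz, hzm⟩ := hc.exists_isMinOn hne (f := fun z : Plane × Plane => ‖z.2‖ ^ 2) (by fun_prop)
    refine ⟨‖z.2‖ ^ 2, ?_, fun w h1 h2 => hzm ⟨h1, h2⟩⟩
    have : z.2 ≠ 0 := by
      intro h0
      have := hz.2
      simp [h0] at this
    positivity
  -- The second arc length derivative of the squared distance contains 2 ‖T‖² ≥ 2 m. The connection
  -- and density terms are at most 2 C times the distance, hence at most `m` within the chosen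
  -- radius. At a spatial maximum this leaves a time derivative of at most -m.
  refine ⟨min r₀ (m / (2 * (|C| + 1))), by positivity, m, hm,
    (Metric.closedBall_subset_closedBall (min_le_left _ _)).trans hr0Ω, ?_⟩
  intro O x h t θ hq hxr hmax
  set q := (t, θ)
  have hρ : ContDiffOn ℝ ∞ (fun q => ‖x q - y₀‖ ^ 2) O := (h.smooth.sub contDiffOn_const).norm_sq ℝ
  obtain ⟨-, h2⟩ := h.isLocalMax_dS hρ hq hmax
  have hder : ∀ p ∈ O, ∀ e, fderiv ℝ (fun q => ‖x q - y₀‖ ^ 2) p e =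
      2 * inner ℝ (x p - y₀) (fderiv ℝ x p e) := by
    intro p hp e
    have := ((h.differentiableAt hp h.smooth).hasFDerivAt.sub_const y₀).norm_sq.fderiv
    rw [this]; simp [inner_sub_left]
  have hS : ∀ p ∈ O, S.dS x (fun q => ‖x q - y₀‖ ^ 2) p = 2 * inner ℝ (x p - y₀) (S.tang x p) := by
    intro p hp
    simp only [tang, dS, dX]
    rw [hder p hp, inner_smul_right, smul_eq_mul]; ring
  have hSS : S.dS x (S.dS x fun q => ‖x q - y₀‖ ^ 2) q = 2 * ‖S.tang x q‖ ^ 2 +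
      2 * inner ℝ (x q - y₀) (S.dS x (S.tang x) q) := by
    rw [h.dS_congr hq hS, h.dS_const_mul hq ((h.smooth.sub contDiffOn_const).inner ℝ h.contDiffOn_tang)]
    have h1 := ((h.differentiableAt hq h.smooth).hasFDerivAt.sub_const y₀).inner ℝ
      (h.differentiableAt hq h.contDiffOn_tang).hasFDerivAt
    simp only [dS, dX]
    rw [h1.fderiv]
    simp only [ContinuousLinearMap.comp_apply, ContinuousLinearMap.prod_apply, fderivInnerCLM_apply,
      smul_eq_mul, inner_smul_right]
    have h3 : S.tang x q = (S.speed x q)⁻¹ • fderiv ℝ x q (0, 1) := rfl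
    have h4 : inner ℝ (fderiv ℝ x q (0, 1)) (S.tang x q) = S.speed x q * ‖S.tang x q‖ ^ 2 := by
      have : fderiv ℝ x q (0, 1) = S.speed x q • S.tang x q := h.dX_eq hq x
      rw [this, inner_smul_left, real_inner_self_eq_norm_sq]; simp
    rw [h4]
    have hv := h.speed_pos hq
    field_simp
    ring
  rw [hSS, h.dS_tang hq, geoCurv_eq] at h2
  have hTq := h.G_tang_tang hq
  have hxr0 : x q ∈ Metric.closedBall y₀ r₀ := by
    rw [mem_closedBall_iff_norm]; exact hxr.trans (min_le_left _ _)
  have b1 := hC (x q, S.tang x q) ⟨hxr0, hTq⟩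
  have b2 := hmT (x q, S.tang x q) hxr0 hTq
  have h6 : fderiv ℝ x q (1, 0) = S.kap x 0 q • S.nor x q := h.flow q hq
  rw [dT, hder q hq, h6]
  have b3 : inner ℝ (x q - y₀) (S.Γ (x q) (S.tang x q) (S.tang x q) -
      fderiv ℝ S.ψ (x q) (S.nor x q) • S.nor x q) ≤ m / 2 := by
    refine (real_inner_le_norm _ _).trans ?_
    calc _ ≤ (m / (2 * (|C| + 1))) * (|C| + 1) := by
          refine mul_le_mul (hxr.trans (min_le_right _ _)) ?_ (norm_nonneg _) (by positivity)
          exact b1.trans ((le_abs_self C).trans (by linarith))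
      _ = m / 2 := by field_simp
  simp only [inner_sub_right, inner_smul_right, add_mul] at h2 b3 ⊢
  simp only at b2
  linarith

end IsFlow
end PlaneGeometry
end DensityFlow
end

/-! ### Metric, connection and rotation in a chart -/

noncomputable section

namespace DensityFlow

section Chart

variable {M : Type*} [TopologicalSpace M] [ChartedSpace Plane M]

theorem isOpen_chart_target (p : M) : IsOpen (extChartAt (𝓡 2) p).target :=
  isOpen_extChartAt_target p

variable [IsManifold (𝓡 2) ∞ M]

theorem mdifferentiableAt_chart_symm (p : M) {y : Plane} (hy : y ∈ (extChartAt (𝓡 2) p).target) :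
    MDifferentiableAt 𝓘(ℝ, Plane) (𝓡 2) (extChartAt (𝓡 2) p).symm y :=
  (((contMDiffOn_extChartAt_symm (n := ∞) p) y hy).contMDiffAt
    ((isOpen_chart_target p).mem_nhds hy)).mdifferentiableAt (by simp)

/-- Differential of the inverse of the preferred chart at `p`. -/
def chartDeriv (p : M) (y : Plane) : Plane →L[ℝ] Plane :=
  mfderiv 𝓘(ℝ, Plane) (𝓡 2) (extChartAt (𝓡 2) p).symm y

theorem contMDiffOn_chartDeriv (p : M) (u : Plane) :
    ContMDiffOn 𝓘(ℝ, Plane) ((𝓡 2).prod 𝓘(ℝ, Plane)) ∞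
      (fun y => (⟨(extChartAt (𝓡 2) p).symm y, chartDeriv p y u⟩ : TangentBundle (𝓡 2) M))
      (extChartAt (𝓡 2) p).target := by
  have ho := isOpen_chart_target p
  have h1 := (contMDiffOn_extChartAt_symm (I := 𝓡 2) (n := ∞) p).contMDiffOn_tangentMapWithin
    (m := ∞) (by simp) ho.uniqueMDiffOn
  have h2 : ContMDiff 𝓘(ℝ, Plane) (𝓘(ℝ, Plane).prod 𝓘(ℝ, Plane)) ∞
      (fun y : Plane => (⟨y, u⟩ : TangentBundle 𝓘(ℝ, Plane) Plane)) :=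
    (contMDiff_vectorSpace_iff_contDiff (n := ∞) (V := fun _ : Plane => u)).2 contDiff_const
  refine (h1.comp (s := (extChartAt (𝓡 2) p).target) h2.contMDiffOn fun y hy => hy).congr fun y hy => ?_
  simp only [Function.comp_apply, tangentMapWithin, chartDeriv]
  rw [mfderivWithin_of_isOpen ho hy]
  rfl

variable (g : Metric M)

theorem contDiffOn_inner_chartDeriv (p : M) (u w : Plane) :
    ContDiffOn ℝ ∞ (fun y => g.inner ((extChartAt (𝓡 2) p).symm y) (chartDeriv p y u)
      (chartDeriv p y w)) (extChartAt (𝓡 2) p).target := by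
  rw [← contMDiffOn_iff_contDiffOn]
  intro y hy
  have hb := contMDiffOn_extChartAt_symm (I := 𝓡 2) (n := ∞) p y hy
  have hg := ContMDiffAt.comp_contMDiffWithinAt y (g.contMDiff.contMDiffAt) hb
  have h1 := ContMDiffWithinAt.clm_bundle_apply₂ (F₁ := Plane) (F₂ := Plane) (F₃ := ℝ)
    (E₃ := Bundle.Trivial M ℝ) hg
    (contMDiffOn_chartDeriv p u y hy) (contMDiffOn_chartDeriv p w y hy)
  simp only [Bundle.contMDiffWithinAt_totalSpace] at h1
  exact h1.2

theorem contDiffOn_gram (p : M) (i j : Fin 2) :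
    ContDiffOn ℝ ∞ (fun y => gram g p y i j) (extChartAt (𝓡 2) p).target :=
  contDiffOn_inner_chartDeriv g p (stdVec i) (stdVec j)

theorem gram_symm (p : M) (y : Plane) (i j : Fin 2) : gram g p y i j = gram g p y j i :=
  g.symm _ _ _

theorem plane_eq (u : Plane) : u = u 0 • stdVec 0 + u 1 • stdVec 1 := by
  ext i; fin_cases i <;> simp [stdVec]

/-- The metric in the preferred chart at `p`. -/
def chartMetric (p : M) (y : Plane) : Plane →L[ℝ] Plane →L[ℝ] ℝ :=
  ∑ i, ∑ j, gram g p y i j • (EuclideanSpace.proj i : Plane →L[ℝ] ℝ).smulRight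
    (EuclideanSpace.proj j : Plane →L[ℝ] ℝ)

theorem chartMetric_apply (p : M) (y u w : Plane) :
    chartMetric g p y u w = ∑ i, ∑ j, gram g p y i j * (u i * w j) := by
  simp [chartMetric, Fin.sum_univ_two]

theorem chartMetric_eq_inner (p : M) (y u w : Plane) :
    chartMetric g p y u w = g.inner ((extChartAt (𝓡 2) p).symm y) (chartDeriv p y u)
      (chartDeriv p y w) := by
  have key : ∀ (B : Plane →L[ℝ] Plane →L[ℝ] ℝ) (D : Plane →L[ℝ] Plane),
      B (D u) (D w) = ∑ i, ∑ j, B (D (stdVec i)) (D (stdVec j)) * (u i * w j) := by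
    intro B D
    conv_lhs => rw [plane_eq u, plane_eq w]
    simp only [map_add, map_smul, add_apply, smul_apply, smul_eq_mul, Fin.sum_univ_two]
    ring
  rw [chartMetric_apply]
  exact (key (g.inner ((extChartAt (𝓡 2) p).symm y)) (chartDeriv p y)).symm

set_option maxSynthPendingDepth 3 in
theorem contDiffOn_chartMetric (p : M) :
    ContDiffOn ℝ ∞ (chartMetric g p) (extChartAt (𝓡 2) p).target :=
  ContDiffOn.sum fun i _ => ContDiffOn.sum fun j _ => (contDiffOn_gram g p i j).smul contDiffOn_const

theorem chartMetric_symm (p : M) (y u w : Plane) : chartMetric g p y u w = chartMetric g p y w u := by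
  simp only [chartMetric_apply, Fin.sum_univ_two]
  rw [gram_symm g p y 1 0]; ring

theorem chartDeriv_injective (p : M) {y : Plane} (hy : y ∈ (extChartAt (𝓡 2) p).target) :
    Function.Injective (chartDeriv p y) := by
  have h := isInvertible_mfderivWithin_extChartAt_symm (I := 𝓡 2) hy
  rw [show range (𝓡 2) = univ from ModelWithCorners.range_eq_univ _, mfderivWithin_univ] at h
  exact h.injective

theorem chartMetric_pos (p : M) {y : Plane} (hy : y ∈ (extChartAt (𝓡 2) p).target) {u : Plane}
    (hu : u ≠ 0) : 0 < chartMetric g p y u u := by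
  rw [chartMetric_eq_inner]
  refine g.pos _ _ fun h0 => hu (chartDeriv_injective p hy ?_)
  rw [map_zero]; exact h0

theorem stdVec_ne_zero (i : Fin 2) : stdVec i ≠ 0 := by
  simp [stdVec]

theorem gram_det (p : M) (y : Plane) :
    (gram g p y).det = gram g p y 0 0 * gram g p y 1 1 - gram g p y 0 1 ^ 2 := by
  rw [Matrix.det_fin_two, gram_symm g p y 1 0]; ring

theorem gram_det_pos (p : M) {y : Plane} (hy : y ∈ (extChartAt (𝓡 2) p).target) :
    0 < (gram g p y).det := by
  have h0 := chartMetric_pos g p hy (stdVec_ne_zero 0)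
  have h00 : chartMetric g p y (stdVec 0) (stdVec 0) = gram g p y 0 0 := by
    simp [chartMetric_apply, stdVec]
  rw [h00] at h0
  -- On the vector with components -g₀₁ and g₀₀ the metric takes the value g₀₀ times the
  -- determinant.
  have h1 := chartMetric_pos g p hy (u := (-gram g p y 0 1) • stdVec 0 + gram g p y 0 0 • stdVec 1) (by
    intro h
    have := congrArg (fun z : Plane => z 1) h
    simp [stdVec] at this
    exact h0.ne' this)
  rw [chartMetric_apply] at h1
  simp [Fin.sum_univ_two, stdVec, gram_symm g p y 1 0] at h1
  rw [gram_det]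
  by_contra! hle
  nlinarith

theorem contDiffOn_gram_inv (p : M) (i j : Fin 2) :
    ContDiffOn ℝ ∞ (fun y => (gram g p y)⁻¹ i j) (extChartAt (𝓡 2) p).target := by
  have h1 : ∀ i j, ContDiffOn ℝ ∞ (fun y => (gram g p y).adjugate i j) (extChartAt (𝓡 2) p).target := by
    intro i j
    have := contDiffOn_gram g p
    simp only [Matrix.adjugate_fin_two]
    fin_cases i <;> fin_cases j
    · exact this 1 1
    · exact (this 0 1).neg
    · exact (this 1 0).neg
    · exact this 0 0
  have h2 : ContDiffOn ℝ ∞ (fun y => (gram g p y).det) (extChartAt (𝓡 2) p).target := by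
    simp only [gram_det]
    exact ((contDiffOn_gram g p 0 0).mul (contDiffOn_gram g p 1 1)).sub ((contDiffOn_gram g p 0 1).pow 2)
  simp only [Matrix.inv_def, Matrix.smul_apply, smul_eq_mul, Ring.inverse_eq_inv']
  exact (h2.inv fun y hy => (gram_det_pos g p hy).ne').mul (h1 i j)

theorem contDiffOn_partialD {f : Plane → ℝ} {s : Set Plane} (hs : IsOpen s) (hf : ContDiffOn ℝ ∞ f s)
    (i : Fin 2) : ContDiffOn ℝ ∞ (partialD i f) s :=
  (hf.fderiv_of_isOpen hs (m := ∞) (by simp)).clm_apply contDiffOn_const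

theorem contDiffOn_christoffel (p : M) (k i j : Fin 2) :
    ContDiffOn ℝ ∞ (christoffel g p k i j) (extChartAt (𝓡 2) p).target := by
  have h := fun a b c => contDiffOn_partialD (isOpen_chart_target p) (contDiffOn_gram g p a b) c
  refine contDiffOn_const.mul (ContDiffOn.sum fun l _ => (contDiffOn_gram_inv g p k l).mul ?_)
  exact ((h j l i).add (h i l j)).sub (h i j l)

theorem christoffel_symm (p : M) (k i j : Fin 2) (y : Plane) :
    christoffel g p k i j y = christoffel g p k j i y := by
  simp only [christoffel]
  have : (fun z => gram g p z i j) = fun z => gram g p z j i := by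
    ext z; exact gram_symm g p z i j
  rw [this]
  congr 1
  refine Finset.sum_congr rfl fun l _ => ?_
  ring

/-- The Levi-Civita connection in the preferred chart at `p`. -/
def chartConnection (p : M) (y : Plane) : Plane →L[ℝ] Plane →L[ℝ] Plane :=
  ∑ k, ∑ i, ∑ j, christoffel g p k i j y • (EuclideanSpace.proj i : Plane →L[ℝ] ℝ).smulRight
    ((EuclideanSpace.proj j : Plane →L[ℝ] ℝ).smulRight (stdVec k))

theorem chartConnection_apply (p : M) (y u w : Plane) :
    chartConnection g p y u w =
      ∑ k, (∑ i, ∑ j, christoffel g p k i j y * (u i * w j)) • stdVec k := by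
  simp [chartConnection, Fin.sum_univ_two, smul_smul, add_smul, mul_assoc]

set_option maxSynthPendingDepth 3 in
theorem contDiffOn_chartConnection (p : M) :
    ContDiffOn ℝ ∞ (chartConnection g p) (extChartAt (𝓡 2) p).target :=
  ContDiffOn.sum fun k _ => ContDiffOn.sum fun i _ => ContDiffOn.sum fun j _ =>
    (contDiffOn_christoffel g p k i j).smul contDiffOn_const

theorem chartConnection_symm (p : M) (y u w : Plane) :
    chartConnection g p y u w = chartConnection g p y w u := by
  simp only [chartConnection_apply, Fin.sum_univ_two]
  rw [christoffel_symm g p 0 1 0, christoffel_symm g p 1 1 0]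
  congr 2 <;> ring

/-- Lowering the index cancels the inverse matrix and leaves the Christoffel symbols of the first
kind, for which metric compatibility is a linear identity. -/
theorem sum_gram_christoffel (p : M) {y : Plane} (hy : y ∈ (extChartAt (𝓡 2) p).target)
    (c i j : Fin 2) :
    ∑ k, gram g p y c k * christoffel g p k i j y =
      (1 / 2 : ℝ) * (partialD i (fun z => gram g p z j c) y + partialD j (fun z => gram g p z i c) y
        - partialD c (fun z => gram g p z i j) y) := by
  have hinv : gram g p y * (gram g p y)⁻¹ = 1 :=
    Matrix.mul_nonsing_inv _ (isUnit_iff_ne_zero.2 (gram_det_pos g p hy).ne')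
  have h := fun l => congrFun (congrFun hinv c) l
  simp only [Matrix.mul_apply, Fin.sum_univ_two] at h
  have h0 := h 0
  have h1 := h 1
  simp only [christoffel, Fin.sum_univ_two]
  obtain rfl | rfl : c = 0 ∨ c = 1 := by fin_cases c <;> simp
  · simp at h0 h1 ⊢
    linear_combination (1 / 2 : ℝ) * (partialD i (fun z => gram g p z j 0) y
      + partialD j (fun z => gram g p z i 0) y - partialD 0 (fun z => gram g p z i j) y) * h0
      + (1 / 2 : ℝ) * (partialD i (fun z => gram g p z j 1) y
      + partialD j (fun z => gram g p z i 1) y - partialD 1 (fun z => gram g p z i j) y) * h1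
  · simp at h0 h1 ⊢
    linear_combination (1 / 2 : ℝ) * (partialD i (fun z => gram g p z j 0) y
      + partialD j (fun z => gram g p z i 0) y - partialD 0 (fun z => gram g p z i j) y) * h0
      + (1 / 2 : ℝ) * (partialD i (fun z => gram g p z j 1) y
      + partialD j (fun z => gram g p z i 1) y - partialD 1 (fun z => gram g p z i j) y) * h1

theorem fderiv_chartMetric (p : M) {y : Plane} (hy : y ∈ (extChartAt (𝓡 2) p).target) (u v w : Plane) :
    fderiv ℝ (chartMetric g p) y u v w =
      ∑ a, ∑ i, ∑ j, partialD a (fun z => gram g p z i j) y * (u a * (v i * w j)) := by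
  have ho := isOpen_chart_target p
  have hd := (ContDiffOn.differentiableAt_of_isOpen (contDiffOn_chartMetric g p) ho hy).hasFDerivAt
  have h1 := ((hd.clm_apply (hasFDerivAt_const v y)).clm_apply (hasFDerivAt_const w y)).fderiv
  have hg := fun i j => (ContDiffOn.differentiableAt_of_isOpen (contDiffOn_gram g p i j) ho hy).hasFDerivAt
  have h2 := (HasFDerivAt.fun_sum (u := Finset.univ) fun (i : Fin 2) _ =>
    HasFDerivAt.fun_sum (u := Finset.univ) fun (j : Fin 2) _ => (hg i j).mul_const (v i * w j)).fderiv
  simp only [chartMetric_apply] at h1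
  rw [h2] at h1
  have h3 := congrArg (fun L : Plane →L[ℝ] ℝ => L u) h1
  have hu : ∀ i j, fderiv ℝ (fun y => gram g p y i j) y u =
      u 0 * partialD 0 (fun z => gram g p z i j) y + u 1 * partialD 1 (fun z => gram g p z i j) y := by
    intro i j
    conv_lhs => rw [plane_eq u]
    simp [partialD]
  simp only [add_apply, ContinuousLinearMap.flip_apply, ContinuousLinearMap.comp_apply,
    zero_apply, map_zero, Fin.sum_univ_two, smul_apply, smul_eq_mul, hu, zero_add] at h3
  rw [← h3]
  simp only [Fin.sum_univ_two]
  ring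

theorem chartMetric_compat (p : M) {y : Plane} (hy : y ∈ (extChartAt (𝓡 2) p).target)
    (u v w : Plane) :
    fderiv ℝ (chartMetric g p) y u v w = chartMetric g p y (chartConnection g p y u v) w
      + chartMetric g p y v (chartConnection g p y u w) := by
  have key : ∀ u v w : Plane, chartMetric g p y v (chartConnection g p y u w) =
      ∑ c, ∑ i, ∑ j, ((1 / 2 : ℝ) * (partialD i (fun z => gram g p z j c) y
        + partialD j (fun z => gram g p z i c) y - partialD c (fun z => gram g p z i j) y))
          * (v c * (u i * w j)) := by
    intro u v w
    simp only [← sum_gram_christoffel g p hy]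
    rw [chartMetric_apply, chartConnection_apply]
    simp only [Fin.sum_univ_two, stdVec, PiLp.add_apply, PiLp.smul_apply, smul_eq_mul,
      PiLp.single_apply]
    simp
    ring
  have hs : ∀ a, partialD a (fun z => gram g p z 1 0) y = partialD a (fun z => gram g p z 0 1) y := by
    intro a; congr 1; ext z; exact gram_symm g p z 1 0
  rw [chartMetric_symm g p y _ w, key, key, fderiv_chartMetric g p hy]
  simp only [Fin.sum_univ_two, hs]
  ring

/-- Rotation by a right angle in the preferred chart at `p`. -/
def chartRotation (p : M) (y : Plane) : Plane →L[ℝ] Plane :=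
  (√(gram g p y).det)⁻¹ • ∑ j, (gram g p y 0 j • (EuclideanSpace.proj j : Plane →L[ℝ] ℝ).smulRight (stdVec 1)
    - gram g p y 1 j • (EuclideanSpace.proj j : Plane →L[ℝ] ℝ).smulRight (stdVec 0))

theorem chartRotation_apply (p : M) (y u : Plane) :
    chartRotation g p y u = (√(gram g p y).det)⁻¹ • ((∑ j, gram g p y 0 j * u j) • stdVec 1
      - (∑ j, gram g p y 1 j * u j) • stdVec 0) := by
  simp [chartRotation, Fin.sum_univ_two, add_smul, smul_smul]

theorem contDiffOn_chartRotation (p : M) :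
    ContDiffOn ℝ ∞ (chartRotation g p) (extChartAt (𝓡 2) p).target := by
  have h2 : ContDiffOn ℝ ∞ (fun y => (gram g p y).det) (extChartAt (𝓡 2) p).target := by
    simp only [gram_det]
    exact ((contDiffOn_gram g p 0 0).mul (contDiffOn_gram g p 1 1)).sub ((contDiffOn_gram g p 0 1).pow 2)
  refine ((h2.sqrt fun y hy => (gram_det_pos g p hy).ne').inv fun y hy =>
    (Real.sqrt_pos.2 (gram_det_pos g p hy)).ne').smul (ContDiffOn.sum fun j _ => ?_)
  exact ((contDiffOn_gram g p 0 j).smul contDiffOn_const).sub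
    ((contDiffOn_gram g p 1 j).smul contDiffOn_const)

theorem chartRotation_orth (p : M) (y u : Plane) : chartMetric g p y u (chartRotation g p y u) = 0 := by
  rw [chartMetric_apply, chartRotation_apply]
  simp [Fin.sum_univ_two, stdVec]
  rw [gram_symm g p y 1 0]
  ring

theorem chartRotation_norm (p : M) {y : Plane} (hy : y ∈ (extChartAt (𝓡 2) p).target) (u : Plane) :
    chartMetric g p y (chartRotation g p y u) (chartRotation g p y u) = chartMetric g p y u u := by
  have hd := gram_det_pos g p hy
  have hs : (√(gram g p y).det)⁻¹ ^ 2 * (gram g p y).det = 1 := by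
    rw [inv_pow, Real.sq_sqrt hd.le, inv_mul_cancel₀ hd.ne']
  rw [chartMetric_apply, chartMetric_apply, chartRotation_apply]
  rw [gram_det] at hs ⊢
  simp [Fin.sum_univ_two, stdVec, gram_symm g p y 1 0]
  set s := (√(gram g p y 0 0 * gram g p y 1 1 - gram g p y 0 1 ^ 2))⁻¹
  linear_combination (gram g p y 0 0 * (u 0 * u 0) + gram g p y 0 1 * (u 0 * u 1)
    + (gram g p y 0 1 * (u 1 * u 0) + gram g p y 1 1 * (u 1 * u 1))) * hs

theorem contDiffOn_comp_chart_symm {f : M → ℝ} (hf : ContMDiff (𝓡 2) 𝓘(ℝ, ℝ) ∞ f) (p : M) :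
    ContDiffOn ℝ ∞ (fun y => f ((extChartAt (𝓡 2) p).symm y)) (extChartAt (𝓡 2) p).target := by
  rw [← contMDiffOn_iff_contDiffOn]
  exact hf.comp_contMDiffOn (contMDiffOn_extChartAt_symm p)

/-- The geometry of a surface with density in the preferred chart at `p`. -/
def chartGeometry {ψ : M → ℝ} (hψ : ContMDiff (𝓡 2) 𝓘(ℝ, ℝ) ∞ ψ) (p : M) : PlaneGeometry where
  Ω := (extChartAt (𝓡 2) p).target
  isOpen := isOpen_chart_target p
  G := chartMetric g p
  Γ := chartConnection g p
  J := chartRotation g p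
  ψ := fun y => ψ ((extChartAt (𝓡 2) p).symm y)
  smooth_G := contDiffOn_chartMetric g p
  smooth_Γ := contDiffOn_chartConnection g p
  smooth_J := contDiffOn_chartRotation g p
  smooth_ψ := contDiffOn_comp_chart_symm hψ p
  symm_G := chartMetric_symm g p
  pos_G _ hy _ hu := chartMetric_pos g p hy hu
  symm_Γ := chartConnection_symm g p
  compat _ hy := chartMetric_compat g p hy
  J_orth y _ := chartRotation_orth g p y
  J_norm _ hy := chartRotation_norm g p hy

end Chart

end DensityFlow
end

/-! ### Changes of coordinates and the curvature vector in an arbitrary chart -/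

noncomputable section

namespace DensityFlow

/-- Transformation law of the Levi-Civita connection under a change of coordinates. -/
theorem PlaneGeometry.connection_transform {S S' : PlaneGeometry} {Φ : Plane → Plane} {y : Plane}
    (hy : y ∈ S.Ω) (hy' : Φ y ∈ S'.Ω) (hΦ : ContDiffAt ℝ ∞ Φ y)
    (hG : ∀ᶠ z in 𝓝 y, ∀ u w, S.G z u w = S'.G (Φ z) (fderiv ℝ Φ z u) (fderiv ℝ Φ z w))
    (u v w : Plane) :
    S.G y (S.Γ y u v) w = S'.G (Φ y) (fderiv ℝ (fderiv ℝ Φ) y u v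
      + S'.Γ (Φ y) (fderiv ℝ Φ y u) (fderiv ℝ Φ y v)) (fderiv ℝ Φ y w) := by
  have hd2 : DifferentiableAt ℝ (fderiv ℝ Φ) y :=
    (hΦ.fderiv_right (m := ∞) (by simp)).differentiableAt (by simp)
  have hsymm : ∀ a b, fderiv ℝ (fderiv ℝ Φ) y a b = fderiv ℝ (fderiv ℝ Φ) y b a := fun a b =>
    (hΦ.isSymmSndFDerivAt (by
      simpa using (WithTop.coe_le_coe.2 (le_top : (2 : ℕ∞) ≤ ⊤) : (2 : WithTop ℕ∞) ≤ ∞))) a b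
  have hGd := (ContDiffOn.differentiableAt_of_isOpen S.smooth_G S.isOpen hy).hasFDerivAt
  have hGd' := (ContDiffOn.differentiableAt_of_isOpen S'.smooth_G S'.isOpen hy').hasFDerivAt
  have hΦd := (hΦ.differentiableAt (by simp)).hasFDerivAt
  have key : ∀ a u w : Plane, fderiv ℝ S.G y a u w =
      fderiv ℝ S'.G (Φ y) (fderiv ℝ Φ y a) (fderiv ℝ Φ y u) (fderiv ℝ Φ y w)
      + S'.G (Φ y) (fderiv ℝ (fderiv ℝ Φ) y a u) (fderiv ℝ Φ y w)
      + S'.G (Φ y) (fderiv ℝ Φ y u) (fderiv ℝ (fderiv ℝ Φ) y a w) := by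
    intro a u w
    have h1 := ((hGd.clm_apply (hasFDerivAt_const u y)).clm_apply (hasFDerivAt_const w y)).fderiv
    have h2 := (((hGd'.comp y hΦd).clm_apply (hd2.hasFDerivAt.clm_apply (hasFDerivAt_const u y))).clm_apply
      (hd2.hasFDerivAt.clm_apply (hasFDerivAt_const w y))).fderiv
    have h3 : (fun z => S.G z u w) =ᶠ[𝓝 y]
        fun z => S'.G (Φ z) (fderiv ℝ Φ z u) (fderiv ℝ Φ z w) := by
      filter_upwards [hG] with z hz using hz u w
    simp only [Function.comp_def] at h2
    have h4 := h3.fderiv_eq (𝕜 := ℝ)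
    rw [h1, h2] at h4
    have h5 := congrArg (fun L : Plane →L[ℝ] ℝ => L a) h4
    simp only [add_apply, ContinuousLinearMap.flip_apply, ContinuousLinearMap.comp_apply,
      zero_apply, map_zero, zero_add] at h5
    rw [h5]
    ring
  have hG0 := hG.self_of_nhds
  -- The defect of the transformation law is symmetric in its first two arguments and skew in the
  -- last two, because both connections are torsion free and metric. Such a trilinear form vanishes,
  -- as in the uniqueness of the Levi-Civita connection.
  set A := fun a u w : Plane => S.G y (S.Γ y a u) w - S'.G (Φ y) (fderiv ℝ (fderiv ℝ Φ) y a u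
      + S'.Γ (Φ y) (fderiv ℝ Φ y a) (fderiv ℝ Φ y u)) (fderiv ℝ Φ y w) with hA
  have h1 : ∀ a u w, A a u w = A u a w := by
    intro a u w
    simp only [hA]
    rw [S.symm_Γ y a u, hsymm a u, S'.symm_Γ (Φ y) (fderiv ℝ Φ y a)]
  have h2 : ∀ a u w, A a u w + A a w u = 0 := by
    intro a u w
    have h := key a u w
    rw [S.compat y hy, S'.compat (Φ y) hy', S.symm_G y u] at h
    simp only [hA, map_add, add_apply]
    rw [S'.symm_G (Φ y) (fderiv ℝ (fderiv ℝ Φ) y a w),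
      S'.symm_G (Φ y) (S'.Γ (Φ y) (fderiv ℝ Φ y a) (fderiv ℝ Φ y w))]
    linarith
  have h3 : A u v w = 0 := by
    have e1 := h2 u v w
    have e2 := h2 v w u
    have e3 := h2 w u v
    rw [h1 u v] at e1 ⊢
    rw [h1 v w] at e2
    rw [h1 w u] at e3
    linarith
  exact sub_eq_zero.1 h3

section Chart

variable {M : Type*} [TopologicalSpace M] [ChartedSpace Plane M]

theorem mem_chart_target {p x : M} (hx : x ∈ (chartAt Plane p).source) :
    extChartAt (𝓡 2) p x ∈ (extChartAt (𝓡 2) p).target :=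
  (extChartAt (𝓡 2) p).map_source (by rwa [extChartAt_source])

theorem chart_symm_apply {p x : M} (hx : x ∈ (chartAt Plane p).source) :
    (extChartAt (𝓡 2) p).symm (extChartAt (𝓡 2) p x) = x :=
  (extChartAt (𝓡 2) p).left_inv (by rwa [extChartAt_source])

variable [IsManifold (𝓡 2) ∞ M]

/-- The differential of a curve at a point in terms of its coordinates in a chart. -/
theorem mfderiv_curve {c : ℝ → M} {θ : ℝ} (hc : MDifferentiableAt 𝓘(ℝ, ℝ) (𝓡 2) c θ) {p : M}
    (hp : c θ ∈ (chartAt Plane p).source) :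
    (mfderiv 𝓘(ℝ, ℝ) (𝓡 2) c θ (1 : ℝ) : Plane) =
      chartDeriv p (extChartAt (𝓡 2) p (c θ)) (deriv (fun s => extChartAt (𝓡 2) p (c s)) θ) := by
  have he := (mdifferentiableAt_extChartAt (I := 𝓡 2) hp)
  have hx := he.comp θ hc
  have hs := mdifferentiableAt_chart_symm p (mem_chart_target hp)
  have hcomp := hs.hasMFDerivAt.comp θ hx.hasMFDerivAt
  have heq : c =ᶠ[𝓝 θ] (extChartAt (𝓡 2) p).symm ∘ (extChartAt (𝓡 2) p ∘ c) := by
    filter_upwards [hc.continuousAt.preimage_mem_nhds ((chartAt Plane p).open_source.mem_nhds hp)]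
      with s hs
    exact (chart_symm_apply hs).symm
  have h1 := (hcomp.congr_of_eventuallyEq heq).mfderiv
  have h2 : mfderiv 𝓘(ℝ, ℝ) 𝓘(ℝ, Plane) (extChartAt (𝓡 2) p ∘ c) θ =
    fderiv ℝ (fun s => extChartAt (𝓡 2) p (c s)) θ := mfderiv_eq_fderiv
  rw [h1]
  change chartDeriv p (extChartAt (𝓡 2) p (c θ))
    (mfderiv 𝓘(ℝ, ℝ) 𝓘(ℝ, Plane) (extChartAt (𝓡 2) p ∘ c) θ (1 : ℝ)) = _
  rw [h2]
  rfl

/-- Change of coordinates from the preferred chart at `p` to the one at `p'`. -/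
def transition (p p' : M) (z : Plane) : Plane := extChartAt (𝓡 2) p' ((extChartAt (𝓡 2) p).symm z)

theorem contDiffAt_transition {p p' x : M} (hp : x ∈ (chartAt Plane p).source)
    (hp' : x ∈ (chartAt Plane p').source) :
    ContDiffAt ℝ ∞ (transition p p') (extChartAt (𝓡 2) p x) := by
  rw [← contMDiffAt_iff_contDiffAt]
  have h1 := ((contMDiffOn_extChartAt_symm (I := 𝓡 2) (n := ∞) p) _ (mem_chart_target hp)).contMDiffAt
    ((isOpen_chart_target p).mem_nhds (mem_chart_target hp))
  refine ContMDiffAt.comp (extChartAt (𝓡 2) p x) ?_ h1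
  rw [chart_symm_apply hp]
  exact contMDiffAt_extChartAt' hp'

theorem eventually_chart_symm_mem {p p' x : M} (hp : x ∈ (chartAt Plane p).source)
    (hp' : x ∈ (chartAt Plane p').source) :
    ∀ᶠ z in 𝓝 (extChartAt (𝓡 2) p x), z ∈ (extChartAt (𝓡 2) p).target ∧
      (extChartAt (𝓡 2) p).symm z ∈ (chartAt Plane p').source := by
  have hc := (mdifferentiableAt_chart_symm p (mem_chart_target hp)).continuousAt
  have h1 : (chartAt Plane p').source ∈ 𝓝 ((extChartAt (𝓡 2) p).symm (extChartAt (𝓡 2) p x)) := by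
    rw [chart_symm_apply hp]; exact (chartAt Plane p').open_source.mem_nhds hp'
  filter_upwards [(isOpen_chart_target p).mem_nhds (mem_chart_target hp), hc.preimage_mem_nhds h1]
    with z h1 h2 using ⟨h1, h2⟩

theorem chartDeriv_transition {p p' : M} {z : Plane} (hz : z ∈ (extChartAt (𝓡 2) p).target)
    (hz' : (extChartAt (𝓡 2) p).symm z ∈ (chartAt Plane p').source) (u : Plane) :
    chartDeriv p z u = chartDeriv p' (transition p p' z) (fderiv ℝ (transition p p') z u) := by
  have hsrc : (extChartAt (𝓡 2) p).symm z ∈ (chartAt Plane p).source := by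
    rw [← extChartAt_source (𝓡 2)]; exact (extChartAt (𝓡 2) p).map_target hz
  have hzz : extChartAt (𝓡 2) p ((extChartAt (𝓡 2) p).symm z) = z := (extChartAt (𝓡 2) p).right_inv hz
  have hT := contDiffAt_transition hsrc hz'
  rw [hzz] at hT
  have hTd : HasMFDerivAt 𝓘(ℝ, Plane) 𝓘(ℝ, Plane) (transition p p') z (fderiv ℝ (transition p p') z) :=
    (hT.differentiableAt (by simp)).hasFDerivAt.hasMFDerivAt
  have hs := (mdifferentiableAt_chart_symm p' (mem_chart_target hz')).hasMFDerivAt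
  have hcomp := HasMFDerivAt.comp (g := (extChartAt (𝓡 2) p').symm) z hs hTd
  have hev := eventually_chart_symm_mem hsrc hz'
  rw [hzz] at hev
  have heq : (extChartAt (𝓡 2) p).symm =ᶠ[𝓝 z] (extChartAt (𝓡 2) p').symm ∘ transition p p' := by
    filter_upwards [hev] with w hw
    exact (chart_symm_apply hw.2).symm
  have h1 := (hcomp.congr_of_eventuallyEq heq).mfderiv
  rw [chartDeriv, h1]
  rfl

theorem chartDeriv_self (p : M) (u : Plane) : chartDeriv p (extChartAt (𝓡 2) p p) u = u := by
  have h := mfderivWithin_range_extChartAt_symm (I := 𝓡 2) (x := p)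
  rw [show range (𝓡 2) = univ from ModelWithCorners.range_eq_univ _, mfderivWithin_univ] at h
  rw [chartDeriv, h]
  rfl

variable (g : Metric M)

theorem chartMetric_self (p : M) (u w : Plane) :
    chartMetric g p (extChartAt (𝓡 2) p p) u w = g.inner p u w := by
  rw [chartMetric_eq_inner, chartDeriv_self, chartDeriv_self]
  rw [extChartAt_to_inv]

theorem chartMetric_transition {p p' : M} {z : Plane} (hz : z ∈ (extChartAt (𝓡 2) p).target)
    (hz' : (extChartAt (𝓡 2) p).symm z ∈ (chartAt Plane p').source) (u w : Plane) :
    chartMetric g p z u w = chartMetric g p' (transition p p' z)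
      (fderiv ℝ (transition p p') z u) (fderiv ℝ (transition p p') z w) := by
  rw [chartMetric_eq_inner, chartMetric_eq_inner, chartDeriv_transition hz hz',
    chartDeriv_transition hz hz']
  rw [transition, chart_symm_apply hz']

theorem gram_self (p : M) (u w : Plane) : ∑ i, ∑ j, gram g p (extChartAt (𝓡 2) p p) i j * (u i * w j)
    = g.inner p u w := by
  rw [← chartMetric_apply, chartMetric_self]

/-- The gradient is dual to the differential. -/
theorem inner_metricGradient (f : M → ℝ) (p : M) (w : Plane) :
    g.inner p (metricGradient g f p) w =
      fderiv ℝ (fun y => f ((extChartAt (𝓡 2) p).symm y)) (extChartAt (𝓡 2) p p) w := by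
  have hy := mem_chart_target (mem_chart_source Plane p)
  have hinv : (gram g p (extChartAt (𝓡 2) p p)) * (gram g p (extChartAt (𝓡 2) p p))⁻¹ = 1 :=
    Matrix.mul_nonsing_inv _ (isUnit_iff_ne_zero.2 (gram_det_pos g p hy).ne')
  have h := fun c l => congrFun (congrFun hinv c) l
  simp only [Matrix.mul_apply, Fin.sum_univ_two] at h
  have h00 := (h 0 0).trans (Matrix.one_apply_eq 0)
  have h01 := (h 0 1).trans (Matrix.one_apply_ne (by decide))
  have h10 := (h 1 0).trans (Matrix.one_apply_ne (by decide))
  have h11 := (h 1 1).trans (Matrix.one_apply_eq 1)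
  set G := gram g p (extChartAt (𝓡 2) p p)
  have hsy : G 1 0 = G 0 1 := gram_symm g p _ 1 0
  rw [hsy] at h10 h11
  have h1 : g.inner p (metricGradient g f p) w = ∑ i, ∑ j, G i j *
      ((∑ l, G⁻¹ i l * partialD l (fun y => f ((extChartAt (𝓡 2) p).symm y)) (extChartAt (𝓡 2) p p)) * w j) := by
    refine (gram_self g p _ w).symm.trans ?_
    refine Finset.sum_congr rfl fun i _ => Finset.sum_congr rfl fun j _ => ?_
    have hsum : ∀ a : Fin 2 → ℝ, (∑ k, a k • stdVec k : Plane) i = a i := by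
      intro a
      rw [Fin.sum_univ_two]
      obtain rfl | rfl : i = 0 ∨ i = 1 := by fin_cases i <;> simp
      all_goals simp [stdVec]
    exact congrArg (fun z => G i j * (z * w j)) (hsum fun k => ∑ l, G⁻¹ k l * partialD l
      (fun y => f ((extChartAt (𝓡 2) p).symm y)) (extChartAt (𝓡 2) p p))
  rw [h1]
  conv_rhs => rw [plane_eq w]
  simp only [Fin.sum_univ_two, map_add, map_smul, smul_eq_mul, hsy]
  change _ = w 0 * partialD 0 _ _ + w 1 * partialD 1 _ _
  set a := partialD 0 (fun y => f ((extChartAt (𝓡 2) p).symm y)) (extChartAt (𝓡 2) p p)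
  set b := partialD 1 (fun y => f ((extChartAt (𝓡 2) p).symm y)) (extChartAt (𝓡 2) p p)
  linear_combination (a * w 0) * h00 + (b * w 0) * h01 + (a * w 1) * h10 + (b * w 1) * h11

theorem acceleration_eq (c : ℝ → M) (θ : ℝ) (v : Plane) (hv : v = velocity c θ) :
    (acceleration g c θ : Plane) = deriv (deriv fun s => extChartAt (𝓡 2) (c θ) (c s)) θ
      + chartConnection g (c θ) (extChartAt (𝓡 2) (c θ) (c θ)) v v := by
  rw [chartConnection_apply, ← iteratedDeriv_one, ← iteratedDeriv_succ']
  subst hv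
  rfl

/-- Characterizes the normal part by its products with `v` and with vectors orthogonal to `v`, a
form that transfers to other coordinates without following the projection itself. -/
theorem normalPart_char {B : Plane →L[ℝ] Plane →L[ℝ] ℝ} {a v w W : Plane}
    (hv : B v v ≠ 0) (hW : W = (B v v)⁻¹ • a - w - (B ((B v v)⁻¹ • a - w) v / B v v) • v) :
    B W v = 0 ∧ ∀ n, B v n = 0 → B W n = (B v v)⁻¹ * B a n - B w n := by
  constructor
  · rw [hW]
    simp only [map_sub, map_smul, sub_apply, smul_apply, smul_eq_mul]
    field_simp
    ring
  · intro n hn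
    rw [hW]
    simp only [map_sub, map_smul, sub_apply, smul_apply, smul_eq_mul, hn]
    ring

variable {ψ : M → ℝ} (hψ : ContMDiff (𝓡 2) 𝓘(ℝ, ℝ) ∞ ψ)

theorem contDiffAt_chart_curve {c : ℝ → M} {θ : ℝ} (hc : ContMDiffAt 𝓘(ℝ, ℝ) (𝓡 2) ∞ c θ) {p : M}
    (hp : c θ ∈ (chartAt Plane p).source) :
    ContDiffAt ℝ ∞ (fun s => extChartAt (𝓡 2) p (c s)) θ := by
  rw [← contMDiffAt_iff_contDiffAt]
  exact (contMDiffAt_extChartAt' hp).comp θ hc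

/-- The curvature vector with density in an arbitrary chart. -/
theorem psiCurvature_chart {c : ℝ → M} {θ : ℝ} (hc : ContMDiff 𝓘(ℝ, ℝ) (𝓡 2) ∞ c)
    (hreg : velocity c θ ≠ 0) {p : M} (hp : c θ ∈ (chartAt Plane p).source) {W : Plane}
    (hW : chartDeriv p (extChartAt (𝓡 2) p (c θ)) W = psiCurvature g ψ c θ) :
    let S := chartGeometry g hψ p
    let x := fun s => extChartAt (𝓡 2) p (c s)
    S.G (x θ) W (deriv x θ) = 0 ∧ ∀ n, S.G (x θ) (deriv x θ) n = 0 →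
      S.G (x θ) W n = (S.G (x θ) (deriv x θ) (deriv x θ))⁻¹ *
        S.G (x θ) (deriv (deriv x) θ + S.Γ (x θ) (deriv x θ) (deriv x θ)) n - fderiv ℝ S.ψ (x θ) n := by
  intro S x
  -- Acceleration, gradient and metric at the point are defined by means of the preferred chart
  -- there, so `Φ` passes from the chart at `p` to that one.
  set p' := c θ
  set y := x θ
  set Φ := transition p p'
  set D := fderiv ℝ Φ y
  have hp' : p' ∈ (chartAt Plane p').source := mem_chart_source _ _
  have hy : y ∈ (extChartAt (𝓡 2) p).target := mem_chart_target hp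
  have hyp : (extChartAt (𝓡 2) p).symm y = p' := chart_symm_apply hp
  have hyp' : (extChartAt (𝓡 2) p).symm y ∈ (chartAt Plane p').source := by rw [hyp]; exact hp'
  have hΦy : Φ y = extChartAt (𝓡 2) p' p' := by simp only [Φ, transition, hyp]
  have hD : ∀ u, chartDeriv p y u = D u := fun u => by
    rw [chartDeriv_transition hy hyp']
    change chartDeriv p' (Φ y) (D u) = D u
    rw [hΦy, chartDeriv_self]
  have hΦ : ContDiffAt ℝ ∞ Φ y := contDiffAt_transition hp hp'
  have hG : ∀ u w, S.G y u w = g.inner p' (D u) (D w) := fun u w => by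
    rw [← chartMetric_self, ← hΦy]
    exact chartMetric_transition g hy hyp' u w
  have hev := eventually_chart_symm_mem hp hp'
  set S' := chartGeometry g hψ p'
  have hΓ := fun u v w => PlaneGeometry.connection_transform (S := S) (S' := S') (Φ := Φ) (y := y) hy
    (by rw [hΦy]; exact mem_chart_target hp') hΦ
    (by filter_upwards [hev] with z hz u w using chartMetric_transition g hz.1 hz.2 u w) u v w
  have hx : ContDiffAt ℝ ∞ x θ := contDiffAt_chart_curve hc.contMDiffAt hp
  have hxd : ∀ᶠ s in 𝓝 θ, ContDiffAt ℝ ∞ x s := by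
    filter_upwards [hc.continuous.continuousAt.preimage_mem_nhds
      ((chartAt Plane p).open_source.mem_nhds hp)] with s hs
    exact contDiffAt_chart_curve hc.contMDiffAt hs
  have hΦd : ∀ᶠ s in 𝓝 θ, ContDiffAt ℝ ∞ Φ (x s) := by
    filter_upwards [hc.continuous.continuousAt.preimage_mem_nhds
      ((chartAt Plane p).open_source.mem_nhds hp), hc.continuous.continuousAt.preimage_mem_nhds
      ((chartAt Plane p').open_source.mem_nhds hp')] with s hs hs'
    exact contDiffAt_transition hs hs'
  have hcomp : (fun s => extChartAt (𝓡 2) p' (c s)) =ᶠ[𝓝 θ] fun s => Φ (x s) := by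
    filter_upwards [hc.continuous.continuousAt.preimage_mem_nhds
      ((chartAt Plane p).open_source.mem_nhds hp)] with s hs
    simp only [Φ, x, transition]
    rw [chart_symm_apply hs]
  have hder : deriv (fun s => extChartAt (𝓡 2) p' (c s)) =ᶠ[𝓝 θ]
      fun s => fderiv ℝ Φ (x s) (deriv x s) := by
    filter_upwards [hcomp.eventuallyEq_nhds, hxd, hΦd] with s h1 h2 h3
    rw [h1.deriv_eq]
    exact ((h3.differentiableAt (by simp)).hasFDerivAt.comp_hasDerivAt s
      (h2.differentiableAt (by simp)).hasDerivAt).deriv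
  -- The second derivative of `Φ` that appears here is the term by which the connection fails to be
  -- a tensor; the two cancel in `hacc`.
  have hder2 : deriv (deriv fun s => extChartAt (𝓡 2) p' (c s)) θ =
      fderiv ℝ (fderiv ℝ Φ) y (deriv x θ) (deriv x θ) + D (deriv (deriv x) θ) := by
    rw [hder.deriv_eq]
    have h1 : HasFDerivAt (fderiv ℝ Φ) (fderiv ℝ (fderiv ℝ Φ) y) (x θ) :=
      ((hΦ.fderiv_right (m := ∞) (by simp)).differentiableAt (by simp)).hasFDerivAt
    have h2 : HasDerivAt (deriv x) (deriv (deriv x) θ) θ := by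
      have h3 : ContDiffAt ℝ ∞ (deriv x) θ := by
        have h4 := hx.fderiv_right (m := ∞) (by simp)
        exact (h4.clm_apply contDiffAt_const).congr_of_eventuallyEq
          (Eventually.of_forall fun s => (fderiv_apply_one_eq_deriv).symm)
      exact (h3.differentiableAt (by simp)).hasDerivAt
    exact ((h1.comp_hasDerivAt θ (hx.differentiableAt (by simp)).hasDerivAt).clm_apply h2).deriv
  set v : Plane := velocity c θ with hv
  have hvel : v = D (deriv x θ) := by
    rw [← hD]
    exact mfderiv_curve (hc.mdifferentiableAt (by simp)) hp
  set B : Plane →L[ℝ] Plane →L[ℝ] ℝ := g.inner p'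
  have hGB : ∀ u w, S.G y u w = B (D u) (D w) := hG
  have hSB : S'.G (Φ y) = B := by
    ext u w
    rw [hΦy]
    exact chartMetric_self g p' _ _
  have hvv : B v v ≠ 0 := (g.pos p' v hreg).ne'
  set a : Plane := acceleration g c θ with ha
  have hacc : ∀ n, B a (D n) = S.G y (deriv (deriv x) θ + S.Γ y (deriv x θ) (deriv x θ)) n := by
    intro n
    have h1 := acceleration_eq g c θ v rfl
    rw [← ha, hder2, hvel] at h1
    rw [map_add, add_apply, hΓ, hGB, hSB, h1]
    simp only [map_add, add_apply]
    rw [hΦy]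
    change _ + B (chartConnection g p' _ _ _) _ = _ + (_ + B (chartConnection g p' _ _ _) _)
    ring
  set w : Plane := metricGradient g ψ p' with hw
  have hgrad : ∀ n, B w (D n) = fderiv ℝ S.ψ y n := by
    intro n
    have h1 := inner_metricGradient g ψ p' (D n)
    have h2 : (fun z => S.ψ z) =ᶠ[𝓝 y] fun z => S'.ψ (Φ z) := by
      filter_upwards [hev] with z hz
      change ψ _ = ψ ((extChartAt (𝓡 2) p').symm (transition p p' z))
      rw [transition, chart_symm_apply hz.2]
    have h3 : DifferentiableAt ℝ S'.ψ (Φ y) := ContDiffOn.differentiableAt_of_isOpen S'.smooth_ψ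
      S'.isOpen (by rw [hΦy]; exact mem_chart_target hp')
    have h4 := (h3.hasFDerivAt.comp y (hΦ.differentiableAt (by simp)).hasFDerivAt).fderiv
    have h5 : fderiv ℝ S.ψ y = fderiv ℝ (fun z => S'.ψ (Φ z)) y := h2.fderiv_eq
    rw [h5]
    refine Eq.trans ?_ (congrArg (fun L : Plane →L[ℝ] ℝ => L n) h4).symm
    rw [hΦy]
    exact h1
  have hWv : D W = (B v v)⁻¹ • a - w - (B ((B v v)⁻¹ • a - w) v / B v v) • v := by
    rw [← hD]; exact hW
  obtain ⟨c1, c2⟩ := normalPart_char (B := B) hvv hWv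
  refine ⟨by rw [hGB, ← hvel]; exact c1, fun n hn => ?_⟩
  rw [hGB, ← hvel] at hn
  rw [hGB W, c2 _ hn, hacc, hgrad, hGB (deriv x θ) (deriv x θ), ← hvel]

end Chart
end DensityFlow
end

/-! ### Independence of the chart; the flow in coordinates -/

noncomputable section

namespace DensityFlow

namespace PlaneGeometry

variable {S S' : PlaneGeometry} {O O' : Set (ℝ × ℝ)} {x x' : ℝ × ℝ → Plane} {q : ℝ × ℝ}

/-- In ∇_θ T the derivative of `v⁻¹` multiplies x_θ, which is orthogonal to the normal, so only v⁻¹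
∇_θ x_θ counts. -/
theorem IsRegular.kap_zero_eq (h : S.IsRegular O x) (hq : q ∈ O) :
    S.kap x 0 q = (S.G (x q) (dX x q) (dX x q))⁻¹ *
      S.G (x q) (dX (dX x) q + S.Γ (x q) (dX x q) (dX x q)) (S.nor x q)
      - fderiv ℝ S.ψ (x q) (S.nor x q) := by
  have hv := h.speed_pos hq
  have h1 : S.covD x (0, 1) (S.tang x) q =
      fderiv ℝ (fun q => (S.speed x q)⁻¹) q (0, 1) • dX x q
        + (S.speed x q)⁻¹ • S.covD x (0, 1) (dX x) q :=
    h.covD_smul (h.differentiableAt hq h.contDiffOn_inv_speed)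
      (h.differentiableAt hq (h.contDiffOn_dX h.smooth)) _
  have h2 : S.G (x q) (dX x q) (S.nor x q) = 0 := by
    rw [h.dX_eq hq x]
    change S.G (x q) (_ • S.tang x q) _ = 0
    rw [map_smul, smul_apply, h.G_tang_nor hq, smul_zero]
  rw [← h.speed_sq hq]
  change S.G (x q) ((S.speed x q)⁻¹ • S.covD x (0, 1) (S.tang x) q) (S.nor x q) - _ = _
  rw [h1]
  simp only [map_smul, map_add, smul_apply, add_apply, h2, smul_eq_mul, covD]
  simp only [dX] at *
  field_simp
  ring

/-- The curvature with density and its arc length derivatives do not depend on the coordinates, up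
to a common sign. -/
theorem IsFlow.eventually_kap_eq (h : S.IsFlow O x) (h' : S'.IsFlow O' x') {Φ : Plane → Plane}
    {τ : ℝ × ℝ} (hq : q ∈ O) (hq' : q + τ ∈ O') (hΦ : ContDiffAt ℝ ∞ Φ (x q))
    (hG : ∀ᶠ z in 𝓝 (x q), ∀ u w, S.G z u w = S'.G (Φ z) (fderiv ℝ Φ z u) (fderiv ℝ Φ z w))
    (hx : ∀ᶠ p in 𝓝 q, x' (p + τ) = Φ (x p)) :
    (∀ᶠ p in 𝓝 q, S'.speed x' (p + τ) = S.speed x p) ∧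
      ∃ ε : ℝ, ε ^ 2 = 1 ∧ ∀ j, ∀ᶠ p in 𝓝 q, S'.kap x' j (p + τ) = ε * S.kap x j p := by
  have hxc : ContinuousAt x q := (h.differentiableAt hq h.smooth).continuousAt
  have hO : ∀ᶠ p in 𝓝 q, p ∈ O := h.isOpen.mem_nhds hq
  have hτc : Continuous fun p : ℝ × ℝ => p + τ := continuous_id.add continuous_const
  have hO' : ∀ᶠ p in 𝓝 q, p + τ ∈ O' := hτc.continuousAt.preimage_mem_nhds (h'.isOpen.mem_nhds hq')
  have hΦ1 : ∀ᶠ p in 𝓝 q, ContDiffAt ℝ 1 Φ (x p) := by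
    have h1 : ContDiffAt ℝ 1 Φ (x q) := hΦ.of_le (by simp)
    exact hxc.eventually (h1.eventually (by simp))
  have hD : ∀ᶠ p in 𝓝 q, ∀ e, fderiv ℝ x' (p + τ) e = fderiv ℝ Φ (x p) (fderiv ℝ x p e) := by
    filter_upwards [hx.eventually_nhds, hO, hΦ1] with p h1 h2 h3 e
    have h4 := (h3.differentiableAt (by simp)).hasFDerivAt.comp p
      (h.differentiableAt h2 h.smooth).hasFDerivAt
    have h5 : fderiv ℝ (fun p => x' (p + τ)) p = fderiv ℝ x' (p + τ) := fderiv_comp_add_right τ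
    rw [← h5, Filter.EventuallyEq.fderiv_eq (f := fun p => Φ (x p)) h1]
    exact congrArg (fun L : ℝ × ℝ →L[ℝ] Plane => L e) h4.fderiv
  have hGx : ∀ᶠ p in 𝓝 q, ∀ u w, S.G (x p) u w =
      S'.G (x' (p + τ)) (fderiv ℝ Φ (x p) u) (fderiv ℝ Φ (x p) w) := by
    filter_upwards [hxc.eventually hG, hx] with p h1 h2 u w
    rw [h2, h1]
  have hspeed : ∀ᶠ p in 𝓝 q, S'.speed x' (p + τ) = S.speed x p := by
    filter_upwards [hD, hGx] with p h1 h2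
    simp only [speed, dX, h1, h2]
  refine ⟨hspeed, ?_⟩
  -- The component of the transported normal along the other normal. Both are unit vectors
  -- orthogonal to the same tangent, so it is 1 or -1, and by continuity it is locally constant.
  set a : ℝ × ℝ → ℝ := fun p =>
    S'.G (x' (p + τ)) (fderiv ℝ Φ (x p) (S.nor x p)) (S'.nor x' (p + τ)) with ha
  have hnor : ∀ᶠ p in 𝓝 q, fderiv ℝ Φ (x p) (S.nor x p) = a p • S'.nor x' (p + τ) ∧ a p ^ 2 = 1 := by
    filter_upwards [hD, hGx, hspeed, hO, hO'] with p h1 h2 h3 h4 h5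
    have ht : S'.tang x' (p + τ) = fderiv ℝ Φ (x p) (S.tang x p) := by
      change (S'.speed x' (p + τ))⁻¹ • fderiv ℝ x' (p + τ) (0, 1) =
        fderiv ℝ Φ (x p) ((S.speed x p)⁻¹ • fderiv ℝ x p (0, 1))
      rw [h1, h3, map_smul]
    have h6 := h'.eq_frame h5 (fderiv ℝ Φ (x p) (S.nor x p))
    rw [ht, ← h2, h.G_nor_tang h4, zero_smul, zero_add] at h6
    refine ⟨h6, ?_⟩
    have h7 := h2 (S.nor x p) (S.nor x p)
    rw [h.G_nor_nor h4, h6] at h7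
    simp only [map_smul, smul_apply, smul_eq_mul, h'.G_nor_nor h5] at h7
    change 1 = a p * (a p * 1) at h7
    rw [sq, h7]; ring
  have hac : ContinuousAt a q := by
    have e1 : ContinuousAt (fun p => S'.G (x' (p + τ))) q :=
      ContinuousAt.comp (g := fun q => S'.G (x' q)) (f := fun p => p + τ)
        (h'.differentiableAt hq' h'.contDiffOn_G).continuousAt hτc.continuousAt
    have e2 : ContinuousAt (fun p => fderiv ℝ Φ (x p)) q :=
      ((hΦ.fderiv_right (m := ∞) (by simp)).continuousAt).comp' hxc
    have e3 : ContinuousAt (S.nor x) q := (h.differentiableAt hq h.contDiffOn_nor).continuousAt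
    have e4 : ContinuousAt (fun p => S'.nor x' (p + τ)) q :=
      ContinuousAt.comp (g := S'.nor x') (f := fun p => p + τ)
        (h'.differentiableAt hq' h'.contDiffOn_nor).continuousAt hτc.continuousAt
    exact (e1.clm_apply (e2.clm_apply e3)).clm_apply e4
  set ε := a q with hε
  have hε2 : ε ^ 2 = 1 := hnor.self_of_nhds.2
  have haε : ∀ᶠ p in 𝓝 q, a p = ε := by
    have h1 : ∀ᶠ p in 𝓝 q, |a p - ε| < 1 := by
      simpa [Real.dist_eq] using hac.eventually (Metric.ball_mem_nhds ε one_pos)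
    filter_upwards [h1, hnor] with p h1 h2
    rcases sq_eq_sq_iff_eq_or_eq_neg.1 (h2.2.trans hε2.symm) with h3 | h3
    · exact h3
    · rw [h3, abs_lt] at h1
      nlinarith
  refine ⟨ε, hε2, fun j => ?_⟩
  induction j with
  | zero =>
    -- Rather than transforming the curvature, one compares the velocities κ N of the two flows,
    -- which correspond under the differential of `Φ`.
    filter_upwards [hD, hnor, haε, hO, hO'] with p h1 h2 h3 h4 h5
    have h6 : dT x' (p + τ) = fderiv ℝ Φ (x p) (dT x p) := h1 _
    rw [h'.flow _ h5, h.flow _ h4, map_smul, h2.1, h3, smul_smul] at h6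
    have h7 := congrArg (fun z => S'.G (x' (p + τ)) z (S'.nor x' (p + τ))) h6
    simp only [map_smul, smul_apply, smul_eq_mul, h'.G_nor_nor h5, mul_one] at h7
    rw [h7, mul_comm]
  | succ j ih =>
    filter_upwards [ih.eventually_nhds, hspeed, hO] with p h1 h2 h3
    change (S'.speed x' (p + τ))⁻¹ • fderiv ℝ (S'.kap x' j) (p + τ) (0, 1) =
      ε * ((S.speed x p)⁻¹ • fderiv ℝ (S.kap x j) p (0, 1))
    have h5 : fderiv ℝ (fun p => S'.kap x' j (p + τ)) p = fderiv ℝ (S'.kap x' j) (p + τ) :=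
      fderiv_comp_add_right τ
    rw [h2, ← h5, Filter.EventuallyEq.fderiv_eq (f := fun p => ε * S.kap x j p) h1,
      fderiv_const_mul (h.differentiableAt h3 (h.contDiffOn_kap j))]
    simp only [smul_apply, smul_eq_mul]
    ring

end PlaneGeometry

section Surface

variable {M : Type*} [TopologicalSpace M] [ChartedSpace Plane M]

/-- The coordinates of a family of curves in the preferred chart at `p`. -/
def chartCoord (γ : ℝ → ℝ → M) (p : M) (q : ℝ × ℝ) : Plane := extChartAt (𝓡 2) p (γ q.1 q.2)

/-- The positive times and the parameters at which the curve is in the domain of the preferred chart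
at `p`. -/
def chartDomain (γ : ℝ → ℝ → M) (p : M) : Set (ℝ × ℝ) :=
  {q | 0 < q.1 ∧ γ q.1 q.2 ∈ (chartAt Plane p).source}

theorem isOpen_pos_time : IsOpen {q : ℝ × ℝ | 0 < q.1} := isOpen_lt continuous_const continuous_fst

variable [IsManifold (𝓡 2) ∞ M] {g : Metric M} {ψ : M → ℝ} {γ : ℝ → ℝ → M}

namespace IsPsiMCF

theorem contMDiffAt (hγ : IsPsiMCF g ψ γ) {q : ℝ × ℝ} (hq : 0 < q.1) :
    ContMDiffAt 𝓘(ℝ, ℝ × ℝ) (𝓡 2) ∞ (fun q : ℝ × ℝ => γ q.1 q.2) q :=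
  hγ.smooth.contMDiffAt (Filter.mem_of_superset (isOpen_pos_time.mem_nhds hq)
    fun _ hp => ⟨mem_Ici.2 (le_of_lt hp), mem_univ _⟩)

theorem isOpen_chartDomain (hγ : IsPsiMCF g ψ γ) (p : M) : IsOpen (chartDomain γ p) := by
  rw [isOpen_iff_mem_nhds]
  rintro q ⟨h1, h2⟩
  exact Filter.inter_mem (isOpen_pos_time.mem_nhds h1)
    ((hγ.contMDiffAt h1).continuousAt.preimage_mem_nhds
      ((chartAt Plane p).open_source.mem_nhds h2))

theorem contDiffOn_chartCoord (hγ : IsPsiMCF g ψ γ) (p : M) :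
    ContDiffOn ℝ ∞ (chartCoord γ p) (chartDomain γ p) := by
  rintro q ⟨h1, h2⟩
  refine ContDiffAt.contDiffWithinAt ?_
  rw [← contMDiffAt_iff_contDiffAt]
  exact (contMDiffAt_extChartAt' h2).comp q (hγ.contMDiffAt h1)

theorem velocity_chart (hγ : IsPsiMCF g ψ γ) {p : M} {t θ : ℝ} (hq : (t, θ) ∈ chartDomain γ p) :
    (velocity (γ t) θ : Plane) =
      chartDeriv p (chartCoord γ p (t, θ)) (dX (chartCoord γ p) (t, θ)) := by
  have h1 := mfderiv_curve (((hγ.closed t hq.1.le).smooth θ).mdifferentiableAt (by simp)) hq.2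
  have h2 := hasDerivAt_space (ContDiffOn.differentiableAt_of_isOpen (hγ.contDiffOn_chartCoord p)
    (hγ.isOpen_chartDomain p) hq)
  rw [← h2.deriv]
  exact h1

variable (hψ : ContMDiff (𝓡 2) 𝓘(ℝ, ℝ) ∞ ψ)

theorem isRegular (hγ : IsPsiMCF g ψ γ) (p : M) :
    (chartGeometry g hψ p).IsRegular (chartDomain γ p) (chartCoord γ p) where
  isOpen := hγ.isOpen_chartDomain p
  smooth := hγ.contDiffOn_chartCoord p
  mapsTo _ hq := mem_chart_target hq.2
  regular := by
    rintro ⟨t, θ⟩ hq h0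
    have h1 := hγ.velocity_chart hq
    rw [h0, map_zero] at h1
    exact (hγ.closed t hq.1.le).regular θ h1

/-- In coordinates, a solution of the flow on the surface is a solution of the flow in the plane. -/
theorem isFlow (hγ : IsPsiMCF g ψ γ) (p : M) :
    (chartGeometry g hψ p).IsFlow (chartDomain γ p) (chartCoord γ p) where
  toIsRegular := hγ.isRegular hψ p
  flow := by
    rintro ⟨t, θ⟩ hq
    have hR := hγ.isRegular hψ p
    set S := chartGeometry g hψ p
    set x := chartCoord γ p
    have ht : 0 < t := hq.1
    have hxd : DifferentiableAt ℝ x (t, θ) := hR.differentiableAt hq hR.smooth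
    have hT := hasDerivAt_time hxd
    have hXd : DifferentiableAt ℝ (dX x) (t, θ) :=
      hR.differentiableAt hq (hR.contDiffOn_dX hR.smooth)
    have hW : chartDeriv p (extChartAt (𝓡 2) p (γ t θ)) (dT x (t, θ)) =
        psiCurvature g ψ (γ t) θ := by
      have h1 := hγ.flow t ht.le θ
      rw [mfderivWithin_of_mem_nhds (Ici_mem_nhds ht)] at h1
      have hmd : MDifferentiableAt 𝓘(ℝ, ℝ) (𝓡 2) (fun s => γ s θ) t := by
        have h2 : MDifferentiableAt 𝓘(ℝ, ℝ) 𝓘(ℝ, ℝ × ℝ) (fun s : ℝ => (s, θ)) t :=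
          (differentiableAt_id.prodMk (differentiableAt_const θ)).mdifferentiableAt
        exact ((hγ.contMDiffAt (q := (t, θ)) ht).mdifferentiableAt (by simp)).comp t h2
      have h2 := mfderiv_curve hmd (p := p) hq.2
      rw [← hT.deriv]
      exact h2.symm.trans h1
    obtain ⟨h1, h2⟩ := psiCurvature_chart g hψ (hγ.closed t ht.le).smooth
      ((hγ.closed t ht.le).regular θ) hq.2 hW
    have hd1 : deriv (fun s => extChartAt (𝓡 2) p (γ t s)) θ = dX x (t, θ) :=
      (hasDerivAt_space hxd).deriv
    have hd2 : deriv (deriv fun s => extChartAt (𝓡 2) p (γ t s)) θ = dX (dX x) (t, θ) := by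
      have h3 : deriv (fun s => extChartAt (𝓡 2) p (γ t s)) =ᶠ[𝓝 θ] fun s => dX x (t, s) := by
        have h4 : ∀ᶠ s in 𝓝 θ, (t, s) ∈ chartDomain γ p :=
          (Continuous.prodMk_right t).continuousAt.preimage_mem_nhds (hR.isOpen.mem_nhds hq)
        filter_upwards [h4] with s hs
        exact (hasDerivAt_space (hR.differentiableAt hs hR.smooth)).deriv
      rw [h3.deriv_eq]
      exact (hasDerivAt_space hXd).deriv
    have hdX : dX x (t, θ) = S.speed x (t, θ) • S.tang x (t, θ) := hR.dX_eq hq x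
    rw [hd1] at h1 h2
    rw [hd2] at h2
    change S.G (x (t, θ)) (dT x (t, θ)) (dX x (t, θ)) = 0 at h1
    have h3 : S.G (x (t, θ)) (dT x (t, θ)) (S.tang x (t, θ)) = 0 := by
      rw [hdX, map_smul, smul_eq_mul] at h1
      exact (mul_eq_zero.1 h1).resolve_left (hR.speed_pos hq).ne'
    have h4 : S.G (x (t, θ)) (dX x (t, θ)) (S.nor x (t, θ)) = 0 := by
      rw [hdX, map_smul, smul_apply, hR.G_tang_nor hq, smul_zero]
    -- The velocity is determined by its tangential component, which is zero, and its normal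
    -- component, which is κ.
    rw [hR.eq_frame hq (dT x (t, θ)), h3, zero_smul, zero_add, hR.kap_zero_eq hq]
    exact congrArg (· • S.nor x (t, θ)) (h2 _ h4)

end IsPsiMCF

end Surface

end DensityFlow
end

/-! ### Global quantities along the flow and uniform estimates -/

noncomputable section

namespace DensityFlow

theorem dT_congr {E : Type*} [NormedAddCommGroup E] [NormedSpace ℝ E] {f f' : ℝ × ℝ → E} {q : ℝ × ℝ}
    (h : f =ᶠ[𝓝 q] f') : dT f q = dT f' q := by
  rw [dT, dT, h.fderiv_eq]

theorem dX_congr {E : Type*} [NormedAddCommGroup E] [NormedSpace ℝ E] {f f' : ℝ × ℝ → E} {q : ℝ × ℝ}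
    (h : f =ᶠ[𝓝 q] f') : dX f q = dX f' q := by
  rw [dX, dX, h.fderiv_eq]

theorem eventuallyEq_dX {E : Type*} [NormedAddCommGroup E] [NormedSpace ℝ E] {f f' : ℝ × ℝ → E}
    {q : ℝ × ℝ} (h : f =ᶠ[𝓝 q] f') : dX f =ᶠ[𝓝 q] dX f' :=
  h.eventuallyEq_nhds.mono fun _ hp => dX_congr hp

section Surface

variable {M : Type*} [TopologicalSpace M] [ChartedSpace Plane M]

/-- Finitely many charts, each restricted to a compact coordinate neighbourhood, cover `U`.
Requiring the property for all larger constants lets one sum of absolute values serve every chart.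
-/
theorem exists_uniform_const {U : Set M} (hU : IsCompact U) {γ : ℝ → ℝ → M}
    (hγU : ∀ t, 0 ≤ t → ∀ θ, γ t θ ∈ U) {R : ℝ → ℝ × ℝ → Prop}
    (hR : ∀ p K, IsCompact K → K ⊆ (extChartAt (𝓡 2) p).target → ∃ C, ∀ C' ≥ C,
      ∀ q ∈ chartDomain γ p, chartCoord γ p q ∈ K → R C' q) :
    ∃ C, 0 ≤ C ∧ ∀ q : ℝ × ℝ, 0 < q.1 → R C q := by
  have h1 : ∀ p : M, ∃ K, IsCompact K ∧ K ⊆ (extChartAt (𝓡 2) p).target ∧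
      K ∈ 𝓝 (extChartAt (𝓡 2) p p) := fun p => by
    obtain ⟨K, hK, hpK, hKs⟩ := exists_compact_subset ((isOpen_extChartAt_target (I := 𝓡 2) p))
      (mem_extChartAt_target (I := 𝓡 2) p)
    exact ⟨K, hK, hKs, mem_interior_iff_mem_nhds.1 hpK⟩
  choose K hK hKs hKn using h1
  choose C hC using fun p => hR p (K p) (hK p) (hKs p)
  obtain ⟨s, -, hs⟩ := hU.elim_nhds_subcover
    (fun p => (chartAt Plane p).source ∩ extChartAt (𝓡 2) p ⁻¹' K p)
    fun p _ => inter_mem ((chartAt Plane p).open_source.mem_nhds (mem_chart_source Plane p))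
      ((continuousAt_extChartAt p).preimage_mem_nhds (hKn p))
  refine ⟨∑ p ∈ s, |C p|, Finset.sum_nonneg fun _ _ => abs_nonneg _, fun q hq => ?_⟩
  obtain ⟨p, hp, h2⟩ := mem_iUnion₂.1 (hs (hγU q.1 hq.le q.2))
  exact hC p _ ((le_abs_self _).trans (Finset.single_le_sum (f := fun p => |C p|)
    (fun _ _ => abs_nonneg _) hp)) q ⟨hq, h2.1⟩ h2.2

theorem mem_chartDomain_self {γ : ℝ → ℝ → M} {q : ℝ × ℝ} (hq : 0 < q.1) :
    q ∈ chartDomain γ (γ q.1 q.2) :=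
  ⟨hq, mem_chart_source Plane _⟩

variable [IsManifold (𝓡 2) ∞ M] (g : Metric M) {ψ : M → ℝ} (hψ : ContMDiff (𝓡 2) 𝓘(ℝ, ℝ) ∞ ψ)
  (γ : ℝ → ℝ → M)

/-- The speed of a family of curves. -/
def flowSpeed (q : ℝ × ℝ) : ℝ :=
  (chartGeometry g hψ (γ q.1 q.2)).speed (chartCoord γ (γ q.1 q.2)) q

/-- The square of the `j`-th arc length derivative of the curvature with density. -/
def curvSq (j : ℕ) (q : ℝ × ℝ) : ℝ :=
  (chartGeometry g hψ (γ q.1 q.2)).kap (chartCoord γ (γ q.1 q.2)) j q ^ 2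

/-- The value of the density along a family of curves. -/
def flowDensity (ψ : M → ℝ) (γ : ℝ → ℝ → M) (q : ℝ × ℝ) : ℝ := Real.exp (ψ (γ q.1 q.2))

/-- Arc length derivative. -/
def arcDeriv (f : ℝ × ℝ → ℝ) (q : ℝ × ℝ) : ℝ := (flowSpeed g hψ γ q)⁻¹ * dX f q

variable {g γ} {q : ℝ × ℝ} {p : M}

namespace IsPsiMCF

/-- With τ = 0 this compares two charts at the same point; with τ = (0, 2π) it gives periodicity.
Squaring removes the sign left undetermined by the choice of normals. -/
theorem eventually_eq_of_charts (hγ : IsPsiMCF g ψ γ) {p' : M} {τ : ℝ × ℝ}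
    (hq : q ∈ chartDomain γ p) (hq' : q + τ ∈ chartDomain γ p')
    (hτ : ∀ᶠ r in 𝓝 q, γ (r + τ).1 (r + τ).2 = γ r.1 r.2) :
    (∀ᶠ r in 𝓝 q, (chartGeometry g hψ p').speed (chartCoord γ p') (r + τ) =
      (chartGeometry g hψ p).speed (chartCoord γ p) r) ∧
    ∀ j, ∀ᶠ r in 𝓝 q, (chartGeometry g hψ p').kap (chartCoord γ p') j (r + τ) ^ 2 =
      (chartGeometry g hψ p).kap (chartCoord γ p) j r ^ 2 := by
  have hqp' : γ q.1 q.2 ∈ (chartAt Plane p').source := by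
    rw [← hτ.self_of_nhds]; exact hq'.2
  obtain ⟨h1, ε, hε, h2⟩ := (hγ.isFlow hψ p).eventually_kap_eq (hγ.isFlow hψ p')
    (Φ := transition p p') hq hq' (contDiffAt_transition hq.2 hqp')
    (by filter_upwards [eventually_chart_symm_mem hq.2 hqp'] with z hz u w
          using chartMetric_transition g hz.1 hz.2 u w)
    (by filter_upwards [hτ, (hγ.isOpen_chartDomain p).mem_nhds hq] with r hr hr'
        simp only [chartCoord, transition, hr]
        rw [chart_symm_apply hr'.2])
  refine ⟨h1, fun j => ?_⟩
  filter_upwards [h2 j] with r hr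
  rw [hr, mul_pow, hε, one_mul]

theorem flowSpeed_eq (hγ : IsPsiMCF g ψ γ) (hq : q ∈ chartDomain γ p) :
    flowSpeed g hψ γ q = (chartGeometry g hψ p).speed (chartCoord γ p) q := by
  have h := (hγ.eventually_eq_of_charts hψ (τ := 0) hq (by simpa using mem_chartDomain_self hq.1)
    (Eventually.of_forall fun r => by simp)).1.self_of_nhds
  rw [add_zero] at h
  exact h

theorem curvSq_eq (hγ : IsPsiMCF g ψ γ) (hq : q ∈ chartDomain γ p) (j : ℕ) :
    curvSq g hψ γ j q = (chartGeometry g hψ p).kap (chartCoord γ p) j q ^ 2 := by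
  have h := ((hγ.eventually_eq_of_charts hψ (τ := 0) hq (by simpa using mem_chartDomain_self hq.1)
    (Eventually.of_forall fun r => by simp)).2 j).self_of_nhds
  rw [add_zero] at h
  exact h

theorem eventually_periodic (hγ : IsPsiMCF g ψ γ) (hq : 0 < q.1) :
    ∀ᶠ r in 𝓝 q, γ (r + (0, 2 * Real.pi)).1 (r + (0, 2 * Real.pi)).2 = γ r.1 r.2 := by
  filter_upwards [isOpen_pos_time.mem_nhds hq] with r hr
  simpa using (hγ.closed r.1 (le_of_lt hr)).periodic r.2

theorem mem_chartDomain_add (hγ : IsPsiMCF g ψ γ) (hq : q ∈ chartDomain γ p) :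
    q + (0, 2 * Real.pi) ∈ chartDomain γ p :=
  ⟨by simpa using hq.1, by rw [(hγ.eventually_periodic hq.1).self_of_nhds]; exact hq.2⟩

theorem flowSpeed_periodic (hγ : IsPsiMCF g ψ γ) {t : ℝ} (ht : 0 < t) :
    Function.Periodic (fun θ => flowSpeed g hψ γ (t, θ)) (2 * Real.pi) := fun θ => by
  have hq : (t, θ) ∈ chartDomain γ (γ t θ) := mem_chartDomain_self ht
  have h := (hγ.eventually_eq_of_charts hψ hq (hγ.mem_chartDomain_add hq)
    (hγ.eventually_periodic ht)).1.self_of_nhds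
  rw [← hγ.flowSpeed_eq hψ (hγ.mem_chartDomain_add hq), ← hγ.flowSpeed_eq hψ hq] at h
  simpa using h

theorem curvSq_periodic (hγ : IsPsiMCF g ψ γ) {t : ℝ} (ht : 0 < t) (j : ℕ) :
    Function.Periodic (fun θ => curvSq g hψ γ j (t, θ)) (2 * Real.pi) := fun θ => by
  have hq : (t, θ) ∈ chartDomain γ (γ t θ) := mem_chartDomain_self ht
  have h := ((hγ.eventually_eq_of_charts hψ hq (hγ.mem_chartDomain_add hq)
    (hγ.eventually_periodic ht)).2 j).self_of_nhds
  rw [← hγ.curvSq_eq hψ (hγ.mem_chartDomain_add hq), ← hγ.curvSq_eq hψ hq] at h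
  simpa using h

theorem eventually_flowSpeed (hγ : IsPsiMCF g ψ γ) (hq : q ∈ chartDomain γ p) :
    flowSpeed g hψ γ =ᶠ[𝓝 q] (chartGeometry g hψ p).speed (chartCoord γ p) :=
  Filter.mem_of_superset ((hγ.isOpen_chartDomain p).mem_nhds hq)
    fun _ hr => hγ.flowSpeed_eq hψ hr

theorem eventually_curvSq (hγ : IsPsiMCF g ψ γ) (hq : q ∈ chartDomain γ p) (j : ℕ) :
    curvSq g hψ γ j =ᶠ[𝓝 q] fun r => (chartGeometry g hψ p).kap (chartCoord γ p) j r ^ 2 :=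
  Filter.mem_of_superset ((hγ.isOpen_chartDomain p).mem_nhds hq)
    fun _ hr => hγ.curvSq_eq hψ hr j

theorem eventually_comp (hγ : IsPsiMCF g ψ γ) (hq : q ∈ chartDomain γ p) (f : M → ℝ) :
    (fun r => f (γ r.1 r.2)) =ᶠ[𝓝 q]
      fun r => (f ∘ (extChartAt (𝓡 2) p).symm) (chartCoord γ p r) :=
  Filter.mem_of_superset ((hγ.isOpen_chartDomain p).mem_nhds hq)
    fun r hr => by
      change f (γ r.1 r.2) = f ((extChartAt (𝓡 2) p).symm (extChartAt (𝓡 2) p (γ r.1 r.2)))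
      rw [chart_symm_apply hr.2]

theorem eventually_flowDensity (hγ : IsPsiMCF g ψ γ) (hq : q ∈ chartDomain γ p) :
    flowDensity ψ γ =ᶠ[𝓝 q]
      fun r => Real.exp ((chartGeometry g hψ p).ψ (chartCoord γ p r)) := by
  filter_upwards [hγ.eventually_comp hq ψ] with r hr
  exact congrArg Real.exp hr

theorem contDiffOn_of_charts {f : ℝ × ℝ → ℝ}
    (h : ∀ q : ℝ × ℝ, 0 < q.1 → ∃ f', f =ᶠ[𝓝 q] f' ∧ ContDiffAt ℝ ∞ f' q) :
    ContDiffOn ℝ ∞ f {q | 0 < q.1} := fun q hq => by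
  obtain ⟨f', h1, h2⟩ := h q hq
  exact (h2.congr_of_eventuallyEq h1).contDiffWithinAt

theorem contDiffOn_flowSpeed (hγ : IsPsiMCF g ψ γ) :
    ContDiffOn ℝ ∞ (flowSpeed g hψ γ) {q | 0 < q.1} :=
  contDiffOn_of_charts fun _ hq => ⟨_, hγ.eventually_flowSpeed hψ (mem_chartDomain_self hq),
    (hγ.isRegular hψ _).contDiffOn_speed.contDiffAt ((hγ.isOpen_chartDomain _).mem_nhds
      (mem_chartDomain_self hq))⟩

theorem contDiffOn_curvSq (hγ : IsPsiMCF g ψ γ) (j : ℕ) :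
    ContDiffOn ℝ ∞ (curvSq g hψ γ j) {q | 0 < q.1} :=
  contDiffOn_of_charts fun _ hq => ⟨_, hγ.eventually_curvSq hψ (mem_chartDomain_self hq) j,
    (((hγ.isRegular hψ _).contDiffOn_kap j).pow 2).contDiffAt ((hγ.isOpen_chartDomain _).mem_nhds
      (mem_chartDomain_self hq))⟩

theorem contDiffOn_comp (hγ : IsPsiMCF g ψ γ) {f : M → ℝ} (hf : ContMDiff (𝓡 2) 𝓘(ℝ, ℝ) ∞ f) :
    ContDiffOn ℝ ∞ (fun q : ℝ × ℝ => f (γ q.1 q.2)) {q | 0 < q.1} := fun q hq => by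
  refine ContDiffAt.contDiffWithinAt ?_
  rw [← contMDiffAt_iff_contDiffAt]
  exact (hf (γ q.1 q.2)).comp q (hγ.contMDiffAt hq)

theorem contDiffOn_flowDensity (hψ : ContMDiff (𝓡 2) 𝓘(ℝ, ℝ) ∞ ψ) (hγ : IsPsiMCF g ψ γ) :
    ContDiffOn ℝ ∞ (flowDensity ψ γ) {q | 0 < q.1} :=
  (hγ.contDiffOn_comp hψ).exp

theorem flowSpeed_pos (hγ : IsPsiMCF g ψ γ) (hq : 0 < q.1) : 0 < flowSpeed g hψ γ q :=
  (hγ.isRegular hψ _).speed_pos (mem_chartDomain_self hq)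

theorem curvSq_nonneg (j : ℕ) : 0 ≤ curvSq g hψ γ j q := sq_nonneg _

theorem contDiffOn_arcDeriv (hγ : IsPsiMCF g ψ γ) {f : ℝ × ℝ → ℝ}
    (hf : ContDiffOn ℝ ∞ f {q | 0 < q.1}) : ContDiffOn ℝ ∞ (arcDeriv g hψ γ f) {q | 0 < q.1} :=
  ((hγ.contDiffOn_flowSpeed hψ).inv fun _ hq => (hγ.flowSpeed_pos hψ hq).ne').mul
    (contDiffOn_fderiv_apply isOpen_pos_time hf _)

theorem eventually_arcDeriv (hγ : IsPsiMCF g ψ γ) (hq : q ∈ chartDomain γ p) {f f' : ℝ × ℝ → ℝ}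
    (hf : f =ᶠ[𝓝 q] f') : arcDeriv g hψ γ f =ᶠ[𝓝 q] (chartGeometry g hψ p).dS (chartCoord γ p) f' := by
  filter_upwards [hγ.eventually_flowSpeed hψ hq, eventuallyEq_dX hf] with r h1 h2
  rw [arcDeriv, h1, h2]; rfl

theorem eventually_iterate_arcDeriv (hγ : IsPsiMCF g ψ γ) (hq : q ∈ chartDomain γ p)
    {f f' : ℝ × ℝ → ℝ} (hf : f =ᶠ[𝓝 q] f') (j : ℕ) : (arcDeriv g hψ γ)^[j] f =ᶠ[𝓝 q]
      ((chartGeometry g hψ p).dS (chartCoord γ p))^[j] f' := by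
  induction j with
  | zero => exact hf
  | succ j ih =>
    rw [Function.iterate_succ_apply', Function.iterate_succ_apply']
    exact hγ.eventually_arcDeriv hψ hq ih

theorem dT_flowDensity_mul_speed (hγ : IsPsiMCF g ψ γ) (hq : 0 < q.1) :
    dT (fun r => flowDensity ψ γ r * flowSpeed g hψ γ r) q =
      -curvSq g hψ γ 0 q * (flowDensity ψ γ q * flowSpeed g hψ γ q) := by
  have hq' : q ∈ chartDomain γ (γ q.1 q.2) := mem_chartDomain_self hq
  have h1 := hγ.eventually_flowDensity hψ hq'
  have h2 := hγ.eventually_flowSpeed hψ hq'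
  rw [dT_congr (h1.fun_mul h2), h1.self_of_nhds, h2.self_of_nhds,
    (hγ.eventually_curvSq hψ hq' 0).self_of_nhds]
  exact (hγ.isFlow hψ _).dT_density hq'

/-- The square of (κ_j²)_s = 2 κ_j κ_{j+1}, whose two sides involve squares only. -/
theorem sq_arcDeriv_curvSq (hγ : IsPsiMCF g ψ γ) (hq : 0 < q.1) (j : ℕ) :
    arcDeriv g hψ γ (curvSq g hψ γ j) q ^ 2 =
      4 * curvSq g hψ γ j q * curvSq g hψ γ (j + 1) q := by
  have hq' : q ∈ chartDomain γ (γ q.1 q.2) := mem_chartDomain_self hq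
  have h1 := hγ.eventually_curvSq hψ hq'
  rw [(hγ.eventually_arcDeriv hψ hq' (h1 j)).self_of_nhds, (h1 j).self_of_nhds,
    (h1 (j + 1)).self_of_nhds, (hγ.isFlow hψ _).dS_sq hq' ((hγ.isRegular hψ _).contDiffOn_kap j)]
  change (2 * _ * PlaneGeometry.kap _ _ (j + 1) q) ^ 2 = _
  ring

variable {U : Set M}

theorem exists_dT_energy_le (hγ : IsPsiMCF g ψ γ) (hU : IsCompact U)
    (hγU : ∀ t, 0 ≤ t → ∀ θ, γ t θ ∈ U) : ∃ C, 0 ≤ C ∧ ∀ q : ℝ × ℝ, 0 < q.1 →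
    dT (fun r => curvSq g hψ γ 0 r * (flowDensity ψ γ r * flowSpeed g hψ γ r)) q ≤
      dX (fun r => flowDensity ψ γ r * arcDeriv g hψ γ (curvSq g hψ γ 0) r) q
      + flowDensity ψ γ q * flowSpeed g hψ γ q * (-2 * curvSq g hψ γ 1 q
        + C * (curvSq g hψ γ 0 q * (1 + curvSq g hψ γ 0 q))) := by
  refine exists_uniform_const hU hγU fun p K hK hKs => ?_
  have hF := hγ.isFlow hψ p
  obtain ⟨C, -, hC⟩ := hF.exists_reaction_le hK hKs
  refine ⟨2 * C, fun C' hC' q hq hqK => ?_⟩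
  have h1 := hγ.eventually_flowDensity hψ hq
  have h2 := hγ.eventually_flowSpeed hψ hq
  have h3 := hγ.eventually_curvSq hψ hq
  rw [dT_congr ((h3 0).fun_mul (h1.fun_mul h2)), dX_congr (h1.fun_mul (hγ.eventually_arcDeriv hψ hq (h3 0)))]
  refine (hF.dT_energy hq).le.trans (add_le_add le_rfl ?_)
  rw [h1.self_of_nhds, h2.self_of_nhds, (h3 0).self_of_nhds, (h3 1).self_of_nhds]
  refine mul_le_mul_of_nonneg_left ?_ (mul_pos (Real.exp_pos _) (hF.speed_pos hq)).le
  have h4 := hC q hq hqK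
  set a := (chartGeometry g hψ p).kap (chartCoord γ p) 0 q ^ 2 with ha
  have ha0 : 0 ≤ a := sq_nonneg _
  have h5 : (chartGeometry g hψ p).kap (chartCoord γ p) 0 q ^ 4 = a ^ 2 := by rw [ha]; ring
  rw [h5]
  have h6 := mul_le_mul_of_nonneg_left h4 ha0
  have h7 : 0 ≤ (C' - 2 * C) * (a * (1 + a)) := by
    have : 0 ≤ C' - 2 * C := by linarith
    positivity
  nlinarith

theorem isLocalMax_congr_time {f f' : ℝ × ℝ → ℝ} {t θ : ℝ} (h : f =ᶠ[𝓝 (t, θ)] f')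
    (hm : IsLocalMax (fun s => f (t, s)) θ) : IsLocalMax (fun s => f' (t, s)) θ := by
  have h1 : ∀ᶠ s in 𝓝 θ, f (t, s) = f' (t, s) :=
    (Continuous.prodMk_right t).continuousAt.eventually h
  exact (Filter.EventuallyEq.isLocalMax_iff h1).1 hm

theorem exists_dT_curvSq_le (hγ : IsPsiMCF g ψ γ) (hU : IsCompact U)
    (hγU : ∀ t, 0 ≤ t → ∀ θ, γ t θ ∈ U) : ∃ C, 0 ≤ C ∧ ∀ q : ℝ × ℝ, 0 < q.1 →
    IsLocalMax (fun s => curvSq g hψ γ 0 (q.1, s)) q.2 → dT (curvSq g hψ γ 0) q ≤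
      C * (curvSq g hψ γ 0 q * (1 + curvSq g hψ γ 0 q)) := by
  refine exists_uniform_const hU hγU fun p K hK hKs => ?_
  have hF := hγ.isFlow hψ p
  obtain ⟨C, -, hC⟩ := hF.exists_reaction_le hK hKs
  refine ⟨2 * C, fun C' hC' q hq hqK hmax => ?_⟩
  obtain ⟨t, θ⟩ := q
  have h3 := hγ.eventually_curvSq hψ hq 0
  rw [dT_congr h3]
  refine (hF.dT_kap_sq_le_of_isLocalMax hq (isLocalMax_congr_time h3 hmax)).trans ?_
  rw [h3.self_of_nhds]
  have h4 := hC _ hq hqK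
  set a := (chartGeometry g hψ p).kap (chartCoord γ p) 0 (t, θ) ^ 2 with ha
  have ha0 : 0 ≤ a := sq_nonneg _
  have h6 := mul_le_mul_of_nonneg_left h4 ha0
  have h7 : 0 ≤ (C' - 2 * C) * (a * (1 + a)) := by
    have : 0 ≤ C' - 2 * C := by linarith
    positivity
  nlinarith

theorem exists_dT_curvSq_succ_le (hγ : IsPsiMCF g ψ γ) (hU : IsCompact U)
    (hγU : ∀ t, 0 ≤ t → ∀ θ, γ t θ ∈ U) {B : ℝ} (hB : 0 ≤ B) (j : ℕ) :
    ∃ C, 0 ≤ C ∧ ∀ q : ℝ × ℝ, 0 < q.1 → ∀ lam, 0 ≤ lam →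
    (∀ i ≤ j, curvSq g hψ γ i q ≤ B ^ 2) →
    IsLocalMax (fun s => curvSq g hψ γ (j + 1) (q.1, s) + lam * curvSq g hψ γ j (q.1, s)) q.2 →
    dT (fun r => curvSq g hψ γ (j + 1) r + lam * curvSq g hψ γ j r) q ≤
      C + 2 * lam * B * C + (3 * C - 2 * lam) * curvSq g hψ γ (j + 1) q := by
  refine exists_uniform_const hU hγU fun p K hK hKs => ?_
  have hF := hγ.isFlow hψ p
  obtain ⟨C, -, hC⟩ := hF.exists_bernstein hK hKs hB j
  refine ⟨C, fun C' hC' q hq hqK lam hlam hb hmax => ?_⟩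
  obtain ⟨t, θ⟩ := q
  have h3 := hγ.eventually_curvSq hψ hq
  have h4 : (fun r => curvSq g hψ γ (j + 1) r + lam * curvSq g hψ γ j r) =ᶠ[𝓝 (t, θ)] fun r =>
      (chartGeometry g hψ p).kap (chartCoord γ p) (j + 1) r ^ 2
        + lam * (chartGeometry g hψ p).kap (chartCoord γ p) j r ^ 2 := by
    filter_upwards [h3 j, h3 (j + 1)] with r h1 h2
    rw [h1, h2]
  rw [dT_congr h4]
  refine (hC lam hlam t θ hq hqK (fun i hi => ?_) (isLocalMax_congr_time h4 hmax)).trans ?_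
  · have h5 := hb i hi
    rw [(h3 i).self_of_nhds] at h5
    exact abs_le_of_sq_le_sq h5 hB
  · rw [(h3 (j + 1)).self_of_nhds]
    have h5 : lam * B * C ≤ lam * B * C' := mul_le_mul_of_nonneg_left hC' (by positivity)
    have h6 := mul_le_mul_of_nonneg_right hC'
      (sq_nonneg ((chartGeometry g hψ p).kap (chartCoord γ p) (j + 1) (t, θ)))
    linarith

/-- Turns curvature bounds into bounds for the derivatives of test functions along the curves, the
input of the compactness argument. -/
theorem exists_abs_iterate_arcDeriv_le (hγ : IsPsiMCF g ψ γ) (hU : IsCompact U)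
    (hγU : ∀ t, 0 ≤ t → ∀ θ, γ t θ ∈ U) {f : M → ℝ} (hf : ContMDiff (𝓡 2) 𝓘(ℝ, ℝ) ∞ f) (B : ℝ)
    (j : ℕ) : ∃ C, 0 ≤ C ∧ ∀ q : ℝ × ℝ, 0 < q.1 → (∀ i ≤ j, curvSq g hψ γ i q ≤ B) →
      |(arcDeriv g hψ γ)^[j] (fun r => f (γ r.1 r.2)) q| ≤ C := by
  refine exists_uniform_const hU hγU fun p K hK hKs => ?_
  have hF := hγ.isFlow hψ p
  obtain ⟨a, ha, hae⟩ := hF.iterate_dS_comp_adm (contDiffOn_comp_chart_symm hf p) j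
  obtain ⟨C, hC⟩ := hF.adm_bounded ha hK hKs (√B)
  refine ⟨C, fun C' hC' q hq hqK hb => ?_⟩
  rw [(hγ.eventually_iterate_arcDeriv hψ hq (hγ.eventually_comp hq f) j).self_of_nhds]
  refine (le_of_eq (congrArg abs (hae hq))).trans ((hC q hq hqK fun i hi => ?_).trans hC')
  refine Real.abs_le_sqrt ?_
  rw [← hγ.curvSq_eq hψ hq]
  exact hb i hi

/-- The first derivative along a unit tangent needs no curvature bound. It serves to control
oscillation by length before any curvature estimate is available. -/
theorem exists_abs_arcDeriv_le (hγ : IsPsiMCF g ψ γ) (hU : IsCompact U)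
    (hγU : ∀ t, 0 ≤ t → ∀ θ, γ t θ ∈ U) {f : M → ℝ} (hf : ContMDiff (𝓡 2) 𝓘(ℝ, ℝ) ∞ f) :
    ∃ C, 0 ≤ C ∧ ∀ q : ℝ × ℝ, 0 < q.1 → |arcDeriv g hψ γ (fun r => f (γ r.1 r.2)) q| ≤ C := by
  refine exists_uniform_const hU hγU fun p K hK hKs => ?_
  have hF := hγ.isFlow hψ p
  set S := chartGeometry g hψ p
  have hfp := contDiffOn_comp_chart_symm hf p
  have hc : ContinuousOn (fun z : Plane × Plane =>
      fderiv ℝ (fun y => f ((extChartAt (𝓡 2) p).symm y)) z.1 z.2) {z | z.1 ∈ K ∧ S.G z.1 z.2 z.2 = 1} := by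
    have h1 := (hfp.fderiv_of_isOpen (isOpen_chart_target p) (m := ∞) (by simp)).continuousOn
    exact (h1.comp continuousOn_fst fun z hz => hKs hz.1).clm_apply continuousOn_snd
  obtain ⟨C, hC⟩ := (S.isCompact_unit_tangent hK hKs).exists_bound_of_continuousOn hc
  refine ⟨C, fun C' hC' q hq hqK => ?_⟩
  rw [(hγ.eventually_arcDeriv hψ hq (hγ.eventually_comp hq f)).self_of_nhds]
  have h1 := hC (chartCoord γ p q, S.tang (chartCoord γ p) q) ⟨hqK, hF.G_tang_tang hq⟩
  refine le_trans (le_of_eq ?_) (h1.trans hC')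
  have h2 : DifferentiableAt ℝ (fun y => f ((extChartAt (𝓡 2) p).symm y)) (chartCoord γ p q) :=
    ContDiffOn.differentiableAt_of_isOpen hfp (isOpen_chart_target p) (mem_chart_target hq.2)
  have h3 := (h2.hasFDerivAt.comp q (hF.differentiableAt hq hF.smooth).hasFDerivAt).fderiv
  rw [Real.norm_eq_abs]
  congr 1
  change (S.speed (chartCoord γ p) q)⁻¹ • fderiv ℝ _ q (0, 1) =
    fderiv ℝ _ _ ((S.speed (chartCoord γ p) q)⁻¹ • fderiv ℝ (chartCoord γ p) q (0, 1))
  rw [map_smul]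
  congr 1
  exact congrArg (fun L : ℝ × ℝ →L[ℝ] ℝ => L (0, 1)) h3

end IsPsiMCF

/-- A function with a strict minimum at a given point, whose maximum over a curve moving by the
flow decreases at a definite rate as long as it is negative. -/
theorem exists_barrier_function [T2Space M] (g : Metric M)
    (hψ : ContMDiff (𝓡 2) 𝓘(ℝ, ℝ) ∞ ψ) (P : M) :
    ∃ Q : M → ℝ, ContMDiff (𝓡 2) 𝓘(ℝ, ℝ) ∞ Q ∧ ∃ m > 0, ∃ c > 0, Q P = -m ∧ (∀ x, -m ≤ Q x) ∧
      ∀ γ, IsPsiMCF g ψ γ → ∀ t θ, 0 < t → Q (γ t θ) < 0 →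
        IsLocalMax (fun s => Q (γ t s)) θ → dT (fun q => Q (γ q.1 q.2)) (t, θ) ≤ -c := by
  set e := extChartAt (𝓡 2) P with he
  obtain ⟨r, hr, c, hc, -, hbar⟩ := (chartGeometry g hψ P).exists_barrier
    (y₀ := e P) (mem_extChartAt_target P)
  obtain ⟨χ⟩ : Nonempty (SmoothBumpFunction (𝓡 2) P) := inferInstance
  -- Within `ρ` of the centre the bump is 1 and the disc is a barrier. The function |y|² - ρ² is
  -- negative only there, so the cutoff is invisible where the function is negative.
  set ρ := min r χ.rIn with hρ
  have hρ0 : 0 < ρ := lt_min hr χ.rIn_pos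
  have hsm : ContMDiff (𝓡 2) 𝓘(ℝ, ℝ) ∞ (fun x => χ x • (‖e x - e P‖ ^ 2 - ρ ^ 2)) := by
    refine χ.contMDiff_smul ?_
    have h1 : ContDiff ℝ ∞ fun y : Plane => ‖y - e P‖ ^ 2 - ρ ^ 2 :=
      ((contDiff_id.sub contDiff_const).norm_sq ℝ).sub contDiff_const
    exact h1.contMDiff.comp_contMDiffOn contMDiffOn_extChartAt
  refine ⟨_, hsm, ρ ^ 2, by positivity, c, hc, ?_, fun x => ?_, ?_⟩
  · rw [χ.eq_one, he, sub_self]; simp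
  · have h1 : 0 ≤ χ x := χ.nonneg
    have h2 : χ x ≤ 1 := χ.le_one
    rw [smul_eq_mul]
    nlinarith [sq_nonneg ‖e x - e P‖, sq_nonneg ρ, mul_nonneg h1 (sq_nonneg ‖e x - e P‖),
      mul_nonneg (sub_nonneg.2 h2) (sq_nonneg ρ)]
  · intro γ hγ t θ ht hneg hmax
    have hpos : 0 < χ (γ t θ) := by
      refine lt_of_le_of_ne χ.nonneg fun h => ?_
      rw [← h, zero_smul] at hneg
      exact lt_irrefl _ hneg
    have hsrc : γ t θ ∈ (chartAt Plane P).source := by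
      by_contra h
      exact hpos.ne' (Function.notMem_support.1 fun h' => h (χ.support_subset_source h'))
    have hq : (t, θ) ∈ chartDomain γ P := ⟨ht, hsrc⟩
    have hlt : ‖e (γ t θ) - e P‖ < ρ := by
      rw [smul_eq_mul] at hneg
      have h1 := (mul_neg_iff.1 hneg).resolve_right fun h => lt_asymm h.1 hpos
      exact lt_of_pow_lt_pow_left₀ 2 hρ0.le (by linarith [h1.2])
    have hF := hγ.isFlow hψ P
    have hev : (fun q : ℝ × ℝ => χ (γ q.1 q.2) • (‖e (γ q.1 q.2) - e P‖ ^ 2 - ρ ^ 2)) =ᶠ[𝓝 (t, θ)]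
        fun q => ‖chartCoord γ P q - e P‖ ^ 2 - ρ ^ 2 := by
      have h1 : ContinuousAt (fun q => ‖chartCoord γ P q - e P‖) (t, θ) :=
        ((hF.differentiableAt hq hF.smooth).continuousAt.sub continuousAt_const).norm
      filter_upwards [h1.eventually (gt_mem_nhds hlt), hF.isOpen.mem_nhds hq] with q h2 h3
      have h4 : χ (γ q.1 q.2) = 1 := χ.one_of_dist_le h3.2 (by
        rw [dist_eq_norm]; exact (h2.le.trans (min_le_right _ _)))
      rw [h4, one_smul]; rfl
    rw [dT_congr hev]
    have hm := IsPsiMCF.isLocalMax_congr_time hev hmax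
    have h5 := hbar _ _ hF t θ hq (hlt.le.trans (min_le_left _ _))
      (by
        filter_upwards [hm] with s hs
        simpa using hs)
    have h6 : dT (fun q => ‖chartCoord γ P q - e P‖ ^ 2 - ρ ^ 2) (t, θ) =
        dT (fun q => ‖chartCoord γ P q - e P‖ ^ 2) (t, θ) := by
      rw [dT, dT, fderiv_sub_const]
    rw [h6]; exact h5

end Surface

end DensityFlow
end

/-! ### Lower bound for the length, decay of the curvature, derivative bounds -/

noncomputable section

namespace DensityFlow

section Slices

variable {f : ℝ × ℝ → ℝ} {t : ℝ}

theorem continuous_slice (hf : ContDiffOn ℝ ∞ f {q | 0 < q.1}) (ht : 0 < t) :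
    Continuous fun θ => f (t, θ) :=
  hf.continuousOn.comp_continuous (Continuous.prodMk_right t) fun _ => ht

theorem contDiff_slice (hf : ContDiffOn ℝ ∞ f {q | 0 < q.1}) (ht : 0 < t) :
    ContDiff ℝ ∞ fun θ => f (t, θ) := by
  have h := hf.comp (contDiff_prodMk_right (𝕜 := ℝ) (n := ∞) t).contDiffOn (s := univ)
    (fun _ _ => ht)
  exact contDiffOn_univ.1 h

theorem contDiffOn_dT (hf : ContDiffOn ℝ ∞ f {q | 0 < q.1}) :
    ContDiffOn ℝ ∞ (dT f) {q | 0 < q.1} := contDiffOn_fderiv_apply isOpen_pos_time hf _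

theorem contDiffOn_dX' (hf : ContDiffOn ℝ ∞ f {q | 0 < q.1}) :
    ContDiffOn ℝ ∞ (dX f) {q | 0 < q.1} := contDiffOn_fderiv_apply isOpen_pos_time hf _

theorem hasDerivAt_slice_time (hf : ContDiffOn ℝ ∞ f {q | 0 < q.1}) (ht : 0 < t) (θ : ℝ) :
    HasDerivAt (fun τ => f (τ, θ)) (dT f (t, θ)) t :=
  hasDerivAt_time (ContDiffOn.differentiableAt_of_isOpen hf isOpen_pos_time ht)

theorem hasDerivAt_slice_space (hf : ContDiffOn ℝ ∞ f {q | 0 < q.1}) (ht : 0 < t) (θ : ℝ) :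
    HasDerivAt (fun s => f (t, s)) (dX f (t, θ)) θ :=
  hasDerivAt_space (ContDiffOn.differentiableAt_of_isOpen hf isOpen_pos_time ht)

theorem hasDerivAt_integral_slice (hf : ContDiffOn ℝ ∞ f {q | 0 < q.1}) (ht : 0 < t) (a b : ℝ) :
    HasDerivAt (fun τ => ∫ θ in a..b, f (τ, θ)) (∫ θ in a..b, dT f (t, θ)) t := by
  have hK : IsCompact (Icc (t / 2) (2 * t) ×ˢ uIcc a b) := isCompact_Icc.prod isCompact_uIcc
  obtain ⟨C, hC⟩ := hK.exists_bound_of_continuousOn (f := dT f)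
    ((contDiffOn_dT hf).continuousOn.mono fun q hq => lt_of_lt_of_le (by linarith) hq.1.1)
  have hs : Icc (t / 2) (2 * t) ∈ 𝓝 t := Icc_mem_nhds (by linarith) (by linarith)
  refine (intervalIntegral.hasDerivAt_integral_of_dominated_loc_of_deriv_le
    (F := fun τ θ => f (τ, θ)) (F' := fun τ θ => dT f (τ, θ)) (bound := fun _ => C) hs ?_ ?_ ?_ ?_ ?_ ?_).2
  · filter_upwards [lt_mem_nhds ht] with τ hτ
    exact (continuous_slice hf hτ).aestronglyMeasurable
  · exact (continuous_slice hf ht).intervalIntegrable _ _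
  · exact (continuous_slice (contDiffOn_dT hf) ht).aestronglyMeasurable
  · exact Eventually.of_forall fun θ hθ τ hτ => hC (τ, θ) ⟨hτ, uIoc_subset_uIcc hθ⟩
  · exact intervalIntegrable_const
  · exact Eventually.of_forall fun θ _ τ hτ =>
      hasDerivAt_slice_time hf (lt_of_lt_of_le (by linarith) hτ.1) θ

theorem integral_dX_eq_sub (hf : ContDiffOn ℝ ∞ f {q | 0 < q.1}) (ht : 0 < t) (a b : ℝ) :
    ∫ θ in a..b, dX f (t, θ) = f (t, b) - f (t, a) :=
  intervalIntegral.integral_eq_sub_of_hasDerivAt (fun θ _ => hasDerivAt_slice_space hf ht θ)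
    ((continuous_slice (contDiffOn_dX' hf) ht).intervalIntegrable _ _)

theorem exists_bound_of_periodic {P : ℝ} (hP : 0 < P) (hf : ContDiffOn ℝ ∞ f {q | 0 < q.1})
    (hper : ∀ t > 0, Function.Periodic (fun θ => f (t, θ)) P) {a b : ℝ} (ha : 0 < a) :
    ∃ C, ∀ t ∈ Icc a b, ∀ θ, f (t, θ) ≤ C := by
  have hK : IsCompact (Icc a b ×ˢ Icc 0 P) := isCompact_Icc.prod isCompact_Icc
  obtain ⟨C, hC⟩ := hK.exists_bound_of_continuousOn (f := f)
    (hf.continuousOn.mono fun q hq => lt_of_lt_of_le ha hq.1.1)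
  refine ⟨C, fun t ht θ => ?_⟩
  obtain ⟨θ', hθ', h⟩ := (hper t (ha.trans_le ht.1)).exists_mem_Ico₀ hP θ
  change f (t, θ) = f (t, θ') at h
  rw [h]
  exact (le_abs_self _).trans (hC (t, θ') ⟨ht, Ico_subset_Icc_self hθ'⟩)

/-- The values of a function over an interval differ by at most the integral of a bound for its
derivative. -/
theorem abs_sub_le_integral (hf : ContDiffOn ℝ ∞ f {q | 0 < q.1}) (ht : 0 < t) {P : ℝ}
    {h : ℝ → ℝ} (hh : Continuous h) (hfh : ∀ θ, |dX f (t, θ)| ≤ h θ) {θ₁ θ₂ : ℝ}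
    (h₁ : θ₁ ∈ Icc 0 P) (h₂ : θ₂ ∈ Icc 0 P) :
    |f (t, θ₂) - f (t, θ₁)| ≤ ∫ θ in (0 : ℝ)..P, h θ := by
  wlog h12 : θ₁ ≤ θ₂ generalizing θ₁ θ₂
  · rw [abs_sub_comm]; exact this h₂ h₁ (le_of_not_ge h12)
  rw [← integral_dX_eq_sub hf ht]
  refine (intervalIntegral.abs_integral_le_integral_abs h12).trans ?_
  have hc := (continuous_slice (contDiffOn_dX' hf) ht).abs
  refine (intervalIntegral.integral_mono_on h12 (hc.intervalIntegrable _ _)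
    (hh.intervalIntegrable _ _) fun θ _ => hfh θ).trans ?_
  exact intervalIntegral.integral_mono_interval h₁.1 h12 h₂.2
    (Eventually.of_forall fun θ => (abs_nonneg _).trans (hfh θ)) (hh.intervalIntegrable _ _)

end Slices

/-- Decay of a quantity `A₀` for which the weight `μ` is the density of a decreasing length with
dissipation `A₀`. -/
theorem eventually_le_of_dissipation {P : ℝ} (hP : 0 < P) {A₀ A₁ μ F : ℝ × ℝ → ℝ} {C c L₀ : ℝ}
    (hA₀ : ContDiffOn ℝ ∞ A₀ {q | 0 < q.1}) (hA₁ : ContDiffOn ℝ ∞ A₁ {q | 0 < q.1})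
    (hμ : ContDiffOn ℝ ∞ μ {q | 0 < q.1}) (hF : ContDiffOn ℝ ∞ F {q | 0 < q.1})
    (hA₀per : ∀ t > 0, Function.Periodic (fun θ => A₀ (t, θ)) P)
    (hFper : ∀ t > 0, F (t, P) = F (t, 0))
    (hA₀nn : ∀ q, 0 ≤ A₀ q) (hA₁nn : ∀ q, 0 ≤ A₁ q) (hμpos : ∀ q : ℝ × ℝ, 0 < q.1 → 0 < μ q)
    (hC : 0 ≤ C) (hc : 0 ≤ c) (hL₀ : 0 < L₀) (hL : ∀ t > 0, L₀ ≤ ∫ θ in (0 : ℝ)..P, μ (t, θ))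
    (hdμ : ∀ q : ℝ × ℝ, 0 < q.1 → dT μ q = -A₀ q * μ q)
    (hdX : ∀ q : ℝ × ℝ, 0 < q.1 → |dX A₀ q| ≤ c * ((A₀ q + A₁ q) * μ q))
    (hdT : ∀ q : ℝ × ℝ, 0 < q.1 → dT (fun r => A₀ r * μ r) q ≤
      dX F q + μ q * (-2 * A₁ q + C * (A₀ q * (1 + A₀ q))))
    (hmax : ∀ q : ℝ × ℝ, 0 < q.1 → IsLocalMax (fun s => A₀ (q.1, s)) q.2 →
      dT A₀ q ≤ C * (A₀ q * (1 + A₀ q)))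
    {ε : ℝ} (hε : 0 < ε) : ∃ T, ∀ t ≥ T, ∀ θ, A₀ (t, θ) ≤ ε := by
  set L : ℝ → ℝ := fun t => ∫ θ in (0 : ℝ)..P, μ (t, θ)
  set Y : ℝ → ℝ := fun t => ∫ θ in (0 : ℝ)..P, A₀ (t, θ) * μ (t, θ) with hYdef
  set Z : ℝ → ℝ := fun t => ∫ θ in (0 : ℝ)..P, A₁ (t, θ) * μ (t, θ) with hZdef
  set Y' : ℝ → ℝ := fun t => ∫ θ in (0 : ℝ)..P, dT (fun r => A₀ r * μ r) (t, θ)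
  have hcA₀ := fun t (ht : 0 < t) => continuous_slice hA₀ ht
  have hcA₁ := fun t (ht : 0 < t) => continuous_slice hA₁ ht
  have hcμ := fun t (ht : 0 < t) => continuous_slice hμ ht
  have hcA₀μ : ∀ t > 0, Continuous fun θ => A₀ (t, θ) * μ (t, θ) := fun t ht =>
    (hcA₀ t ht).mul (hcμ t ht)
  have hcA₁μ : ∀ t > 0, Continuous fun θ => A₁ (t, θ) * μ (t, θ) := fun t ht =>
    (hcA₁ t ht).mul (hcμ t ht)
  have hLd : ∀ t > 0, HasDerivAt L (-Y t) t := fun t ht => by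
    have h := hasDerivAt_integral_slice hμ ht 0 P
    have h2 : ∫ θ in (0 : ℝ)..P, dT μ (t, θ) = -Y t := by
      rw [hYdef, ← intervalIntegral.integral_neg]
      exact intervalIntegral.integral_congr fun θ _ => by
        simp only [hdμ (t, θ) ht]; ring
    rwa [h2] at h
  have hYd : ∀ t > 0, HasDerivAt Y (Y' t) t := fun t ht =>
    hasDerivAt_integral_slice (hA₀.mul hμ) ht 0 P
  have hY0 : ∀ t > 0, 0 ≤ Y t := fun t ht => intervalIntegral.integral_nonneg hP.le fun θ _ =>
    mul_nonneg (hA₀nn _) (hμpos _ ht).le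
  have hZ0 : ∀ t > 0, 0 ≤ Z t := fun t ht => intervalIntegral.integral_nonneg hP.le fun θ _ =>
    mul_nonneg (hA₁nn _) (hμpos _ ht).le
  -- the pointwise bound by integrals
  have hsup : ∀ t > 0, ∀ θ, A₀ (t, θ) ≤ Y t / L₀ + c * (Y t + Z t) := by
    intro t ht θ
    obtain ⟨θ', hθ', h⟩ := (hA₀per t ht).exists_mem_Ico₀ hP θ
    change A₀ (t, θ) = A₀ (t, θ') at h
    rw [h]
    -- One-dimensional Sobolev bound: the minimum is at most the average `Y t / L₀`, and the
    -- oscillation is at most the integral of the derivative bound.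
    obtain ⟨θ₁, hθ₁, hmin⟩ := (isCompact_Icc (a := (0 : ℝ)) (b := P)).exists_isMinOn
      (nonempty_Icc.2 hP.le) (hcA₀ t ht).continuousOn
    have h1 : A₀ (t, θ₁) * L₀ ≤ Y t := by
      refine (mul_le_mul_of_nonneg_left (hL t ht) (hA₀nn _)).trans ?_
      rw [← intervalIntegral.integral_const_mul]
      refine intervalIntegral.integral_mono_on hP.le
        (((hcμ t ht).const_mul _).intervalIntegrable _ _)
        ((hcA₀μ t ht).intervalIntegrable _ _) fun s hs =>
        mul_le_mul_of_nonneg_right (hmin hs) (hμpos _ ht).le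
    have h2 := abs_sub_le_integral hA₀ ht
      (h := fun s => c * ((A₀ (t, s) + A₁ (t, s)) * μ (t, s)))
      ((((hcA₀ t ht).add (hcA₁ t ht)).mul (hcμ t ht)).const_mul c) (fun s => hdX (t, s) ht) hθ₁
      (Ico_subset_Icc_self hθ')
    have h3 : ∫ s in (0 : ℝ)..P, c * ((A₀ (t, s) + A₁ (t, s)) * μ (t, s)) = c * (Y t + Z t) := by
      rw [intervalIntegral.integral_const_mul]
      simp only [hYdef, hZdef]
      rw [← intervalIntegral.integral_add
        ((hcA₀μ t ht).intervalIntegrable _ _)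
        ((hcA₁μ t ht).intervalIntegrable _ _)]
      congr 1
      exact intervalIntegral.integral_congr fun s _ => by ring
    rw [h3] at h2
    have h4 := (le_abs_self _).trans h2
    have h5 : A₀ (t, θ₁) ≤ Y t / L₀ := (le_div_iff₀ hL₀).2 h1
    linarith
  -- the growth estimate
  have hYle : ∀ t > 0, Y' t ≤ -2 * Z t + C * Y t * (1 + (Y t / L₀ + c * (Y t + Z t))) := by
    intro t ht
    set m := Y t / L₀ + c * (Y t + Z t) with hm
    have hc2 : Continuous fun θ => -2 * (A₁ (t, θ) * μ (t, θ)) + C * (1 + m) * (A₀ (t, θ) * μ (t, θ)) :=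
      ((hcA₁μ t ht).const_mul _).add ((hcA₀μ t ht).const_mul _)
    have h1 : Y' t ≤ ∫ θ in (0 : ℝ)..P, (dX F (t, θ) +
        (-2 * (A₁ (t, θ) * μ (t, θ)) + C * (1 + m) * (A₀ (t, θ) * μ (t, θ)))) := by
      refine intervalIntegral.integral_mono_on hP.le
        ((continuous_slice (contDiffOn_dT (hA₀.mul hμ)) ht).intervalIntegrable _ _)
        (((continuous_slice (contDiffOn_dX' hF) ht).add hc2).intervalIntegrable _ _) fun θ _ => ?_
      refine (hdT (t, θ) ht).trans (add_le_add le_rfl ?_)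
      have h2 := hsup t ht θ
      have h3 : C * (A₀ (t, θ) * (1 + A₀ (t, θ))) ≤ C * (A₀ (t, θ) * (1 + m)) :=
        mul_le_mul_of_nonneg_left (mul_le_mul_of_nonneg_left (by linarith) (hA₀nn _)) hC
      have h4 := mul_le_mul_of_nonneg_left h3 (hμpos (t, θ) ht).le
      linarith
    rw [intervalIntegral.integral_add
      ((continuous_slice (contDiffOn_dX' hF) ht).intervalIntegrable _ _) (hc2.intervalIntegrable _ _),
      integral_dX_eq_sub hF ht, hFper t ht, sub_self, zero_add, intervalIntegral.integral_add
      (f := fun θ => -2 * (A₁ (t, θ) * μ (t, θ)))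
      (g := fun θ => C * (1 + m) * (A₀ (t, θ) * μ (t, θ)))
      (((hcA₁μ t ht).const_mul _).intervalIntegrable _ _)
      (((hcA₀μ t ht).const_mul _).intervalIntegrable _ _),
      intervalIntegral.integral_const_mul, intervalIntegral.integral_const_mul] at h1
    refine h1.trans (le_of_eq ?_)
    simp only [hYdef, hZdef]
    ring
  -- For `Y` below `η` the term `C * c * Y * Z` is at most `Z`, so one of the two copies of `-Z`
  -- survives, and the quadratic terms in `Y` become linear.
  set η : ℝ := min 1 (C * c + 1)⁻¹ with hη
  have hCc : 0 ≤ C * c := mul_nonneg hC hc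
  have hη0 : 0 < η := lt_min one_pos (by positivity)
  set C₁ : ℝ := C * (1 + (1 / L₀ + c)) with hC₁
  have hC₁0 : 0 ≤ C₁ := by positivity
  have hgrow : ∀ t > 0, Y t ≤ η → Y' t ≤ -Z t + C₁ * Y t := by
    intro t ht hYη
    refine (hYle t ht).trans ?_
    have h1 : Y t ≤ 1 := hYη.trans (min_le_left _ _)
    have h2 : C * c * Y t ≤ 1 := by
      have h3 : C * c * Y t ≤ C * c * (C * c + 1)⁻¹ :=
        mul_le_mul_of_nonneg_left (hYη.trans (min_le_right _ _)) hCc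
      refine h3.trans ?_
      rw [← div_eq_mul_inv, div_le_one (by positivity)]
      linarith
    have h3 := mul_le_mul_of_nonneg_right h2 (hZ0 t ht)
    have h4 : C * Y t * (Y t * (1 / L₀ + c)) ≤ C * Y t * (1 * (1 / L₀ + c)) := by
      have := hY0 t ht
      exact mul_le_mul_of_nonneg_left (mul_le_mul_of_nonneg_right h1 (by positivity)) (by positivity)
    have h5 : Y t / L₀ = Y t * (1 / L₀) := by ring
    rw [h5, hC₁]
    linarith
  have hYlim : Tendsto Y atTop (𝓝 0) := tendsto_zero_of_growth_le (C := C₁) hη0 hLd hYd hY0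
    (fun t ht => hL₀.le.trans (hL t ht)) fun t ht h => (hgrow t ht h).trans (by linarith [hZ0 t ht])
  set C₂ : ℝ := 1 / L₀ + c * (2 + C₁) + 1 with hC₂
  have hC₂0 : 0 < C₂ := by positivity
  set K : ℝ := 2 * C + 1 with hK
  -- Small enough that the initial bound `2 * C₂ * δ`, after growing at rate `K` for a unit of time,
  -- is still at most `min ε 1`.
  set δ : ℝ := min η (min ε 1 / (2 * C₂ * Real.exp K)) with hδ
  have hδ0 : 0 < δ := lt_min hη0 (by positivity)
  have hδε : 2 * C₂ * δ * Real.exp K ≤ min ε 1 := by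
    have h := (le_div_iff₀ (by positivity)).1 (min_le_right η (min ε 1 / (2 * C₂ * Real.exp K)))
    calc _ = δ * (2 * C₂ * Real.exp K) := by ring
      _ ≤ _ := h
  obtain ⟨T, hT⟩ := eventually_atTop.1 (hYlim.eventually (gt_mem_nhds hδ0))
  refine ⟨max T 1 + 1, fun t ht θ => ?_⟩
  have ht1 : T ≤ t - 1 := by linarith [le_max_left T 1]
  have ht2 : 1 ≤ t - 1 := by linarith [le_max_right T 1]
  -- Since `Y` is between 0 and `δ` at both ends of the unit interval, its slope is at least `-δ` at
  -- some `s`. The surviving `-Z` in the growth estimate then bounds `Z s`, and with it the supremum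
  -- of `A₀` at time `s`.
  obtain ⟨s, hs, hslope⟩ := exists_hasDerivAt_eq_slope Y Y' (show t - 1 < t by linarith)
    (fun s hs => (hYd s (by linarith [hs.1])).continuousAt.continuousWithinAt)
    (fun s hs => hYd s (by linarith [hs.1]))
  have hs0 : 0 < s := by linarith [hs.1]
  have hYs : Y s < δ := hT s (by linarith [hs.1])
  have hZs : Z s ≤ (1 + C₁) * δ := by
    have h1 := hgrow s hs0 (hYs.le.trans (min_le_left _ _))
    have h2 : -δ ≤ Y' s := by
      rw [hslope, sub_sub_cancel, div_one]
      linarith [hT (t - 1) ht1, hY0 t (by linarith)]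
    have h3 := mul_le_mul_of_nonneg_left hYs.le hC₁0
    linarith
  have hA₀s : ∀ θ, A₀ (s, θ) < 2 * C₂ * δ := fun θ => by
    refine (hsup s hs0 θ).trans_lt ?_
    have h1 : Y s / L₀ ≤ δ * (1 / L₀) := by
      rw [div_eq_mul_one_div]
      exact mul_le_mul_of_nonneg_right hYs.le (by positivity)
    have h2 : c * (Y s + Z s) ≤ c * (δ * (2 + C₁)) := mul_le_mul_of_nonneg_left (by linarith) hc
    have h3 : 0 < C₂ * δ := by positivity
    have h4 : δ * (1 / L₀) + c * (δ * (2 + C₁)) + δ = C₂ * δ := by rw [hC₂]; ring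
    linarith
  -- While `A₀` is at most 1 its maximum grows at rate at most `2 * C`, strictly less than `K`.
  have hbar := lt_barrier_of_isLocalMax (Q := fun t θ => A₀ (t, θ))
    (B := fun τ => 2 * C₂ * δ * Real.exp (K * (τ - s))) (t₀ := s) (t₁ := t) hP
    (hA₀.continuousOn.mono fun q hq => hs0.trans_le hq.1.1)
    (fun τ hτ => hA₀per τ (hs0.trans_le hτ.1)) (by fun_prop) (fun θ => by simpa using hA₀s θ)
    (fun τ hτ ϑ hQ hm => by
      have hτ0 : 0 < τ := hs0.trans hτ.1
      refine ⟨_, _, hasDerivAt_slice_time hA₀ hτ0 ϑ,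
        ((((hasDerivAt_id τ).sub_const s).const_mul K).exp.const_mul (2 * C₂ * δ)), ?_⟩
      refine (hmax (τ, ϑ) hτ0 hm).trans_lt ?_
      simp only [id] at hQ ⊢
      set b := 2 * C₂ * δ * Real.exp (K * (τ - s)) with hb
      have hb0 : 0 < b := by positivity
      have hb1 : b ≤ 1 := by
        refine le_trans ?_ (hδε.trans (min_le_right _ _))
        refine mul_le_mul_of_nonneg_left (Real.exp_le_exp.2 ?_) (by positivity)
        have : τ - s ≤ 1 := by linarith [hτ.2, hs.1]
        nlinarith
      have h1 : 2 * C₂ * δ * (Real.exp (K * (τ - s)) * (K * 1)) = b * K := by rw [hb]; ring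
      rw [hQ, h1]
      have h2 : C * (b * (1 + b)) ≤ C * (b * 2) :=
        mul_le_mul_of_nonneg_left (mul_le_mul_of_nonneg_left (by linarith) hb0.le) hC
      rw [hK]
      linarith) t ⟨hs.2.le, le_rfl⟩ θ
  refine hbar.le.trans (le_trans ?_ (hδε.trans (min_le_left _ _)))
  refine mul_le_mul_of_nonneg_left (Real.exp_le_exp.2 ?_) (by positivity)
  have : t - s ≤ 1 := by linarith [hs.1]
  nlinarith

section Surface

variable {M : Type*} [TopologicalSpace M] [ChartedSpace Plane M] {ψ : M → ℝ} {γ : ℝ → ℝ → M}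
  {U : Set M}

theorem exists_flowDensity_bounds (hψ : ContMDiff (𝓡 2) 𝓘(ℝ, ℝ) ∞ ψ) (hU : IsCompact U)
    (hγU : ∀ t, 0 ≤ t → ∀ θ, γ t θ ∈ U) :
    ∃ E > 0, ∃ D > 0, ∀ q : ℝ × ℝ, 0 < q.1 → E ≤ flowDensity ψ γ q ∧ flowDensity ψ γ q ≤ D := by
  obtain ⟨C, hC⟩ := hU.exists_bound_of_continuousOn hψ.continuous.continuousOn
  refine ⟨Real.exp (-C), Real.exp_pos _, Real.exp C, Real.exp_pos _, fun q hq => ?_⟩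
  have h := abs_le.1 (hC _ (hγU q.1 hq.le q.2))
  exact ⟨Real.exp_le_exp.2 h.1, Real.exp_le_exp.2 h.2⟩

variable [IsManifold (𝓡 2) ∞ M] {g : Metric M}

namespace IsPsiMCF

theorem flowDensity_periodic (hγ : IsPsiMCF g ψ γ) {t : ℝ} (ht : 0 < t) :
    Function.Periodic (fun θ => flowDensity ψ γ (t, θ)) (2 * Real.pi) := fun θ => by
  simp only [flowDensity]
  rw [(hγ.closed t ht.le).periodic θ]

theorem comp_periodic (hγ : IsPsiMCF g ψ γ) {t : ℝ} (ht : 0 < t) (f : M → ℝ) :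
    Function.Periodic (fun θ => f (γ t θ)) (2 * Real.pi) := fun θ => by
  simp only
  rw [(hγ.closed t ht.le).periodic θ]

theorem dX_eq (hγ : IsPsiMCF g ψ γ) (hψ : ContMDiff (𝓡 2) 𝓘(ℝ, ℝ) ∞ ψ) (f : ℝ × ℝ → ℝ) {q : ℝ × ℝ}
    (hq : 0 < q.1) : dX f q = flowSpeed g hψ γ q * arcDeriv g hψ γ f q := by
  rw [arcDeriv, mul_inv_cancel_left₀ (hγ.flowSpeed_pos hψ hq).ne']

/-- The weighted length of the curves of a flow in a compact set is bounded below. -/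
theorem exists_le_length [T2Space M] [FirstCountableTopology M] (hγ : IsPsiMCF g ψ γ)
    (hψ : ContMDiff (𝓡 2) 𝓘(ℝ, ℝ) ∞ ψ)
    (hU : IsCompact U) (hγU : ∀ t, 0 ≤ t → ∀ θ, γ t θ ∈ U) :
    ∃ L₀ > 0, ∀ t > 0, L₀ ≤ ∫ θ in (0 : ℝ)..(2 * Real.pi),
      flowDensity ψ γ (t, θ) * flowSpeed g hψ γ (t, θ) := by
  set μ : ℝ × ℝ → ℝ := fun q => flowDensity ψ γ q * flowSpeed g hψ γ q
  have hμ : ContDiffOn ℝ ∞ μ {q | 0 < q.1} :=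
    (hγ.contDiffOn_flowDensity hψ).mul (hγ.contDiffOn_flowSpeed hψ)
  have hπ : 0 < 2 * Real.pi := Real.two_pi_pos
  by_contra! hcon
  choose t ht0 ht using fun n : ℕ => hcon (1 / ((n : ℝ) + 1)) Nat.one_div_pos_of_nat
  have hlim : Tendsto (fun n => ∫ θ in (0 : ℝ)..(2 * Real.pi), μ (t n, θ)) atTop (𝓝 0) :=
    squeeze_zero (fun n => intervalIntegral.integral_nonneg hπ.le fun θ _ =>
      (mul_pos (Real.exp_pos _) (hγ.flowSpeed_pos hψ (ht0 n))).le) (fun n => (ht n).le)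
      tendsto_one_div_add_atTop_nhds_zero_nat
  -- The base points of ever shorter curves accumulate at a point `P` of `U`, around which the
  -- barrier is placed.
  obtain ⟨P, -, φ, hφ, hP⟩ := hU.isSeqCompact (x := fun n => γ (t n) 0) fun n =>
    hγU _ (ht0 n).le 0
  obtain ⟨Q, hQ, m, hm, c, hc, hQP, hQm, hbar⟩ := exists_barrier_function (ψ := ψ) g hψ P
  obtain ⟨C, hC, hCb⟩ := hγ.exists_abs_arcDeriv_le hψ hU hγU hQ
  obtain ⟨E, hE, D, hD, hED⟩ := exists_flowDensity_bounds hψ hU hγU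
  have hQγ := hγ.contDiffOn_comp hQ
  -- The oscillation of `Q` along a curve is controlled by its length, and the length by the
  -- weighted length.
  have hosc : ∀ n θ, |Q (γ (t n) θ) - Q (γ (t n) 0)| ≤
      C / E * ∫ θ in (0 : ℝ)..(2 * Real.pi), μ (t n, θ) := fun n θ => by
    obtain ⟨θ', hθ', h⟩ := (hγ.comp_periodic (ht0 n) Q).exists_mem_Ico₀ hπ θ
    change Q (γ (t n) θ) = Q (γ (t n) θ') at h
    rw [h, ← intervalIntegral.integral_const_mul]
    refine abs_sub_le_integral hQγ (ht0 n)
      ((continuous_slice hμ (ht0 n)).const_mul _) (fun s => ?_) ⟨le_rfl, hπ.le⟩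
      (Ico_subset_Icc_self hθ')
    rw [hγ.dX_eq hψ _ (ht0 n), abs_mul, abs_of_pos (hγ.flowSpeed_pos hψ (ht0 n))]
    have h1 := hCb (t n, s) (ht0 n)
    have h2 := hγ.flowSpeed_pos hψ (q := (t n, s)) (ht0 n)
    have h3 := (hED (t n, s) (ht0 n)).1
    have h4 : C ≤ C / E * flowDensity ψ γ (t n, s) := by
      rw [div_mul_eq_mul_div, le_div_iff₀ hE]
      exact mul_le_mul_of_nonneg_left h3 hC
    calc _ ≤ flowSpeed g hψ γ (t n, s) * (C / E * flowDensity ψ γ (t n, s)) :=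
          mul_le_mul_of_nonneg_left (h1.trans h4) h2.le
      _ = _ := by simp only [μ]; ring
  have hev1 : ∀ᶠ n in atTop, Q (γ (t (φ n)) 0) < -m + m / 4 := by
    have h1 := (hQ.continuous.tendsto P).comp hP
    rw [hQP] at h1
    exact h1.eventually (gt_mem_nhds (by linarith))
  have hev2 : ∀ᶠ n in atTop, C / E * (∫ θ in (0 : ℝ)..(2 * Real.pi), μ (t (φ n), θ)) < m / 4 := by
    have h1 := (hlim.comp hφ.tendsto_atTop).const_mul (C / E)
    rw [mul_zero] at h1
    exact h1.eventually (gt_mem_nhds (by linarith))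
  obtain ⟨n, hn1, hn2⟩ := (hev1.and hev2).exists
  set s := t (φ n)
  have hs0 : 0 < s := ht0 _
  have hinit : ∀ θ, Q (γ s θ) < -m / 2 := fun θ => by
    have := (le_abs_self _).trans (hosc (φ n) θ)
    linarith
  -- The barrier descends at rate `c / 2`, slower than the maximum of `Q`. Starting from `-m / 2` it
  -- reaches the minimum `-m` of `Q` after time `m / c`, so `Q` would fall strictly below its
  -- minimum.
  have hfin := lt_barrier_of_isLocalMax (Q := fun t θ => Q (γ t θ))
    (B := fun τ => -m / 2 - c / 2 * (τ - s)) (t₀ := s) (t₁ := s + m / c) hπ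
    (hQγ.continuousOn.mono fun q hq => hs0.trans_le hq.1.1)
    (fun τ hτ => hγ.comp_periodic (hs0.trans_le hτ.1) Q) (by fun_prop)
    (fun θ => by simpa using hinit θ)
    (fun τ hτ ϑ hQτ hmx => by
      have hτ0 : 0 < τ := hs0.trans hτ.1
      refine ⟨_, -(c / 2), hasDerivAt_slice_time hQγ hτ0 ϑ, ?_, ?_⟩
      · have h := (((hasDerivAt_id τ).sub_const s).const_mul (c / 2)).const_sub (-m / 2)
        simpa using h
      · refine (hbar γ hγ τ ϑ hτ0 ?_ hmx).trans_lt (by linarith)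
        have : 0 ≤ c / 2 * (τ - s) := mul_nonneg (by linarith) (by linarith [hτ.1])
        rw [hQτ]; linarith) (s + m / c) ⟨by linarith [div_pos hm hc], le_rfl⟩ 0
  have h1 := hQm (γ (s + m / c) 0)
  have h2 : c / 2 * (s + m / c - s) = m / 2 := by field_simp; ring
  rw [h2] at hfin
  linarith

/-- The curvature with density of a flow in a compact set tends to zero. -/
theorem exists_curvSq_zero_le [T2Space M] [FirstCountableTopology M] (hγ : IsPsiMCF g ψ γ)
    (hψ : ContMDiff (𝓡 2) 𝓘(ℝ, ℝ) ∞ ψ)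
    (hU : IsCompact U) (hγU : ∀ t, 0 ≤ t → ∀ θ, γ t θ ∈ U) {ε : ℝ} (hε : 0 < ε) :
    ∃ T, ∀ t ≥ T, ∀ θ, curvSq g hψ γ 0 (t, θ) ≤ ε := by
  obtain ⟨L₀, hL₀, hL⟩ := hγ.exists_le_length hψ hU hγU
  obtain ⟨E, hE, D, hD, hED⟩ := exists_flowDensity_bounds hψ hU hγU
  obtain ⟨C₁, hC₁, h1⟩ := hγ.exists_dT_energy_le hψ hU hγU
  obtain ⟨C₂, hC₂, h2⟩ := hγ.exists_dT_curvSq_le hψ hU hγU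
  have hA := hγ.contDiffOn_curvSq hψ
  have hw := hγ.contDiffOn_flowDensity hψ
  have hF := hw.mul (hγ.contDiffOn_arcDeriv hψ (hA 0))
  have hpos : ∀ q : ℝ × ℝ, 0 < q.1 → 0 < flowDensity ψ γ q * flowSpeed g hψ γ q := fun q hq =>
    mul_pos (Real.exp_pos _) (hγ.flowSpeed_pos hψ hq)
  have hmono : ∀ q, C₁ * (curvSq g hψ γ 0 q * (1 + curvSq g hψ γ 0 q)) ≤
      max C₁ C₂ * (curvSq g hψ γ 0 q * (1 + curvSq g hψ γ 0 q)) ∧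
      C₂ * (curvSq g hψ γ 0 q * (1 + curvSq g hψ γ 0 q)) ≤
      max C₁ C₂ * (curvSq g hψ γ 0 q * (1 + curvSq g hψ γ 0 q)) := fun q => by
    have h0 : 0 ≤ curvSq g hψ γ 0 q := curvSq_nonneg hψ 0
    exact ⟨mul_le_mul_of_nonneg_right (le_max_left _ _) (by positivity),
      mul_le_mul_of_nonneg_right (le_max_right _ _) (by positivity)⟩
  refine eventually_le_of_dissipation Real.two_pi_pos (hA 0) (hA 1)
    (hw.mul (hγ.contDiffOn_flowSpeed hψ)) hF (fun t ht => hγ.curvSq_periodic hψ ht 0) ?_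
    (fun q => curvSq_nonneg hψ 0) (fun q => curvSq_nonneg hψ 1) hpos (le_max_of_le_left hC₁)
    (inv_nonneg.2 hE.le) hL₀ hL (fun q hq => hγ.dT_flowDensity_mul_speed hψ hq) ?_
    (fun q hq => (h1 q hq).trans (add_le_add le_rfl (mul_le_mul_of_nonneg_left
      (add_le_add le_rfl (hmono q).1) (hpos q hq).le)))
    (fun q hq hm => (h2 q hq hm).trans (hmono q).2) hε
  · intro t ht
    have h3 : dX (curvSq g hψ γ 0) (t, 2 * Real.pi) = dX (curvSq g hψ γ 0) (t, 0) := by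
      rw [← (hasDerivAt_slice_space (hA 0) ht _).deriv, ← (hasDerivAt_slice_space (hA 0) ht _).deriv]
      have h4 := (hγ.curvSq_periodic hψ ht 0)
      have h5 : (fun s => curvSq g hψ γ 0 (t, s + 2 * Real.pi)) = fun s => curvSq g hψ γ 0 (t, s) :=
        funext h4
      have h6 := deriv_comp_add_const (fun s => curvSq g hψ γ 0 (t, s)) (2 * Real.pi) 0
      rw [h5, zero_add] at h6
      exact h6.symm
    have h4 := hγ.flowSpeed_periodic hψ ht 0
    have h5 := hγ.flowDensity_periodic ht 0
    simp only [zero_add] at h4 h5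
    simp only [arcDeriv, h3, h4, h5]
  · intro q hq
    rw [hγ.dX_eq hψ _ hq, abs_mul, abs_of_pos (hγ.flowSpeed_pos hψ hq)]
    have h3 := hγ.sq_arcDeriv_curvSq hψ hq 0
    -- |2 κ κ_s| ≤ κ² + κ_s². Passing from v to e^ψ v then costs the factor `E⁻¹`, the constant `c`
    -- of the dissipation lemma.
    have h4 : |arcDeriv g hψ γ (curvSq g hψ γ 0) q| ≤ curvSq g hψ γ 0 q + curvSq g hψ γ 1 q := by
      refine abs_le_of_sq_le_sq ?_ (add_nonneg (curvSq_nonneg hψ 0) (curvSq_nonneg hψ 1))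
      rw [h3]
      nlinarith [sq_nonneg (curvSq g hψ γ 0 q - curvSq g hψ γ 1 q)]
    have h5 : 1 ≤ E⁻¹ * flowDensity ψ γ q := by
      rw [inv_mul_eq_div, one_le_div hE]; exact (hED q hq).1
    have h6 := hγ.flowSpeed_pos hψ hq
    have h7 : 0 ≤ (curvSq g hψ γ 0 q + curvSq g hψ γ 1 q) * flowSpeed g hψ γ q :=
      mul_nonneg ((abs_nonneg _).trans h4) h6.le
    calc _ ≤ flowSpeed g hψ γ q * (curvSq g hψ γ 0 q + curvSq g hψ γ 1 q) :=
          mul_le_mul_of_nonneg_left h4 h6.le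
      _ = 1 * ((curvSq g hψ γ 0 q + curvSq g hψ γ 1 q) * flowSpeed g hψ γ q) := by ring
      _ ≤ E⁻¹ * flowDensity ψ γ q * ((curvSq g hψ γ 0 q + curvSq g hψ γ 1 q) * flowSpeed g hψ γ q) :=
          mul_le_mul_of_nonneg_right h5 h7
      _ = _ := by ring

/-- All arc length derivatives of the curvature with density of a flow in a compact set are bounded
for times bounded away from zero. -/
theorem exists_curvSq_le [T2Space M] [FirstCountableTopology M] (hγ : IsPsiMCF g ψ γ)
    (hψ : ContMDiff (𝓡 2) 𝓘(ℝ, ℝ) ∞ ψ)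
    (hU : IsCompact U) (hγU : ∀ t, 0 ≤ t → ∀ θ, γ t θ ∈ U) (j : ℕ) :
    ∃ B, 0 ≤ B ∧ ∀ i ≤ j, ∀ t ≥ 1, ∀ θ, curvSq g hψ γ i (t, θ) ≤ B ^ 2 := by
  have hA := hγ.contDiffOn_curvSq hψ
  have hper := fun j t (ht : 0 < t) => hγ.curvSq_periodic hψ ht j
  induction j with
  | zero =>
    -- Beyond `T` the decay of the curvature gives the bound, and on [1, T] compactness does.
    obtain ⟨T, hT⟩ := hγ.exists_curvSq_zero_le hψ hU hγU one_pos
    obtain ⟨C, hC⟩ := exists_bound_of_periodic Real.two_pi_pos (hA 0) (hper 0) (a := 1) (b := T)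
      one_pos
    refine ⟨max 1 C, by positivity, fun i hi t ht θ => ?_⟩
    obtain rfl : i = 0 := Nat.le_zero.1 hi
    have h1 : (1 : ℝ) ≤ max 1 C := le_max_left _ _
    have h2 : max 1 C ≤ max 1 C ^ 2 := by nlinarith
    refine le_trans ?_ h2
    rcases le_total T t with h | h
    · exact (hT t h θ).trans (le_max_left _ _)
    · exact (hC t ⟨ht, h⟩ θ).trans (le_max_right _ _)
  | succ j ih =>
    obtain ⟨B, hB, hBj⟩ := ih
    obtain ⟨C, hC, hCb⟩ := hγ.exists_dT_curvSq_succ_le hψ hU hγU hB j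
    -- Makes the coefficient `3 * C - 2 * lam` of κ_{j+1}² equal to -1.
    set lam : ℝ := (3 * C + 1) / 2 with hlam
    have hlam0 : 0 ≤ lam := by positivity
    have hQ : ContDiffOn ℝ ∞ (fun r => curvSq g hψ γ (j + 1) r + lam * curvSq g hψ γ j r)
        {q | 0 < q.1} := (hA (j + 1)).add (contDiffOn_const.mul (hA j))
    have hQper : ∀ t > 0, Function.Periodic
        (fun θ => curvSq g hψ γ (j + 1) (t, θ) + lam * curvSq g hψ γ j (t, θ)) (2 * Real.pi) :=
      fun t ht θ => by
        have h1 := hper (j + 1) t ht θ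
        have h2 := hper j t ht θ
        simp only at h1 h2 ⊢
        rw [h1, h2]
    obtain ⟨b₀, hb₀⟩ := exists_bound_of_periodic Real.two_pi_pos hQ hQper (a := 1) (b := 1) one_pos
    -- Exceeds the values at time 1 and also the level at which the time derivative becomes
    -- negative: where the quantity equals `b`, κ_{j+1}² is at least `b - lam * B ^ 2`.
    set b : ℝ := max b₀ (C + 2 * lam * B * C + lam * B ^ 2) + 1 with hb
    have key : ∀ t ≥ 1, ∀ θ, curvSq g hψ γ (j + 1) (t, θ) ≤ b := by
      intro t ht θ
      have h := lt_barrier_of_isLocalMax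
        (Q := fun t θ => curvSq g hψ γ (j + 1) (t, θ) + lam * curvSq g hψ γ j (t, θ))
        (B := fun _ => b) (t₀ := 1) (t₁ := t) Real.two_pi_pos
        (hQ.continuousOn.mono fun q hq => one_pos.trans_le hq.1.1)
        (fun τ hτ => hQper τ (one_pos.trans_le hτ.1)) continuousOn_const
        (fun θ => by
          have := hb₀ 1 ⟨le_rfl, le_rfl⟩ θ
          have h2 := le_max_left b₀ (C + 2 * lam * B * C + lam * B ^ 2)
          linarith)
        (fun τ hτ ϑ hQτ hm => by
          have hτ0 : 0 < τ := one_pos.trans hτ.1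
          refine ⟨_, 0, hasDerivAt_slice_time hQ hτ0 ϑ, hasDerivAt_const _ _, ?_⟩
          refine (hCb (τ, ϑ) hτ0 lam hlam0 (fun i hi => hBj i hi τ hτ.1.le ϑ) hm).trans_lt ?_
          have h1 := mul_le_mul_of_nonneg_left (hBj j le_rfl τ hτ.1.le ϑ) hlam0
          have h2 := le_max_right b₀ (C + 2 * lam * B * C + lam * B ^ 2)
          have h3 : 3 * C - 2 * lam = -1 := by rw [hlam]; ring
          rw [h3]
          linarith) t ⟨ht, le_rfl⟩ θ
      have h2 : 0 ≤ lam * curvSq g hψ γ j (t, θ) := mul_nonneg hlam0 (curvSq_nonneg hψ j)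
      linarith
    refine ⟨max B (max b 1), le_max_of_le_left hB, fun i hi t ht θ => ?_⟩
    rcases Nat.le_succ_iff.1 hi with h | rfl
    · exact (hBj i h t ht θ).trans (pow_le_pow_left₀ hB (le_max_left _ _) 2)
    · have h1 : b ≤ max B (max b 1) := (le_max_left _ _).trans (le_max_right _ _)
      have h2 : 1 ≤ max B (max b 1) := (le_max_right _ _).trans (le_max_right _ _)
      nlinarith [key t ht θ]

end IsPsiMCF

end Surface

end DensityFlow
end

/-! ### Reparametrizations -/

noncomputable section

namespace DensityFlow

/-- The reparametrization that makes a positive periodic speed `v` constant. -/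
theorem exists_constant_speed {v : ℝ → ℝ} {P : ℝ} (hP : 0 < P) (hv : ContDiff ℝ ∞ v)
    (hpos : ∀ θ, 0 < v θ) (hper : Function.Periodic v P) :
    ∃ φ : ℝ → ℝ, ContDiff ℝ ∞ φ ∧ (∀ u, φ (u + P) = φ u + P) ∧
      ∀ u, HasDerivAt φ (((∫ θ in (0 : ℝ)..P, v θ) / P) / v (φ u)) u := by
  set ℓ : ℝ := (∫ θ in (0 : ℝ)..P, v θ) / P with hℓ
  have hint : ∀ a b, IntervalIntegrable v volume a b := fun a b => hv.continuous.intervalIntegrable a b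
  have hℓ0 : 0 < ℓ := div_pos (intervalIntegral.intervalIntegral_pos_of_pos (hint _ _) hpos hP) hP
  -- Arc length normalized so that a full turn has length `P`; the reparametrization is its inverse.
  set σ : ℝ → ℝ := fun θ => (∫ s in (0 : ℝ)..θ, v s) / ℓ with hσ
  have hσd : ∀ θ, HasDerivAt σ (v θ / ℓ) θ := fun θ =>
    (intervalIntegral.integral_hasDerivAt_right (hint _ _)
      hv.continuous.aestronglyMeasurable.stronglyMeasurableAtFilter hv.continuous.continuousAt).div_const ℓ
  have hσmono : StrictMono σ := strictMono_of_deriv_pos fun θ => by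
    rw [(hσd θ).deriv]; exact div_pos (hpos θ) hℓ0
  have hσsm : ContDiff ℝ ∞ σ := by
    rw [contDiff_infty_iff_deriv]
    refine ⟨fun θ => (hσd θ).differentiableAt, ?_⟩
    rw [funext fun θ => (hσd θ).deriv]
    exact hv.div_const ℓ
  have hσadd : ∀ θ, σ (θ + P) = σ θ + P := fun θ => by
    have h1 := intervalIntegral.integral_add_adjacent_intervals (hint 0 θ) (hint θ (θ + P))
    have h2 := hper.intervalIntegral_add_eq θ 0
    rw [zero_add] at h2
    have h3 : (∫ s in (0 : ℝ)..P, v s) / ℓ = P := by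
      rw [div_eq_iff hℓ0.ne', hℓ]; field_simp
    simp only [hσ]
    rw [← h1, h2, add_div, h3]
  have hσ0 : σ 0 = 0 := by simp [hσ]
  have hσnat : ∀ n : ℕ, σ (n * P) = n * P ∧ σ (-(n * P)) = -(n * P) := fun n => by
    induction n with
    | zero => simp [hσ0]
    | succ n ih =>
      have h1 := hσadd (n * P)
      have h2 := hσadd (-((n + 1 : ℕ) * P))
      have e1 : (n : ℝ) * P + P = (n + 1 : ℕ) * P := by push_cast; ring
      have e2 : -(((n + 1 : ℕ) : ℝ) * P) + P = -(n * P) := by push_cast; ring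
      rw [e1, ih.1, e1] at h1
      rw [e2, ih.2] at h2
      exact ⟨h1, by linarith⟩
  have hσsurj : Function.Surjective σ := fun y => by
    obtain ⟨n, hn⟩ := exists_nat_ge (|y| / P)
    have hn' : |y| ≤ n * P := (div_le_iff₀ hP).1 hn
    have hab := abs_le.1 hn'
    have := intermediate_value_Icc (f := σ) (a := -(n * P)) (b := n * P)
      (by linarith) hσsm.continuous.continuousOn
    rw [(hσnat n).1, (hσnat n).2] at this
    obtain ⟨x, -, hx⟩ := this hab
    exact ⟨x, hx⟩
  set e : ℝ ≃ₜ ℝ := (hσmono.orderIsoOfSurjective σ hσsurj).toHomeomorph with he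
  have hes : ∀ u, σ (e.symm u) = u := fun u => e.apply_symm_apply u
  have hsm : ContDiff ℝ ∞ e.symm := e.contDiff_symm_deriv (f' := fun θ => v θ / ℓ)
    (fun θ => (div_pos (hpos θ) hℓ0).ne') hσd hσsm
  refine ⟨e.symm, hsm, fun u => ?_, fun u => ?_⟩
  · apply hσmono.injective
    rw [hes, hσadd, hes]
  · have h1 := HasDerivAt.of_local_left_inverse hsm.continuous.continuousAt (hσd (e.symm u))
      (div_pos (hpos _) hℓ0).ne' (Eventually.of_forall hes)
    rwa [inv_div] at h1

/-- A sequence of reparametrizations is interpolated by a smooth family. -/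
theorem exists_isReparametrization {Φ : ℕ → ℝ → ℝ} (hΦ : ∀ n, ContDiff ℝ ∞ (Φ n))
    (hadd : ∀ n u, Φ n (u + 2 * Real.pi) = Φ n u + 2 * Real.pi) (hpos : ∀ n u, 0 < deriv (Φ n) u) :
    ∃ φ : ℝ → ℝ → ℝ, IsReparametrization φ ∧ ∀ n : ℕ, φ n = Φ n := by
  -- The outer radius 1/3 is less than 1/2, so the family is the identity near half-integer times,
  -- where `round` jumps.
  let χ : ContDiffBump (0 : ℝ) := ⟨1 / 6, 1 / 3, by norm_num, by norm_num⟩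
  have hχ0 : ∀ x : ℝ, 1 / 3 ≤ |x| → χ x = 0 := fun x hx => χ.zero_of_le_dist (by
    rw [Real.dist_eq, sub_zero]; exact hx)
  set φ : ℝ → ℝ → ℝ := fun t u =>
    u + χ (t - round t) * (Φ (round t).toNat u - u) with hφ
  refine ⟨φ, ⟨?_, fun t _ u => ?_, fun t _ u => ?_⟩, fun n => ?_⟩
  · refine ContDiff.contDiffOn (contDiff_iff_contDiffAt.2 fun q => ?_)
    obtain ⟨t₀, u₀⟩ := q
    set n := round t₀ with hn
    have hloc : (fun q : ℝ × ℝ => φ q.1 q.2) =ᶠ[𝓝 (t₀, u₀)]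
        fun q => q.2 + χ (q.1 - n) * (Φ n.toNat q.2 - q.2) := by
      have h1 : ∀ᶠ q : ℝ × ℝ in 𝓝 (t₀, u₀), |q.1 - t₀| < 1 / 6 := by
        have : ContinuousAt (fun q : ℝ × ℝ => |q.1 - t₀|) (t₀, u₀) := by fun_prop
        exact this.eventually (gt_mem_nhds (by simp))
      filter_upwards [h1] with q hq
      rcases eq_or_ne (round q.1) n with h | h
      · simp only [hφ, h]
      · have h2 : (1 : ℝ) ≤ |(round q.1 : ℝ) - n| := by
          have : (1 : ℤ) ≤ |round q.1 - n| := Int.one_le_abs (sub_ne_zero.2 h)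
          exact_mod_cast this
        have h3 := abs_sub_round q.1
        have h4 := abs_sub_round t₀
        rw [← hn] at h4
        have e1 : χ (q.1 - round q.1) = 0 := hχ0 _ (by
          have := abs_add_three ((round q.1 : ℝ) - q.1) (q.1 - t₀) (t₀ - n)
          rw [show (round q.1 : ℝ) - q.1 + (q.1 - t₀) + (t₀ - n) = round q.1 - n by ring,
            abs_sub_comm (round q.1 : ℝ) q.1] at this
          linarith)
        have e2 : χ (q.1 - n) = 0 := hχ0 _ (by
          have := abs_add_le ((round q.1 : ℝ) - q.1) (q.1 - n)
          rw [show (round q.1 : ℝ) - q.1 + (q.1 - n) = round q.1 - n by ring,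
            abs_sub_comm (round q.1 : ℝ) q.1] at this
          linarith)
        simp only [hφ, e1, e2, zero_mul]
    refine ContDiffAt.congr_of_eventuallyEq (ContDiff.contDiffAt ?_) hloc
    have h1 : ContDiff ℝ ∞ fun q : ℝ × ℝ => χ (q.1 - n) := χ.contDiff.comp (contDiff_fst.sub contDiff_const)
    exact contDiff_snd.add (h1.mul (((hΦ _).comp contDiff_snd).sub contDiff_snd))
  · simp only [hφ, hadd]; ring
  -- The derivative is a convex combination of 1 and a positive number.
  · have h1 : HasDerivAt (φ t) (1 + χ (t - round t) * (deriv (Φ (round t).toNat) u - 1)) u :=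
      (hasDerivAt_id u).add (((((hΦ _).differentiable (by simp)) u).hasDerivAt.sub
        (hasDerivAt_id u)).const_mul _)
    rw [h1.deriv]
    have h2 : 0 ≤ χ (t - round t) := χ.nonneg
    have h3 : χ (t - round t) ≤ 1 := χ.le_one
    rcases h2.eq_or_lt with h | h
    · rw [← h]; norm_num
    · nlinarith [mul_pos h (hpos (round t).toNat u)]
  · funext u
    have h1 : χ (0 : ℝ) = 1 := χ.one_of_mem_closedBall (by simp; norm_num [χ])
    simp [hφ, h1]

end DensityFlow
end

/-! ### Compactness of sequences of curves -/

noncomputable section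

namespace DensityFlow

theorem iteratedDeriv_clm_comp {E F : Type*} [NormedAddCommGroup E] [NormedSpace ℝ E]
    [NormedAddCommGroup F] [NormedSpace ℝ F] (L : E →L[ℝ] F) {h : ℝ → E} (hh : ContDiff ℝ ∞ h)
    (i : ℕ) : iteratedDeriv i (fun s => L (h s)) = fun s => L (iteratedDeriv i h s) := by
  induction i with
  | zero => simp
  | succ i ih =>
    rw [iteratedDeriv_succ, ih]
    funext s
    rw [iteratedDeriv_succ]
    exact (L.hasFDerivAt.comp_hasDerivAt s
      ((hh.differentiable_iteratedDeriv i (by exact_mod_cast WithTop.coe_lt_top _)) s).hasDerivAt).deriv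

/-- The coordinates of the plane. -/
def coordCLM (i : Fin 2) : Plane →L[ℝ] ℝ := EuclideanSpace.proj i

theorem norm_plane_le (w : Plane) : ‖w‖ ≤ |w 0| + |w 1| := by
  rw [EuclideanSpace.norm_eq, Fin.sum_univ_two]
  refine Real.sqrt_le_iff.2 ⟨by positivity, ?_⟩
  simp only [Real.norm_eq_abs]
  nlinarith [abs_nonneg (w 0), abs_nonneg (w 1)]

section Surface

variable {M : Type*} [TopologicalSpace M] [ChartedSpace Plane M] [IsManifold (𝓡 2) ∞ M]
  [T2Space M]

/-- The coordinates of a chart extend from a neighbourhood of the base point to the surface. -/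
theorem exists_chart_extension (p : M) : ∃ (H : M → Plane) (N : Set M),
    ContMDiff (𝓡 2) 𝓘(ℝ, Plane) ∞ H ∧ IsOpen N ∧ p ∈ N ∧ N ⊆ (chartAt Plane p).source ∧
      EqOn H (extChartAt (𝓡 2) p) N := by
  obtain ⟨χ⟩ : Nonempty (SmoothBumpFunction (𝓡 2) p) := inferInstance
  refine ⟨fun x => χ x • extChartAt (𝓡 2) p x,
    (chartAt Plane p).source ∩ extChartAt (𝓡 2) p ⁻¹' Metric.ball (extChartAt (𝓡 2) p p) χ.rIn,
    χ.contMDiff_smul contMDiffOn_extChartAt, ?_,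
    ⟨mem_chart_source Plane p, Metric.mem_ball_self χ.rIn_pos⟩, inter_subset_left, fun x hx => ?_⟩
  · have h := (continuousOn_extChartAt (I := 𝓡 2) p)
    rw [extChartAt_source] at h
    exact h.isOpen_inter_preimage (chartAt Plane p).open_source Metric.isOpen_ball
  · simp only
    rw [χ.one_of_dist_le hx.1 (le_of_lt hx.2), one_smul]

theorem exists_bump {p : M} {N : Set M} (hN : N ∈ 𝓝 p) : ∃ f : M → ℝ,
    ContMDiff (𝓡 2) 𝓘(ℝ, ℝ) ∞ f ∧ f p = 1 ∧ ∀ x, f x ≠ 0 → x ∈ N := by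
  obtain ⟨χ, -, hχ⟩ := (SmoothBumpFunction.nhds_basis_tsupport (I := 𝓡 2) p).mem_iff.1 hN
  exact ⟨χ, χ.contMDiff, χ.eq_one, fun x hx => hχ (subset_tsupport _ hx)⟩

/-- Bump functions detect continuity, and global extensions of the coordinates then detect
smoothness. The curve need not be known to be continuous beforehand. -/
theorem contMDiff_of_comp {c : ℝ → M}
    (h : ∀ f : M → ℝ, ContMDiff (𝓡 2) 𝓘(ℝ, ℝ) ∞ f → ContDiff ℝ ∞ fun u => f (c u)) :
    ContMDiff 𝓘(ℝ, ℝ) (𝓡 2) ∞ c := by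
  intro u
  have hcont : ContinuousAt c u := by
    rw [ContinuousAt, tendsto_nhds]
    intro N hN hu
    obtain ⟨f, hf, hf1, hfN⟩ := exists_bump (hN.mem_nhds hu)
    have h1 : ∀ᶠ s in 𝓝 u, 0 < f (c s) :=
      (h f hf).continuous.continuousAt.eventually (lt_mem_nhds (by simp only [hf1]; exact one_pos))
    filter_upwards [h1] with s hs using hfN _ hs.ne'
  rw [contMDiffAt_iff_target]
  refine ⟨hcont, ?_⟩
  obtain ⟨H, N, hH, hN, hpN, -, hHN⟩ := exists_chart_extension (c u)
  have h1 : ContDiff ℝ ∞ fun s => H (c s) := contDiff_euclidean.2 fun i =>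
    h _ ((coordCLM i).contMDiff.comp hH)
  refine (h1.contDiffAt.contMDiffAt).congr_of_eventuallyEq ?_
  filter_upwards [hcont (hN.mem_nhds hpN)] with s hs using (hHN hs).symm

/-- A sequence of curves in a compact set has a smoothly converging subsequence if, for every smooth
function, the derivatives of its restrictions to the curves are uniformly bounded. -/
theorem exists_limit_curve [FirstCountableTopology M] {U : Set M} (hU : IsCompact U) {c : ℕ → ℝ → M}
    (hcU : ∀ k u, c k u ∈ U) (hc : ∀ k, ContMDiff 𝓘(ℝ, ℝ) (𝓡 2) ∞ (c k))
    (hb : ∀ f : M → ℝ, ContMDiff (𝓡 2) 𝓘(ℝ, ℝ) ∞ f → ∀ j, ∃ C, ∀ k u,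
      |iteratedDeriv j (fun s => f (c k s)) u| ≤ C) :
    ∃ (ν : ℕ → ℕ) (c' : ℝ → M), StrictMono ν ∧ ContMDiff 𝓘(ℝ, ℝ) (𝓡 2) ∞ c' ∧
      (∀ u, Tendsto (fun k => c (ν k) u) atTop (𝓝 (c' u))) ∧
      ∀ f : M → ℝ, ContMDiff (𝓡 2) 𝓘(ℝ, ℝ) ∞ f → ∀ j, TendstoLocallyUniformly
        (fun k => iteratedDeriv j fun s => f (c (ν k) s)) (iteratedDeriv j fun s => f (c' s)) atTop := by
  -- Diagonal extraction: a countable power of `U` is sequentially compact, so a subsequence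
  -- converges at all rational parameters.
  obtain ⟨P, -, ν, hν, hP⟩ := (isCompact_univ_pi fun _ : ℚ => hU).isSeqCompact
    (x := fun k (r : ℚ) => c k r) fun k r _ => hcU k r
  rw [tendsto_pi_nhds] at hP
  have hlim : ∀ f : M → ℝ, ContMDiff (𝓡 2) 𝓘(ℝ, ℝ) ∞ f → ∃ F : ℝ → ℝ, ContDiff ℝ ∞ F ∧
      ∀ j, TendstoLocallyUniformly (fun k => iteratedDeriv j fun s => f (c (ν k) s))
        (iteratedDeriv j F) atTop := fun f hf => by
    choose C hC using hb f hf
    refine exists_smooth_limit (S := range ((↑) : ℚ → ℝ)) Rat.denseRange_cast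
      (fun k => (hf.comp (hc (ν k))).contDiff) (C := C) (fun j k u => hC j (ν k) u) ?_
    rintro _ ⟨r, rfl⟩
    exact ⟨_, (hf.continuous.tendsto _).comp (hP r)⟩
  choose! F hF hFlim using hlim
  have hpt : ∀ f : M → ℝ, ContMDiff (𝓡 2) 𝓘(ℝ, ℝ) ∞ f → ∀ u,
      Tendsto (fun k => f (c (ν k) u)) atTop (𝓝 (F f u)) := fun f hf u => by
    have h := (hFlim f hf 0)
    simp only [iteratedDeriv_zero] at h
    exact (tendstoLocallyUniformlyOn_univ.2 h).tendsto_at (mem_univ u)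
  -- The value at `u` is a cluster point found along a subsequence that depends on `u`. Every smooth
  -- function takes the right limit there, so these choices fit together, and bump functions upgrade
  -- this to convergence of the sequence itself.
  choose c' _ μ hμ hc' using fun u => hU.isSeqCompact (x := fun k => c (ν k) u) fun k => hcU _ u
  have hFc : ∀ f : M → ℝ, ContMDiff (𝓡 2) 𝓘(ℝ, ℝ) ∞ f → F f = fun u => f (c' u) := fun f hf => by
    funext u
    exact tendsto_nhds_unique ((hpt f hf u).comp (hμ u).tendsto_atTop)
      ((hf.continuous.tendsto _).comp (hc' u))
  refine ⟨ν, c', hν, contMDiff_of_comp fun f hf => ?_, fun u => ?_, fun f hf j => ?_⟩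
  · rw [← hFc f hf]; exact hF f hf
  · rw [tendsto_nhds]
    intro N hN hu
    obtain ⟨f, hf, hf1, hfN⟩ := exists_bump (hN.mem_nhds hu)
    have h1 := hpt f hf u
    simp only [hFc f hf, hf1] at h1
    filter_upwards [h1.eventually (lt_mem_nhds one_pos)] with k hk using hfN _ hk.ne'
  · rw [← hFc f hf]; exact hFlim f hf j

/-- Convergence of the restrictions of all smooth functions implies convergence in charts. -/
theorem tendstoUniformlyOn_chart {c : ℕ → ℝ → M} {c' : ℝ → M}
    (hc : ∀ k, ContMDiff 𝓘(ℝ, ℝ) (𝓡 2) ∞ (c k)) (hc' : ContMDiff 𝓘(ℝ, ℝ) (𝓡 2) ∞ c')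
    (hlim : ∀ f : M → ℝ, ContMDiff (𝓡 2) 𝓘(ℝ, ℝ) ∞ f → ∀ j, TendstoLocallyUniformly
        (fun k => iteratedDeriv j fun s => f (c k s)) (iteratedDeriv j fun s => f (c' s)) atTop)
    (θ₀ : ℝ) : ∃ δ > 0,
    (∀ θ ∈ Icc (θ₀ - δ) (θ₀ + δ), c' θ ∈ (chartAt Plane (c' θ₀)).source) ∧
    (∀ᶠ n in atTop, ∀ θ ∈ Icc (θ₀ - δ) (θ₀ + δ), c n θ ∈ (chartAt Plane (c' θ₀)).source) ∧
    ∀ i, TendstoUniformlyOn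
      (fun n => iteratedDeriv i fun s => extChartAt (𝓡 2) (c' θ₀) (c n s))
      (iteratedDeriv i fun s => extChartAt (𝓡 2) (c' θ₀) (c' s)) atTop
      (Icc (θ₀ - δ) (θ₀ + δ)) := by
  obtain ⟨H, N, hH, hN, hpN, hNs, hHN⟩ := exists_chart_extension (c' θ₀)
  obtain ⟨f, hf, hf1, hfN⟩ := exists_bump (hN.mem_nhds hpN)
  have h1 : ∀ᶠ θ in 𝓝 θ₀, 1 / 2 < f (c' θ) :=
    (hf.continuous.comp hc'.continuous).continuousAt.eventually
      (lt_mem_nhds (by simp only [Function.comp, hf1]; norm_num))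
  obtain ⟨r, hr, hr1⟩ := Metric.nhds_basis_closedBall.mem_iff.1 h1
  rw [Real.closedBall_eq_Icc] at hr1
  have hN' : ∀ θ ∈ Icc (θ₀ - r) (θ₀ + r), c' θ ∈ N := fun θ hθ =>
    hfN _ (lt_trans one_half_pos (hr1 hθ)).ne'
  have h2 : ∀ᶠ n in atTop, ∀ θ ∈ Icc (θ₀ - r) (θ₀ + r), c n θ ∈ N := by
    have h3 := tendstoLocallyUniformly_iff_forall_isCompact.1 (hlim f hf 0) _
      (isCompact_Icc (a := θ₀ - r) (b := θ₀ + r))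
    -- The bump exceeds 1/2 along the limit, so it cannot vanish on nearby curves; these therefore
    -- stay in `N`, where the global function `H` coincides with the chart.
    filter_upwards [Metric.tendstoUniformlyOn_iff.1 h3 (1 / 2) one_half_pos] with n hn θ hθ
    refine hfN _ fun h0 => ?_
    have h4 := hn θ hθ
    have h5 : (1 : ℝ) / 2 < f (c' θ) := hr1 hθ
    simp only [iteratedDeriv_zero, h0, Real.dist_eq, sub_zero] at h4
    exact (lt_irrefl _) (h5.trans ((le_abs_self _).trans_lt h4))
  have hsub : Icc (θ₀ - r / 2) (θ₀ + r / 2) ⊆ Ioo (θ₀ - r) (θ₀ + r) := fun θ hθ =>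
    ⟨by linarith [hθ.1], by linarith [hθ.2]⟩
  have hIcc := hsub.trans Ioo_subset_Icc_self
  have hcongr : ∀ {b : ℝ → M}, (∀ θ ∈ Icc (θ₀ - r) (θ₀ + r), b θ ∈ N) → ∀ i,
      EqOn (iteratedDeriv i fun s => H (b s))
        (iteratedDeriv i fun s => extChartAt (𝓡 2) (c' θ₀) (b s))
        (Icc (θ₀ - r / 2) (θ₀ + r / 2)) := fun hb i θ hθ => by
    refine Filter.EventuallyEq.iteratedDeriv_eq i ?_
    filter_upwards [Ioo_mem_nhds (hsub hθ).1 (hsub hθ).2] with s hs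
    exact hHN (hb s (Ioo_subset_Icc_self hs))
  have hHlim : ∀ i, TendstoUniformlyOn (fun n => iteratedDeriv i fun s => H (c n s))
      (iteratedDeriv i fun s => H (c' s)) atTop (Icc (θ₀ - r / 2) (θ₀ + r / 2)) := fun i => by
    have hcomp : ∀ l : Fin 2, TendstoUniformlyOn
        (fun n => iteratedDeriv i fun s => (H (c n s)) l)
        (iteratedDeriv i fun s => (H (c' s)) l) atTop (Icc (θ₀ - r / 2) (θ₀ + r / 2)) := fun l =>
      tendstoLocallyUniformly_iff_forall_isCompact.1 (hlim (fun x => (H x) l)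
        ((coordCLM l).contMDiff.comp hH) i) _ isCompact_Icc
    have hpr : ∀ {b : ℝ → M}, ContMDiff 𝓘(ℝ, ℝ) (𝓡 2) ∞ b → ∀ l : Fin 2,
        iteratedDeriv i (fun s => (H (b s)) l) = fun s => (iteratedDeriv i (fun s => H (b s)) s) l :=
      fun hb l => iteratedDeriv_clm_comp (coordCLM l)
        (hH.comp hb).contDiff i
    rw [Metric.tendstoUniformlyOn_iff]
    intro ε hε
    filter_upwards [Metric.tendstoUniformlyOn_iff.1 (hcomp 0) (ε / 2) (half_pos hε),
      Metric.tendstoUniformlyOn_iff.1 (hcomp 1) (ε / 2) (half_pos hε)] with n h3 h4 θ hθ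
    have h5 := h3 θ hθ
    have h6 := h4 θ hθ
    rw [hpr hc', hpr (hc n), Real.dist_eq] at h5 h6
    rw [dist_eq_norm]
    refine (norm_plane_le _).trans_lt ?_
    simp only [PiLp.sub_apply]
    linarith
  refine ⟨r / 2, half_pos hr, fun θ hθ => hNs (hN' θ (hIcc hθ)), ?_, fun i => ?_⟩
  · filter_upwards [h2] with n hn θ hθ using hNs (hn θ (hIcc hθ))
  · refine ((hHlim i).congr_right (hcongr hN' i)).congr ?_
    filter_upwards [h2] with n hn using hcongr hn i

end Surface

end DensityFlow
end

/-! ### Subconvergence to a minimal curve -/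

noncomputable section

namespace DensityFlow

theorem tendsto_clm_apply {E F : Type*} [NormedAddCommGroup E] [NormedSpace ℝ E]
    [NormedAddCommGroup F] [NormedSpace ℝ F] {L : ℕ → E →L[ℝ] F} {v : ℕ → E} {L₀ : E →L[ℝ] F} {v₀ : E}
    (hL : Tendsto L atTop (𝓝 L₀)) (hv : Tendsto v atTop (𝓝 v₀)) :
    Tendsto (fun k => L k (v k)) atTop (𝓝 (L₀ v₀)) :=
  ((continuous_fst.clm_apply continuous_snd : Continuous fun z : (E →L[ℝ] F) × E => z.1 z.2).tendsto
    (L₀, v₀)).comp (hL.prodMk_nhds hv)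

namespace PlaneGeometry

variable (S : PlaneGeometry)

/-- The curvature with density, multiplied by the speed, of a curve with velocity `a` and second
derivative `b` at `y`. -/
def psiCurv (y a b : Plane) : ℝ :=
  (S.G y a a)⁻¹ * S.G y (b + S.Γ y a a) (S.J y a) - fderiv ℝ S.ψ y (S.J y a)

theorem tendsto_psiCurv {y a b : ℕ → Plane} {y₀ a₀ b₀ : Plane} (hy₀ : y₀ ∈ S.Ω) (ha₀ : a₀ ≠ 0)
    (hy : Tendsto y atTop (𝓝 y₀)) (ha : Tendsto a atTop (𝓝 a₀)) (hb : Tendsto b atTop (𝓝 b₀)) :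
    Tendsto (fun k => S.psiCurv (y k) (a k) (b k)) atTop (𝓝 (S.psiCurv y₀ a₀ b₀)) := by
  have hn := S.isOpen.mem_nhds hy₀
  have hG := (S.smooth_G.continuousOn.continuousAt hn).tendsto.comp hy
  have hΓ := (S.smooth_Γ.continuousOn.continuousAt hn).tendsto.comp hy
  have hJ := tendsto_clm_apply ((S.smooth_J.continuousOn.continuousAt hn).tendsto.comp hy) ha
  have hψ := ((S.smooth_ψ.fderiv_of_isOpen S.isOpen (m := ∞) (by simp)).continuousOn.continuousAt
    hn).tendsto.comp hy
  exact (((tendsto_clm_apply (tendsto_clm_apply hG ha) ha).inv₀ (S.pos_G y₀ hy₀ a₀ ha₀).ne').mul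
    (tendsto_clm_apply (tendsto_clm_apply hG (hb.add (tendsto_clm_apply (tendsto_clm_apply hΓ ha) ha)))
      hJ)).sub (tendsto_clm_apply hψ hJ)

variable {S} {O : Set (ℝ × ℝ)} {x : ℝ × ℝ → Plane} {t ℓ u : ℝ} {φ : ℝ → ℝ}

/-- In this parameter the velocity is ℓ T, so the covariant acceleration is ℓ² ∇_s T. Speed and
curvature are thus expressed by the first two derivatives of the coordinates, and both pass to a C²
limit. -/
theorem IsRegular.constant_speed (h : S.IsRegular O x) (hℓ : 0 < ℓ)
    (hφ : ∀ᶠ s in 𝓝 u, HasDerivAt φ (ℓ / S.speed x (t, φ s)) s) (hq : (t, φ u) ∈ O) :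
    S.G (x (t, φ u)) (deriv (fun s => x (t, φ s)) u) (deriv (fun s => x (t, φ s)) u) = ℓ ^ 2 ∧
    S.psiCurv (x (t, φ u)) (deriv (fun s => x (t, φ s)) u) (deriv (deriv fun s => x (t, φ s)) u) =
      ℓ * S.kap x 0 (t, φ u) := by
  have hφu := hφ.self_of_nhds
  have hO : ∀ᶠ s in 𝓝 u, (t, φ s) ∈ O :=
    (continuousAt_const.prodMk hφu.continuousAt).preimage_mem_nhds (h.isOpen.mem_nhds hq)
  have hd : deriv (fun s => x (t, φ s)) =ᶠ[𝓝 u] fun s => ℓ • S.tang x (t, φ s) := by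
    filter_upwards [hφ, hO] with s h1 h2
    have h3 := (hasDerivAt_space (h.differentiableAt h2 h.smooth)).scomp s h1
    refine h3.deriv.trans ?_
    rw [tang, dS, smul_smul, div_eq_mul_inv]
  have hd2 : deriv (deriv fun s => x (t, φ s)) u =
      ℓ • (ℓ / S.speed x (t, φ u)) • dX (S.tang x) (t, φ u) := by
    rw [hd.deriv_eq]
    exact (((hasDerivAt_space (h.differentiableAt hq h.contDiffOn_tang)).scomp u hφu).const_smul ℓ).deriv
  rw [hd2, hd.self_of_nhds]
  set q := (t, φ u)
  have hT := h.G_tang_tang hq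
  have h1 : S.G (x q) (ℓ • S.tang x q) (ℓ • S.tang x q) = ℓ ^ 2 := by
    simp only [map_smul, smul_apply, hT, smul_eq_mul]; ring
  refine ⟨h1, ?_⟩
  have h2 : ℓ • (ℓ / S.speed x q) • dX (S.tang x) q + S.Γ (x q) (ℓ • S.tang x q) (ℓ • S.tang x q) =
      ℓ ^ 2 • ((S.speed x q)⁻¹ • S.covD x (0, 1) (S.tang x) q) := by
    have h3 : fderiv ℝ x q (0, 1) = S.speed x q • S.tang x q := h.dX_eq hq x
    have hv := (h.speed_pos hq).ne'
    simp only [covD, h3, map_smul, smul_apply, smul_add, smul_smul]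
    rw [inv_mul_cancel₀ hv, mul_one, ← sq, ← mul_div_assoc, ← sq, div_eq_mul_inv]
    rfl
  have h4 : S.J (x q) (ℓ • S.tang x q) = ℓ • S.nor x q := map_smul _ _ _
  rw [psiCurv, h1, h2, h4]
  simp only [kap, geoCurv]
  simp only [map_smul, smul_apply, smul_eq_mul]
  field_simp

end PlaneGeometry

section Surface

variable {M : Type*} [TopologicalSpace M] [ChartedSpace Plane M] [IsManifold (𝓡 2) ∞ M]
  {g : Metric M} {ψ : M → ℝ} (hψ : ContMDiff (𝓡 2) 𝓘(ℝ, ℝ) ∞ ψ) {γ : ℝ → ℝ → M} {U : Set M}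

/-- A regular curve whose curvature with density vanishes in coordinates is `ψ`-minimal. -/
theorem psiCurvature_eq_zero {c : ℝ → M} {u ℓ : ℝ} (hc : ContMDiff 𝓘(ℝ, ℝ) (𝓡 2) ∞ c) (hℓ : 0 < ℓ)
    (h1 : (chartGeometry g hψ (c u)).G (extChartAt (𝓡 2) (c u) (c u))
      (deriv (fun s => extChartAt (𝓡 2) (c u) (c s)) u)
      (deriv (fun s => extChartAt (𝓡 2) (c u) (c s)) u) = ℓ ^ 2)
    (h2 : (chartGeometry g hψ (c u)).psiCurv (extChartAt (𝓡 2) (c u) (c u))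
      (deriv (fun s => extChartAt (𝓡 2) (c u) (c s)) u)
      (deriv (deriv fun s => extChartAt (𝓡 2) (c u) (c s)) u) = 0) :
    velocity c u ≠ 0 ∧ psiCurvature g ψ c u = 0 := by
  set S := chartGeometry g hψ (c u)
  set y := extChartAt (𝓡 2) (c u) (c u)
  set a : Plane := deriv (fun s => extChartAt (𝓡 2) (c u) (c s)) u with ha
  have hy : y ∈ S.Ω := mem_extChartAt_target (c u)
  have ha0 : a ≠ 0 := fun h => by
    rw [h] at h1
    simp only [map_zero] at h1
    exact (pow_pos hℓ 2).ne h1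
  have hvel : velocity c u ≠ 0 := fun h => by
    have h3 := mfderiv_curve ((hc u).mdifferentiableAt (by simp)) (mem_chart_source Plane (c u))
    rw [chartDeriv_self] at h3
    exact ha0 (h3.symm.trans h)
  refine ⟨hvel, ?_⟩
  set W : Plane := psiCurvature g ψ c u with hW
  obtain ⟨h3, h4⟩ := psiCurvature_chart g hψ hc hvel (mem_chart_source Plane (c u)) (W := W)
    (chartDeriv_self _ _)
  have h5 : S.G y W (S.J y a) = 0 := (h4 _ (S.J_orth y hy a)).trans h2
  have h6 : S.G y W a = 0 := h3
  have hT : S.G y (ℓ⁻¹ • a) (ℓ⁻¹ • a) = 1 := by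
    simp only [map_smul, smul_apply, smul_eq_mul, h1]; field_simp
  have hN : S.G y (ℓ⁻¹ • S.J y a) (ℓ⁻¹ • S.J y a) = 1 := by
    simp only [map_smul, smul_apply, smul_eq_mul, S.J_norm y hy, h1]; field_simp
  have hTN : S.G y (ℓ⁻¹ • a) (ℓ⁻¹ • S.J y a) = 0 := by
    simp only [map_smul, smul_apply, smul_eq_mul, S.J_orth y hy, mul_zero]
  have h7 := eq_add_of_orthonormal (S.symm_G y) (S.pos_G y hy) hT hN hTN W
  simp only [map_smul, h5, h6, smul_zero, zero_smul, add_zero] at h7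
  exact h7

namespace IsPsiMCF

/-- With constant speed ℓ the parameter derivative is ℓ `∂_s`, and ℓ commutes with everything. -/
theorem iteratedDeriv_constant_speed (hγ : IsPsiMCF g ψ γ) {t ℓ : ℝ} (ht : 0 < t) {φ : ℝ → ℝ}
    (hφ : ∀ u, HasDerivAt φ (ℓ / flowSpeed g hψ γ (t, φ u)) u) {F : ℝ × ℝ → ℝ}
    (hF : ContDiffOn ℝ ∞ F {q | 0 < q.1}) (j : ℕ) :
    ContDiffOn ℝ ∞ ((arcDeriv g hψ γ)^[j] F) {q | 0 < q.1} ∧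
    iteratedDeriv j (fun u => F (t, φ u)) = fun u => ℓ ^ j * (arcDeriv g hψ γ)^[j] F (t, φ u) := by
  induction j with
  | zero => exact ⟨hF, by simp⟩
  | succ j ih =>
    rw [Function.iterate_succ_apply']
    refine ⟨hγ.contDiffOn_arcDeriv hψ ih.1, ?_⟩
    rw [iteratedDeriv_succ, ih.2]
    funext u
    refine (((hasDerivAt_slice_space ih.1 ht (φ u)).comp u (hφ u)).const_mul _).deriv.trans ?_
    simp only [arcDeriv]
    ring

theorem antitone_length (hγ : IsPsiMCF g ψ γ) : AntitoneOn (fun t => ∫ θ in (0 : ℝ)..(2 * Real.pi),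
    flowDensity ψ γ (t, θ) * flowSpeed g hψ γ (t, θ)) (Ici 1) := by
  have hμ := (hγ.contDiffOn_flowDensity hψ).mul (hγ.contDiffOn_flowSpeed hψ)
  have hd := fun t (ht : (0 : ℝ) < t) => hasDerivAt_integral_slice hμ ht 0 (2 * Real.pi)
  refine antitoneOn_of_deriv_nonpos (convex_Ici 1)
    (fun t ht => (hd t (one_pos.trans_le ht)).continuousAt.continuousWithinAt)
    (fun t ht => (hd t (one_pos.trans_le (interior_subset ht))).differentiableAt.differentiableWithinAt)
    fun t ht => ?_
  have ht0 : 0 < t := one_pos.trans_le (interior_subset ht)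
  refine (hd t ht0).deriv.trans_le ?_
  have h := intervalIntegral.integral_nonneg (μ := volume) (f := fun θ => -dT (fun q =>
    flowDensity ψ γ q * flowSpeed g hψ γ q) (t, θ)) Real.two_pi_pos.le fun θ _ => by
      rw [hγ.dT_flowDensity_mul_speed hψ ht0]
      have h1 : 0 ≤ curvSq g hψ γ 0 (t, θ) := curvSq_nonneg hψ 0
      have h2 : 0 < flowDensity ψ γ (t, θ) := Real.exp_pos _
      have h3 := hγ.flowSpeed_pos hψ (q := (t, θ)) ht0
      have := mul_nonneg h1 (mul_pos h2 h3).le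
      linarith
  rw [intervalIntegral.integral_neg] at h
  exact neg_nonneg.1 h

/-- The weighted length lies between its positive lower bound and its value at time 1, and bounds
for the density transfer this to the length. -/
theorem exists_length_bounds [T2Space M] [FirstCountableTopology M] (hγ : IsPsiMCF g ψ γ)
    (hU : IsCompact U) (hγU : ∀ t, 0 ≤ t → ∀ θ, γ t θ ∈ U) :
    ∃ a b : ℝ, 0 < a ∧ ∀ t ≥ 1,
      (∫ θ in (0 : ℝ)..(2 * Real.pi), flowSpeed g hψ γ (t, θ)) / (2 * Real.pi) ∈ Icc a b := by
  obtain ⟨L₀, hL₀, hL⟩ := hγ.exists_le_length hψ hU hγU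
  obtain ⟨E, hE, D, hD, hED⟩ := exists_flowDensity_bounds hψ hU hγU
  have hanti := hγ.antitone_length hψ
  set L : ℝ → ℝ := fun t => ∫ θ in (0 : ℝ)..(2 * Real.pi),
    flowDensity ψ γ (t, θ) * flowSpeed g hψ γ (t, θ) with hLdef
  have hπ := Real.two_pi_pos
  refine ⟨L₀ / D / (2 * Real.pi), L 1 / E / (2 * Real.pi), by positivity, fun t ht => ?_⟩
  have ht0 : 0 < t := one_pos.trans_le ht
  have hv := continuous_slice (hγ.contDiffOn_flowSpeed hψ) ht0
  have hμ := continuous_slice ((hγ.contDiffOn_flowDensity hψ).mul (hγ.contDiffOn_flowSpeed hψ)) ht0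
  have h1 : L t ≤ D * ∫ θ in (0 : ℝ)..(2 * Real.pi), flowSpeed g hψ γ (t, θ) := by
    rw [← intervalIntegral.integral_const_mul]
    exact intervalIntegral.integral_mono_on hπ.le (hμ.intervalIntegrable _ _)
      ((hv.const_mul _).intervalIntegrable _ _) fun θ _ =>
      mul_le_mul_of_nonneg_right (hED (t, θ) ht0).2 (hγ.flowSpeed_pos hψ ht0).le
  have h2 : E * (∫ θ in (0 : ℝ)..(2 * Real.pi), flowSpeed g hψ γ (t, θ)) ≤ L t := by
    rw [← intervalIntegral.integral_const_mul]
    exact intervalIntegral.integral_mono_on hπ.le ((hv.const_mul _).intervalIntegrable _ _)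
      (hμ.intervalIntegrable _ _) fun θ _ =>
      mul_le_mul_of_nonneg_right (hED (t, θ) ht0).1 (hγ.flowSpeed_pos hψ ht0).le
  have h3 : L t ≤ L 1 := hanti (mem_Ici.2 le_rfl) (mem_Ici.2 ht) ht
  constructor
  · refine div_le_div_of_nonneg_right ?_ hπ.le
    rw [div_le_iff₀ hD]
    linarith [hL t ht0]
  · refine div_le_div_of_nonneg_right ?_ hπ.le
    rw [le_div_iff₀ hE]
    linarith

/-- A flow in a compact set, parametrized by a multiple of the arc length at integer times,
subconverges smoothly to a closed `ψ`-minimal curve. -/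
theorem exists_subsequence [T2Space M] [FirstCountableTopology M] (hγ : IsPsiMCF g ψ γ)
    (hU : IsCompact U) (hγU : ∀ t, 0 ≤ t → ∀ θ, γ t θ ∈ U) {Φ : ℕ → ℝ → ℝ}
    (hΦsm : ∀ n, ContDiff ℝ ∞ (Φ n)) (hΦadd : ∀ n u, Φ n (u + 2 * Real.pi) = Φ n u + 2 * Real.pi)
    (hΦ : ∀ n ≥ 1, ∀ u, HasDerivAt (Φ n) (((∫ θ in (0 : ℝ)..(2 * Real.pi),
      flowSpeed g hψ γ (n, θ)) / (2 * Real.pi)) / flowSpeed g hψ γ (n, Φ n u)) u) :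
    ∃ (n : ℕ → ℕ) (c' : ℝ → M), Tendsto n atTop atTop ∧ IsClosedPsiMinimal g ψ c' ∧
      ∀ m, CmConverges m (fun k u => γ (n k) (Φ (n k) u)) c' := by
  obtain ⟨a, b, ha, hab⟩ := hγ.exists_length_bounds hψ hU hγU
  set ℓ : ℕ → ℝ := fun n => (∫ θ in (0 : ℝ)..(2 * Real.pi), flowSpeed g hψ γ (n, θ)) / (2 * Real.pi)
  have h1n : ∀ k : ℕ, (1 : ℝ) ≤ (k + 1 : ℕ) := fun k => by push_cast; linarith [k.cast_nonneg (α := ℝ)]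
  -- The speeds subconverge to a positive limit, which will make the limit curve regular. The shift
  -- by 1 keeps the times at least 1, where the estimates hold.
  obtain ⟨ℓ₀, hℓ₀, ν, hν, hℓlim⟩ := (isCompact_Icc (a := a) (b := b)).isSeqCompact
    (x := fun k => ℓ (k + 1)) fun k => hab _ (h1n k)
  have hn1 : ∀ k, (1 : ℝ) ≤ (ν k + 1 : ℕ) := fun k => h1n _
  have hn0 : ∀ k, (0 : ℝ) < (ν k + 1 : ℕ) := fun k => one_pos.trans_le (hn1 k)
  have hΦ' := fun k => hΦ (ν k + 1) (by omega)
  obtain ⟨μ, c', hμ, hc', hpt, hlim⟩ := exists_limit_curve hU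
    (c := fun k u => γ (ν k + 1 : ℕ) (Φ (ν k + 1) u)) (fun k u => hγU _ (hn0 k).le _)
    (fun k => (hγ.closed _ (hn0 k).le).smooth.comp (hΦsm _).contMDiff) (fun f hf j => by
      obtain ⟨B, hB, hBj⟩ := hγ.exists_curvSq_le hψ hU hγU j
      obtain ⟨C, hC, hCb⟩ := hγ.exists_abs_iterate_arcDeriv_le hψ hU hγU hf (B ^ 2) j
      refine ⟨b ^ j * C, fun k u => ?_⟩
      have h := (hγ.iteratedDeriv_constant_speed hψ (hn0 k) (hΦ' k) (hγ.contDiffOn_comp hf) j).2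
      simp only at h
      rw [h, abs_mul]
      have hℓk := hab _ (hn1 k)
      have h2 : 0 ≤ ℓ (ν k + 1) := ha.le.trans hℓk.1
      refine mul_le_mul ?_ (hCb _ (hn0 k) fun i hi => hBj i hi _ (hn1 k) _) (abs_nonneg _)
        (pow_nonneg (h2.trans hℓk.2) _)
      rw [abs_pow, abs_of_nonneg h2]
      exact pow_le_pow_left₀ h2 hℓk.2 j)
  set n : ℕ → ℕ := fun k => ν (μ k) + 1 with hn
  have hntop : Tendsto n atTop atTop :=
    tendsto_atTop_mono (fun k => Nat.le_succ _) (hν.comp hμ).tendsto_atTop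
  have hcsm : ∀ k, ContMDiff 𝓘(ℝ, ℝ) (𝓡 2) ∞ fun u => γ (n k) (Φ (n k) u) := fun k =>
    (hγ.closed _ (hn0 (μ k)).le).smooth.comp (hΦsm _).contMDiff
  have hchart := tendstoUniformlyOn_chart hcsm hc' hlim
  have hmin : ∀ u, velocity c' u ≠ 0 ∧ psiCurvature g ψ c' u = 0 := fun u => by
    obtain ⟨δ, hδ, -, hsrc, hunif⟩ := hchart u
    have hu : u ∈ Icc (u - δ) (u + δ) := ⟨by linarith, by linarith⟩
    set p := c' u
    set S := chartGeometry g hψ p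
    set x := chartCoord γ p
    have h0 := (hunif 0).tendsto_at hu
    have h1 := (hunif 1).tendsto_at hu
    have h2 := (hunif 2).tendsto_at hu
    simp only [iteratedDeriv_zero] at h0
    simp only [iteratedDeriv_one] at h1
    simp only [iteratedDeriv_succ, iteratedDeriv_zero] at h2
    have hℓ0 : 0 < ℓ₀ := ha.trans_le hℓ₀.1
    have hℓlim' : Tendsto (fun k => ℓ (n k)) atTop (𝓝 ℓ₀) := hℓlim.comp hμ.tendsto_atTop
    have hflow : ∀ᶠ k in atTop, (((n k : ℕ) : ℝ), Φ (n k) u) ∈ chartDomain γ p := by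
      filter_upwards [hsrc] with k hk using ⟨hn0 (μ k), hk u hu⟩
    have hpos : ∀ k, 0 < ℓ (n k) := fun k => ha.trans_le (hab _ (hn1 (μ k))).1
    have hkey := hflow.mono fun k hk => (hγ.isRegular hψ p).constant_speed (hpos k) (u := u)
      (φ := Φ (n k)) (by
        have h3 : ∀ᶠ s in 𝓝 u, (((n k : ℕ) : ℝ), Φ (n k) s) ∈ chartDomain γ p :=
          (continuous_const.prodMk (hΦsm (n k)).continuous).continuousAt.preimage_mem_nhds
            ((hγ.isOpen_chartDomain p).mem_nhds hk)
        filter_upwards [h3] with s hs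
        rw [← hγ.flowSpeed_eq hψ hs]
        exact hΦ' (μ k) s) hk
    have hyΩ : extChartAt (𝓡 2) p (c' u) ∈ S.Ω := mem_extChartAt_target p
    have hGlim := tendsto_clm_apply (tendsto_clm_apply ((S.smooth_G.continuousOn.continuousAt
      (S.isOpen.mem_nhds hyΩ)).tendsto.comp h0) h1) h1
    have e1 : S.G (extChartAt (𝓡 2) p (c' u)) (deriv (fun s => extChartAt (𝓡 2) p (c' s)) u)
        (deriv (fun s => extChartAt (𝓡 2) p (c' s)) u) = ℓ₀ ^ 2 :=
      tendsto_nhds_unique (hGlim.congr' (hkey.mono fun k hk => hk.1)) (hℓlim'.pow 2)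
    refine psiCurvature_eq_zero hψ hc' hℓ0 e1 ?_
    have ha0 : deriv (fun s => extChartAt (𝓡 2) p (c' s)) u ≠ 0 := fun h => by
      rw [h] at e1
      simp only [map_zero] at e1
      exact (pow_pos hℓ0 2).ne e1
    -- The curvature tends to zero uniformly in the parameter, so the moving parameter value `Φ (n
    -- k) u` does no harm.
    have hκ : Tendsto (fun k => S.kap x 0 (((n k : ℕ) : ℝ), Φ (n k) u)) atTop (𝓝 0) := by
      rw [Metric.tendsto_nhds]
      intro ε hε
      obtain ⟨T, hT⟩ := hγ.exists_curvSq_zero_le hψ hU hγU (show 0 < (ε / 2) ^ 2 by positivity)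
      have hnT : Tendsto (fun k => ((n k : ℕ) : ℝ)) atTop atTop :=
        tendsto_natCast_atTop_atTop.comp hntop
      filter_upwards [hflow, hnT.eventually_ge_atTop T] with k hk hkT
      have h3 := hT _ hkT (Φ (n k) u)
      rw [hγ.curvSq_eq hψ hk] at h3
      rw [Real.dist_eq, sub_zero]
      exact (abs_le_of_sq_le_sq h3 (by positivity)).trans_lt (by linarith)
    have h3 := (S.tendsto_psiCurv hyΩ ha0 h0 h1 h2).congr' (hkey.mono fun k hk => hk.2)
    have h4 := hℓlim'.mul hκ
    rw [mul_zero] at h4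
    exact tendsto_nhds_unique h3 h4
  refine ⟨n, c', hntop, ⟨⟨hc', fun u => ?_, fun u => (hmin u).1⟩, fun u => (hmin u).2⟩, fun m θ₀ => ?_⟩
  · refine tendsto_nhds_unique (hpt (u + 2 * Real.pi)) ((hpt u).congr fun k => ?_)
    rw [hΦadd]
    exact ((hγ.closed _ (hn0 (μ k)).le).periodic _).symm
  · obtain ⟨δ, hδ, hs1, hs2, hunif⟩ := hchart θ₀
    exact ⟨δ, hδ, hs1, hs2, fun i _ => hunif i⟩

end IsPsiMCF

end Surface

end DensityFlow
end

/-! ### The convergence theorem -/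

theorem theorem3 {M : Type*} [TopologicalSpace M] [T2Space M] [SecondCountableTopology M]
    [ChartedSpace (EuclideanSpace ℝ (Fin 2)) M] [IsManifold (𝓡 2) ∞ M]
    (g : Bundle.ContMDiffRiemannianMetric (𝓡 2) ∞ (EuclideanSpace ℝ (Fin 2))
      (fun x : M => TangentSpace (𝓡 2) x))
    (ψ : M → ℝ) (hψ : ContMDiff (𝓡 2) 𝓘(ℝ, ℝ) ∞ ψ)
    (hI : DensityFlow.IsoperimetricCondition g)
    (γ₀ : ℝ → M) (hγ₀ : DensityFlow.IsEmbeddedClosedCurve γ₀)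
    (γ : ℝ → ℝ → M) (hγ : DensityFlow.IsPsiMCF g ψ γ) (hinit : γ 0 = γ₀)
    (U : Set M) (hU : IsCompact U) (hγU : ∀ t, 0 ≤ t → ∀ θ, γ t θ ∈ U)
    (hgeom : DensityFlow.BoundedGeometryOn g ψ U) :
    ∃ φ : ℝ → ℝ → ℝ, DensityFlow.IsReparametrization φ ∧
      ∀ m : ℕ, ∃ (t : ℕ → ℝ) (c : ℝ → M), (∀ k, 0 ≤ t k) ∧ Tendsto t atTop atTop ∧
        DensityFlow.IsClosedPsiMinimal g ψ c ∧
        DensityFlow.CmConverges m (fun k u => γ (t k) (φ (t k) u)) c := by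
  have hex : ∀ n : ℕ, ∃ φ : ℝ → ℝ, ContDiff ℝ ∞ φ ∧
      (∀ u, φ (u + 2 * Real.pi) = φ u + 2 * Real.pi) ∧ (∀ u, 0 < deriv φ u) ∧
      (n ≥ 1 → ∀ u, HasDerivAt φ (((∫ θ in (0 : ℝ)..(2 * Real.pi),
        DensityFlow.flowSpeed g hψ γ (n, θ)) / (2 * Real.pi)) /
          DensityFlow.flowSpeed g hψ γ (n, φ u)) u) := by
    intro n
    rcases Nat.eq_zero_or_pos n with rfl | hn
    -- The estimates concern positive times only; at time 0 any reparametrization will do.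
    · exact ⟨id, contDiff_id, fun _ => rfl, fun u => by simp, fun h => by omega⟩
    · have hn0 : (0 : ℝ) < n := Nat.cast_pos.2 hn
      have hv := DensityFlow.contDiff_slice (hγ.contDiffOn_flowSpeed hψ) hn0
      have hpos : ∀ θ, 0 < DensityFlow.flowSpeed g hψ γ ((n : ℝ), θ) := fun θ =>
        hγ.flowSpeed_pos hψ hn0
      obtain ⟨φ, h1, h2, h3⟩ := DensityFlow.exists_constant_speed Real.two_pi_pos hv hpos
        (hγ.flowSpeed_periodic hψ hn0)
      refine ⟨φ, h1, h2, fun u => ?_, fun _ => h3⟩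
      rw [(h3 u).deriv]
      exact div_pos (div_pos (intervalIntegral.intervalIntegral_pos_of_pos
        (hv.continuous.intervalIntegrable _ _) hpos Real.two_pi_pos) Real.two_pi_pos) (hpos _)
  choose Φ hΦsm hΦadd hΦpos hΦ using hex
  obtain ⟨φ, hφ, hφn⟩ := DensityFlow.exists_isReparametrization hΦsm hΦadd hΦpos
  obtain ⟨n, c, hn, hc, hconv⟩ := hγ.exists_subsequence hψ hU hγU hΦsm hΦadd hΦ
  refine ⟨φ, hφ, fun m => ⟨fun k => n k, c, fun k => Nat.cast_nonneg _,
    tendsto_natCast_atTop_atTop.comp hn, hc, ?_⟩⟩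
  simp only [hφn]
  exact hconv m
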